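/- A dga means a differential graded algebra over $\mathbb{Z}$: a $\mathbb{Z}$-graded (possibly unbounded) associative unital ring $A=\bigoplus_i A_i$, not necessarily commutative, with a differential $d\colon A_i\to A_{i-1}$ satisfying $d^2=0$ and $d(xy)=d(x)\,y+(-1)^{|x|}x\,d(y)$. Two dgas are quasi-isomorphic if they are connected by a finite zig-zag of dga maps inducing isomorphisms on homology. Let $p$ be a prime and let $\Lambda_{\mathbb{F}_p}(g_n)=\mathbb{F}_p\oplus\mathbb{F}_p\,g_n$, with $g_n^2=0$ and $|g_n|=n$, be the exterior algebra on one generator of degree $n$. Consider the dgas $C$ whose homology $H_*(C)$ is isomorphic to $\Lambda_{\mathbb{F}_p}(g_n)$ as a graded ring. (1) If $n\ge 1$ is odd, there is exactly one quasi-isomorphism type of such dgas, namely that of $\Lambda_{\mathbb{F}_p}(g_n)$ with zero differential. (2) If $n\ge 2$ is even, there are exactly two quasi-isomorphism types of such dgas: the trivial one, that of $\Lambda_{\mathbb{F}_p}(g_n)$ with zero differential, and one other, the exotic one. (3) For $n=2$ the exotic type is represented by $\mathbb{Z}[e;\,de=p]/(e^3,\,pe^2)$ with $|e|=1$. (4)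 For $n=4$ the exotic type is represented by $$\mathbb{Z}\langle e,f;\ de=p,\ df=e^2\rangle/(e^4,\ e^2f,\ efe,\ fe^2,\ fef,\ f^2,\ p(ef+fe))$$ with $|e|=1$ and $|f|=3$. -/

import Mathlib

open scoped DirectSum

universe u

namespace DGA

/-- A decomposition from an additive map that is a section of the sum map and is the inclusion on
homogeneous elements. -/
@[reducible] def decompositionOfHom {M : Type*} [AddCommGroup M] (ℳ : ℤ → AddSubgroup M)
    (f : M →+ ⨁ i, ℳ i) (h₁ : ∀ x, DirectSum.coeAddMonoidHom ℳ (f x) = x)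
    (h₂ : ∀ (i : ℤ) (x : ℳ i), f x = DirectSum.of (fun i => ℳ i) i x) :
    DirectSum.Decomposition ℳ :=
  DirectSum.Decomposition.ofAddHom ℳ f (AddMonoidHom.ext h₁)
    (DirectSum.addHom_ext fun i x => by
      simp only [AddMonoidHom.comp_apply, DirectSum.coeAddMonoidHom_of, h₂, AddMonoidHom.id_apply])

theorem of_eq_zero {M : Type*} [AddCommGroup M] {ℳ : ℤ → AddSubgroup M} {i : ℤ} {x : ℳ i}
    (h : (x : M) = 0) : DirectSum.of (fun i => ℳ i) i x = 0 := by
  rw [show x = 0 from Subtype.ext h, map_zero]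

theorem of_congr {M : Type*} [AddCommGroup M] {ℳ : ℤ → AddSubgroup M} {i j : ℤ} {x : ℳ i}
    {y : ℳ j} (hij : i = j) (h : (x : M) = y) :
    DirectSum.of (fun i => ℳ i) i x = DirectSum.of (fun i => ℳ i) j y := by
  subst hij
  rw [show x = y from Subtype.ext h]

/-- A differential graded algebra over `ℤ`: an associative unital ring with an (unbounded)
internal `ℤ`-grading `A = ⨁ Aᵢ`, and an additive differential of degree `-1` with `d ∘ d = 0`
satisfying the graded Leibniz rule. No commutativity is required. -/
structure _root_.DGA : Type (u + 1) where
  carrier : Type u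
  [ring : Ring carrier]
  deg : ℤ → AddSubgroup carrier
  [graded : GradedRing deg]
  d : carrier →+ carrier
  d_mem : ∀ {i : ℤ} {x : carrier}, x ∈ deg i → d x ∈ deg (i - 1)
  d_d : ∀ x : carrier, d (d x) = 0
  leibniz : ∀ {i : ℤ} {x : carrier} (y : carrier), x ∈ deg i →
    d (x * y) = d x * y + (i.negOnePow : ℤ) • (x * d y)


instance : CoeSort DGA.{u} (Type u) := ⟨DGA.carrier⟩

attribute [instance] DGA.ring DGA.graded

section Basic

variable (C : DGA.{u})

theorem induction_homogeneous {P : C → Prop} (zero : P 0)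
    (hom : ∀ (i : ℤ) (x : C), x ∈ C.deg i → P x) (add : ∀ x y, P x → P y → P (x + y)) (x : C) :
    P x :=
  DirectSum.Decomposition.inductionOn C.deg (motive := P) zero
    (fun {i} m => hom i m m.2) add x

/-- The sign automorphism `x ↦ (-1)^|x| x`, extended additively. -/
noncomputable def sgn : C →+ C :=
  (DirectSum.toAddMonoid fun i : ℤ => (i.negOnePow : ℤ) • (C.deg i).subtype).comp
    (DirectSum.decomposeAddEquiv C.deg).toAddMonoidHom

theorem sgn_of_mem {i : ℤ} {x : C} (hx : x ∈ C.deg i) : C.sgn x = (i.negOnePow : ℤ) • x := by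
  simp [sgn, DirectSum.decompose_of_mem C.deg hx]

theorem sgn_sgn (x : C) : C.sgn (C.sgn x) = x := by
  induction x using C.induction_homogeneous with
  | zero => simp
  | hom i x hx =>
    rw [C.sgn_of_mem hx, map_zsmul, C.sgn_of_mem hx, smul_smul, ← Units.val_mul]
    simp
  | add x y hx hy => simp [hx, hy]

theorem sgn_d (x : C) : C.sgn (C.d x) = -C.d (C.sgn x) := by
  induction x using C.induction_homogeneous with
  | zero => simp
  | hom i x hx =>
    rw [C.sgn_of_mem hx, C.sgn_of_mem (C.d_mem hx), map_zsmul, Int.negOnePow_sub]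
    simp
  | add x y hx hy => simp only [map_add, hx, hy]; abel

theorem d_mul (x y : C) : C.d (x * y) = C.d x * y + C.sgn x * C.d y := by
  induction x using C.induction_homogeneous with
  | zero => simp
  | hom i x hx => rw [C.leibniz y hx, C.sgn_of_mem hx, smul_mul_assoc]
  | add x x' hx hx' => simp only [map_add, add_mul, hx, hx']; abel

theorem d_one : C.d 1 = 0 := by
  have h := C.leibniz (1 : C) (SetLike.GradedOne.one_mem (A := C.deg))
  simpa using h

/-! ### Homology -/

/-- The subring of cycles. -/
def cycles : Subring C where
  carrier := {x | C.d x = 0}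
  mul_mem' {x y} hx hy := by
    simp only [Set.mem_ofPred_eq] at hx hy ⊢
    rw [C.d_mul, hx, hy, zero_mul, mul_zero, add_zero]
  one_mem' := C.d_one
  add_mem' {x y} hx hy := by
    simp only [Set.mem_ofPred_eq] at hx hy ⊢
    rw [map_add, hx, hy, add_zero]
  zero_mem' := map_zero _
  neg_mem' {x} hx := by
    simp only [Set.mem_ofPred_eq] at hx ⊢
    rw [map_neg, hx, neg_zero]

theorem d_coe_cycles (x : C.cycles) : C.d (x : C) = 0 := x.2

/-- The two-sided ideal of boundaries in the ring of cycles. -/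
def boundaries : Ideal C.cycles where
  carrier := {x | ∃ y : C, C.d y = x}
  add_mem' := by
    rintro x x' ⟨y, hy⟩ ⟨y', hy'⟩
    exact ⟨y + y', by simp [hy, hy']⟩
  zero_mem' := ⟨0, by simp⟩
  smul_mem' := by
    rintro z x ⟨y, hy⟩
    refine ⟨C.sgn z * y, ?_⟩
    have h : C.d (C.sgn (z : C)) = 0 := by
      have := C.sgn_d z
      rw [C.d_coe_cycles, map_zero] at this
      exact neg_eq_zero.mp this.symm
    rw [C.d_mul, h, C.sgn_sgn, hy]
    simp

instance : C.boundaries.IsTwoSided where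
  mul_mem_of_left := by
    rintro x z ⟨y, hy⟩
    refine ⟨y * z, ?_⟩
    rw [C.d_mul, C.d_coe_cycles, hy]
    simp

/-- The homology ring `H_*(C)`: cycles modulo boundaries. -/
abbrev Homology : Type u := C.cycles ⧸ C.boundaries

/-- The group `H_i(C)` inside `H_*(C)`: the classes of the cycles of degree `i`. -/
def homologyDeg (i : ℤ) : AddSubgroup C.Homology :=
  ((C.deg i).comap C.cycles.subtype.toAddMonoidHom).map
    (Ideal.Quotient.mk C.boundaries).toAddMonoidHom

end Basic

/-! ### Maps and quasi-isomorphisms -/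

/-- A map of dgas: a unital ring homomorphism that preserves degrees and commutes with the
differentials. -/
structure Hom (C D : DGA.{u}) extends C.carrier →+* D.carrier where
  map_deg : ∀ {i : ℤ} {x : C.carrier}, x ∈ C.deg i → toRingHom x ∈ D.deg i
  map_d : ∀ x : C.carrier, toRingHom (C.d x) = D.d (toRingHom x)

/-- The map on cycles induced by a map of dgas. -/
def Hom.cyclesMap {C D : DGA.{u}} (f : Hom C D) : C.cycles →+* D.cycles :=
  (f.toRingHom.comp C.cycles.subtype).codRestrict D.cycles fun x => by
    change D.d (f.toRingHom x) = 0
    rw [← f.map_d, C.d_coe_cycles, map_zero]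

/-- The ring map `H_*(C) → H_*(D)` induced by a map of dgas. -/
def Hom.homologyMap {C D : DGA.{u}} (f : Hom C D) : C.Homology →+* D.Homology :=
  Ideal.quotientMap D.boundaries f.cyclesMap <| by
    rintro x ⟨y, hy⟩
    exact ⟨f.toRingHom y, by rw [← f.map_d, hy]; rfl⟩

/-- A quasi-isomorphism is a map of dgas inducing an isomorphism on homology. -/
def Hom.IsQuasiIso {C D : DGA.{u}} (f : Hom C D) : Prop :=
  Function.Bijective f.homologyMap

/-- Two dgas are quasi-isomorphic if they are connected by a finite zig-zag of
quasi-isomorphisms. -/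
def QuasiIsomorphic : DGA.{u} → DGA.{u} → Prop :=
  Relation.EqvGen fun C D => ∃ f : Hom C D, f.IsQuasiIso

/-! ### The graded algebra `Λ_{𝔽_p}(g_n)` and the trivial dga -/

/-- The exterior algebra `Λ_{𝔽_p}(g) = 𝔽_p ⊕ 𝔽_p g`, `g² = 0`, on one generator. -/
abbrev ExteriorRing (p : ℕ) : Type u := DualNumber (ULift.{u} (ZMod p))

/-- The grading of `Λ_{𝔽_p}(g_n)`: scalars in degree `0` and the generator `g` in degree `n`. -/
def exteriorDeg (p : ℕ) (n i : ℤ) : AddSubgroup (ExteriorRing.{u} p) where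
  carrier := {x | (i ≠ 0 → x.fst = 0) ∧ (i ≠ n → x.snd = 0)}
  add_mem' {x y} hx hy :=
    ⟨fun h => by simp [hx.1 h, hy.1 h], fun h => by simp [hx.2 h, hy.2 h]⟩
  zero_mem' := by simp
  neg_mem' {x} hx := ⟨fun h => by simp [hx.1 h], fun h => by simp [hx.2 h]⟩

theorem inl_mem_exteriorDeg (p : ℕ) (n : ℤ) (a : ULift.{u} (ZMod p)) :
    (TrivSqZeroExt.inl a : ExteriorRing p) ∈ exteriorDeg p n 0 :=
  ⟨fun h => absurd rfl h, fun _ => by simp⟩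

theorem inr_mem_exteriorDeg (p : ℕ) (n : ℤ) (a : ULift.{u} (ZMod p)) :
    (TrivSqZeroExt.inr a : ExteriorRing p) ∈ exteriorDeg p n n :=
  ⟨fun _ => by simp, fun h => absurd rfl h⟩

noncomputable instance (p : ℕ) (n : ℤ) : GradedRing (exteriorDeg.{u} p n) where
  one_mem := inl_mem_exteriorDeg p n 1
  mul_mem i j x y hx hy := by
    obtain ⟨hx1, hx2⟩ := hx
    obtain ⟨hy1, hy2⟩ := hy
    refine ⟨fun h => ?_, fun h => ?_⟩
    · rw [TrivSqZeroExt.fst_mul]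
      by_cases hi : i = 0
      · rw [hy1 (by rintro rfl; simp [hi] at h), mul_zero]
      · rw [hx1 hi, zero_mul]
    · rw [TrivSqZeroExt.snd_mul]
      by_cases hi : i = 0
      · subst hi
        rw [hy2 (by simpa using h), smul_zero, zero_add]
        by_cases hj : j = 0
        · subst hj
          rw [hx2 (by simpa using h), smul_zero]
        · rw [hy1 hj, MulOpposite.op_zero, zero_smul]
      · rw [hx1 hi, zero_smul, zero_add]
        by_cases hj : j = 0
        · subst hj
          rw [hx2 (by simpa using h), smul_zero]
        · rw [hy1 hj, MulOpposite.op_zero, zero_smul]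
  toDecomposition := decompositionOfHom _
    { toFun := fun x =>
        DirectSum.of (fun i => exteriorDeg.{u} p n i) 0 ⟨.inl x.fst, inl_mem_exteriorDeg p n _⟩ +
          DirectSum.of (fun i => exteriorDeg.{u} p n i) n ⟨.inr x.snd, inr_mem_exteriorDeg p n _⟩
      map_zero' := by
        rw [of_eq_zero (by ext <;> simp), of_eq_zero (by ext <;> simp), add_zero]
      map_add' := fun a b => by
        rw [add_add_add_comm, ← map_add, ← map_add]
        congr 1 <;> exact of_congr rfl (by ext <;> simp) }
    (fun x => by
      simp only [AddMonoidHom.coe_mk, ZeroHom.coe_mk]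
      rw [map_add, DirectSum.coeAddMonoidHom_of, DirectSum.coeAddMonoidHom_of]
      exact TrivSqZeroExt.inl_fst_add_inr_snd_eq x)
    (fun i x => by
      obtain ⟨x, hx⟩ := x
      simp only [AddMonoidHom.coe_mk, ZeroHom.coe_mk]
      by_cases h : i = 0 <;> by_cases h' : i = n
      · rw [of_congr (j := i) (y := ⟨.inl x.fst, h ▸ inl_mem_exteriorDeg p n _⟩) h.symm rfl,
          of_congr (j := i) (y := ⟨.inr x.snd, h' ▸ inr_mem_exteriorDeg p n _⟩) h'.symm rfl,
          ← map_add]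
        exact of_congr rfl (TrivSqZeroExt.inl_fst_add_inr_snd_eq x)
      · rw [of_eq_zero (i := n) (by ext <;> simp [hx.2 h']), add_zero]
        exact of_congr h.symm (by ext <;> simp [hx.2 h'])
      · rw [of_eq_zero (i := 0) (by ext <;> simp [hx.1 h]), zero_add]
        exact of_congr h'.symm (by ext <;> simp [hx.1 h])
      · rw [of_eq_zero (i := n) (by ext <;> simp [hx.2 h']),
          of_eq_zero (i := 0) (by ext <;> simp [hx.1 h]), add_zero,
          of_eq_zero (by ext <;> simp [hx.1 h, hx.2 h'])])

/-- The exterior algebra `Λ_{𝔽_p}(g_n)` regarded as a dga with zero differential. -/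
noncomputable def exterior (p : ℕ) (n : ℤ) : DGA.{u} where
  carrier := ExteriorRing.{u} p
  deg := exteriorDeg p n
  d := 0
  d_mem _ := zero_mem _
  d_d _ := rfl
  leibniz _ _ := by simp

/-- The homology algebra of `C` is isomorphic to `Λ_{𝔽_p}(g_n)` as a graded ring. -/
def HasExteriorHomology (p : ℕ) (n : ℤ) (C : DGA.{u}) : Prop :=
  ∃ φ : C.Homology ≃+* ExteriorRing.{u} p,
    ∀ i : ℤ, (C.homologyDeg i).map φ.toAddMonoidHom = exteriorDeg p n i

/-! ### Quotients of dgas -/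

section Quotient

variable (C : DGA.{u}) (R : Set C)

theorem mem_span_homogeneous {x : C} (hx : x ∈ TwoSidedIdeal.span R) :
    x ∈ AddSubgroup.closure {y : C | ∃ (i j : ℤ) (a r b : C),
      a ∈ C.deg i ∧ r ∈ R ∧ b ∈ C.deg j ∧ y = a * r * b} := by
  rw [TwoSidedIdeal.mem_span_iff_mem_addSubgroup_closure] at hx
  refine (AddSubgroup.closure_le _).mpr ?_ hx
  rintro _ ⟨_, ⟨a, -, r, hr, rfl⟩, b, -, rfl⟩
  simp only [SetLike.mem_coe]
  induction a using C.induction_homogeneous with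
  | zero => simp
  | add a a' ha ha' => simpa only [add_mul] using add_mem ha ha'
  | hom i a ha =>
    induction b using C.induction_homogeneous with
    | zero => simp
    | add b b' hb hb' => simpa only [mul_add] using add_mem hb hb'
    | hom j b hb => exact AddSubgroup.subset_closure ⟨i, j, a, r, b, ha, hr, hb, rfl⟩

theorem decompose_mem_span (hR : ∀ r ∈ R, ∃ k, r ∈ C.deg k) {x : C}
    (hx : x ∈ TwoSidedIdeal.span R) (k : ℤ) :
    (DirectSum.decompose C.deg x k : C) ∈ TwoSidedIdeal.span R := by
  refine AddSubgroup.closure_induction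
    (p := fun x _ => (DirectSum.decompose C.deg x k : C) ∈ TwoSidedIdeal.span R)
    ?_ ?_ ?_ ?_ (C.mem_span_homogeneous R hx)
  · rintro _ ⟨i, j, a, r, b, ha, hr, hb, rfl⟩
    obtain ⟨l, hl⟩ := hR r hr
    have h := SetLike.GradedMul.mul_mem (SetLike.GradedMul.mul_mem ha hl) hb
    by_cases hk : i + l + j = k
    · subst hk
      rw [DirectSum.decompose_of_mem_same _ h]
      exact TwoSidedIdeal.mul_mem_right _ _ _
        (TwoSidedIdeal.mul_mem_left _ _ _ (TwoSidedIdeal.subset_span hr))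
    · rw [DirectSum.decompose_of_mem_ne _ h hk]
      exact TwoSidedIdeal.zero_mem _
  · simp
  · intro x y _ _ hx hy
    simpa using TwoSidedIdeal.add_mem _ hx hy
  · intro x _ hx
    rw [← GradedRing.proj_apply] at hx ⊢
    rw [map_neg]
    exact TwoSidedIdeal.neg_mem _ hx

theorem d_mem_span (hR : ∀ r ∈ R, ∃ k, r ∈ C.deg k)
    (hd : ∀ r ∈ R, C.d r ∈ TwoSidedIdeal.span R) {x : C}
    (hx : x ∈ TwoSidedIdeal.span R) : C.d x ∈ TwoSidedIdeal.span R := by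
  refine AddSubgroup.closure_induction (p := fun x _ => C.d x ∈ TwoSidedIdeal.span R)
    ?_ ?_ ?_ ?_ (C.mem_span_homogeneous R hx)
  · rintro _ ⟨i, j, a, r, b, ha, hr, hb, rfl⟩
    have hr' := TwoSidedIdeal.subset_span hr
    have har : a * r ∈ TwoSidedIdeal.span R := TwoSidedIdeal.mul_mem_left _ _ _ hr'
    rw [C.d_mul, C.d_mul]
    have hs : C.sgn (a * r) ∈ TwoSidedIdeal.span R := by
      obtain ⟨l, hl⟩ := hR r hr
      rw [C.sgn_of_mem (SetLike.GradedMul.mul_mem ha hl)]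
      exact zsmul_mem har _
    refine TwoSidedIdeal.add_mem _ (TwoSidedIdeal.mul_mem_right _ _ _ (TwoSidedIdeal.add_mem _
      (TwoSidedIdeal.mul_mem_left _ _ _ hr') (TwoSidedIdeal.mul_mem_left _ _ _ (hd r hr))))
      (TwoSidedIdeal.mul_mem_right _ _ _ hs)
  · simp
  · intro x y _ _ hx hy
    simpa using TwoSidedIdeal.add_mem _ hx hy
  · intro x _ hx
    simpa using TwoSidedIdeal.neg_mem _ hx

/-- The quotient ring of `C` by the two-sided ideal generated by `R`. -/
abbrev QuotientRing : Type u := C ⧸ (TwoSidedIdeal.span R).asIdeal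

/-- The degree `i` part of the quotient: the image of the degree `i` part of `C`. -/
def quotientDeg (i : ℤ) : AddSubgroup (C.QuotientRing R) :=
  (C.deg i).map (Ideal.Quotient.mk (TwoSidedIdeal.span R).asIdeal).toAddMonoidHom

variable {R}

/-- The decomposition of an element of the quotient ring into homogeneous components. -/
def quotientDecompose (hR : ∀ r ∈ R, ∃ k, r ∈ C.deg k) :
    C.QuotientRing R →+ ⨁ i, C.quotientDeg R i :=
  QuotientAddGroup.lift (TwoSidedIdeal.span R).asIdeal.toAddSubgroup
    ((DirectSum.map fun i : ℤ =>
      ((Ideal.Quotient.mk (TwoSidedIdeal.span R).asIdeal).toAddMonoidHom.comp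
        (C.deg i).subtype).codRestrict (C.quotientDeg R i) fun x => ⟨x, x.2, rfl⟩).comp
      (DirectSum.decomposeAddEquiv C.deg).toAddMonoidHom)
    (fun x hx => by
      have hx' : x ∈ TwoSidedIdeal.span R := hx
      ext i
      simp only [AddMonoidHom.comp_apply, DirectSum.map_apply]
      exact Ideal.Quotient.eq_zero_iff_mem.mpr (C.decompose_mem_span R hR hx' i))

/-- The differential induced on the quotient ring. -/
def quotientD (hR : ∀ r ∈ R, ∃ k, r ∈ C.deg k) (hd : ∀ r ∈ R, C.d r ∈ TwoSidedIdeal.span R) :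
    C.QuotientRing R →+ C.QuotientRing R :=
  QuotientAddGroup.map (TwoSidedIdeal.span R).asIdeal.toAddSubgroup
    (TwoSidedIdeal.span R).asIdeal.toAddSubgroup C.d fun _ hx => C.d_mem_span R hR hd hx

theorem quotientD_mk (hR : ∀ r ∈ R, ∃ k, r ∈ C.deg k)
    (hd : ∀ r ∈ R, C.d r ∈ TwoSidedIdeal.span R) (x : C) :
    C.quotientD hR hd (Ideal.Quotient.mk _ x) = Ideal.Quotient.mk _ (C.d x) := rfl

theorem quotientDecompose_mk (hR : ∀ r ∈ R, ∃ k, r ∈ C.deg k) {i : ℤ} {x : C}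
    (hx : x ∈ C.deg i) :
    C.quotientDecompose hR (Ideal.Quotient.mk _ x) =
      DirectSum.of (fun i => C.quotientDeg R i) i ⟨Ideal.Quotient.mk _ x, x, hx, rfl⟩ := by
  change (DirectSum.map _) (DirectSum.decompose C.deg x) = _
  rw [DirectSum.decompose_of_mem C.deg hx, DirectSum.map_of]
  rfl

/-- The quotient of the dga `C` by the two-sided ideal generated by a set `R` of homogeneous
elements whose differentials lie in that ideal. -/
def quotient (hR : ∀ r ∈ R, ∃ k, r ∈ C.deg k) (hd : ∀ r ∈ R, C.d r ∈ TwoSidedIdeal.span R) :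
    DGA.{u} where
  carrier := C.QuotientRing R
  deg := C.quotientDeg R
  graded :=
    { one_mem := ⟨1, SetLike.GradedOne.one_mem, rfl⟩
      mul_mem := by
        rintro i j _ _ ⟨x, hx, rfl⟩ ⟨y, hy, rfl⟩
        exact ⟨x * y, SetLike.GradedMul.mul_mem hx hy, rfl⟩
      toDecomposition := decompositionOfHom _ (C.quotientDecompose hR)
        (fun x => by
          obtain ⟨x, rfl⟩ := Ideal.Quotient.mk_surjective x
          induction x using C.induction_homogeneous with
          | zero => simp
          | hom i x hx => rw [C.quotientDecompose_mk hR hx, DirectSum.coeAddMonoidHom_of]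
          | add x y hx hy => rw [map_add, map_add, map_add, hx, hy])
        (fun i x => by
          obtain ⟨_, x, hx, rfl⟩ := x
          exact C.quotientDecompose_mk hR hx) }
  d := C.quotientD hR hd
  d_mem := by
    rintro i _ ⟨x, hx, rfl⟩
    exact ⟨C.d x, C.d_mem hx, rfl⟩
  d_d x := by
    obtain ⟨x, rfl⟩ := Ideal.Quotient.mk_surjective x
    rw [quotientD_mk, quotientD_mk, C.d_d, map_zero]
  leibniz := by
    rintro i _ y ⟨x, hx, rfl⟩
    obtain ⟨y, rfl⟩ := Ideal.Quotient.mk_surjective y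
    change C.quotientD hR hd (Ideal.Quotient.mk _ (x * y)) = _
    rw [quotientD_mk, C.leibniz y hx, map_add, map_zsmul, map_mul, map_mul]
    rfl

end Quotient

/-! ### Free dgas -/

section Free

variable {X : Type u} (w : X → ℤ) (δ : X → FreeRing X)

/-- The word `x₁ ⋯ xₖ` in the free ring. -/
def word (l : List X) : FreeRing X := (l.map FreeRing.of).prod

/-- The degree `|x₁| + ⋯ + |xₖ|` of a word. -/
def wordDeg (l : List X) : ℤ := (l.map w).sum

/-- The elements of the free ring of degree `i`: integral combinations of words of degree `i`. -/
def freeDeg (i : ℤ) : AddSubgroup (FreeRing X) :=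
  AddSubgroup.closure {a | ∃ l : List X, wordDeg w l = i ∧ word l = a}

/-- The value of the derivation with `d x = δ x` on a word:
`d (x l) = δ x · l + (-1)^|x| x · d l`. -/
def wordD : List X → FreeRing X
  | [] => 0
  | x :: l => δ x * word l + ((w x).negOnePow : ℤ) • (FreeRing.of x * wordD l)

/-- The derivation of the free ring with `d x = δ x` on generators. -/
def freeD : FreeRing X →+ FreeRing X :=
  FreeAbelianGroup.lift fun l : FreeMonoid X => wordD w δ l.toList

theorem word_append (l m : List X) : word (l ++ m) = word l * word m := by
  simp [word]

theorem of_eq_word (l : List X) :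
    (FreeAbelianGroup.of (FreeMonoid.ofList l) : FreeRing X) = word l := by
  induction l with
  | nil => rfl
  | cons x l ih =>
    rw [FreeMonoid.ofList_cons, FreeAbelianGroup.of_mul]
    exact congrArg (FreeRing.of x * ·) ih

theorem freeRing_induction {P : FreeRing X → Prop} (zero : P 0) (word : ∀ l, P (word l))
    (neg : ∀ l, P (-DGA.word l)) (add : ∀ a b, P a → P b → P (a + b)) (a : FreeRing X) : P a :=
  FreeAbelianGroup.induction_on a zero (fun l => of_eq_word l.toList ▸ word l.toList)
    (fun l _ => of_eq_word l.toList ▸ neg l.toList) add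

theorem freeD_word (l : List X) : freeD w δ (word l) = wordD w δ l := by
  rw [← of_eq_word]
  exact FreeAbelianGroup.lift_apply_of _ _

theorem word_mem (l : List X) : word l ∈ freeDeg w (wordDeg w l) :=
  AddSubgroup.subset_closure ⟨l, rfl, rfl⟩

variable {w δ}

theorem freeDeg_induction {i : ℤ} {P : FreeRing X → Prop} (zero : P 0)
    (word : ∀ l, wordDeg w l = i → P (word l)) (neg : ∀ a, P a → P (-a))
    (add : ∀ a b, P a → P b → P (a + b)) {a : FreeRing X} (ha : a ∈ freeDeg w i) : P a :=
  AddSubgroup.closure_induction (p := fun a _ => P a)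
    (by rintro _ ⟨l, hl, rfl⟩; exact word l hl) zero (fun a b _ _ => add a b)
    (fun a _ => neg a) ha

theorem one_mem_freeDeg : (1 : FreeRing X) ∈ freeDeg w 0 := word_mem w []

theorem of_mem_freeDeg (x : X) : FreeRing.of x ∈ freeDeg w (w x) := by
  simpa [word, wordDeg] using word_mem w [x]

theorem natCast_mem_freeDeg (m : ℕ) : (m : FreeRing X) ∈ freeDeg w 0 := by
  rw [← nsmul_one]
  exact nsmul_mem one_mem_freeDeg m

theorem mul_mem_freeDeg {i j : ℤ} {a b : FreeRing X} (ha : a ∈ freeDeg w i)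
    (hb : b ∈ freeDeg w j) : a * b ∈ freeDeg w (i + j) := by
  refine freeDeg_induction (P := fun a => a * b ∈ freeDeg w (i + j)) (by simp)
    (fun l hl => ?_) (fun a h => by simpa using h)
    (fun a a' h h' => by simpa only [add_mul] using add_mem h h') ha
  refine freeDeg_induction (P := fun b => word l * b ∈ freeDeg w (i + j)) (by simp)
    (fun m hm => ?_) (fun a h => by simpa using h)
    (fun a a' h h' => by simpa only [mul_add] using add_mem h h') hb
  rw [← word_append, ← hl, ← hm,
    show wordDeg w l + wordDeg w m = wordDeg w (l ++ m) by simp [wordDeg]]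
  exact word_mem w _

theorem wordD_append (l m : List X) : wordD w δ (l ++ m) =
    wordD w δ l * word m + ((wordDeg w l).negOnePow : ℤ) • (word l * wordD w δ m) := by
  induction l with
  | nil => simp [wordD, word, wordDeg]
  | cons x l ih =>
    rw [List.cons_append, wordD, ih, wordD, word_append]
    simp only [wordDeg, word, List.map_cons, List.sum_cons, List.prod_cons, Int.negOnePow_add,
      Units.val_mul, add_mul, mul_add, smul_add, mul_smul, smul_mul_assoc, mul_smul_comm,
      mul_assoc, add_assoc]

theorem freeD_leibniz {i : ℤ} {a : FreeRing X} (b : FreeRing X) (ha : a ∈ freeDeg w i) :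
    freeD w δ (a * b) = freeD w δ a * b + (i.negOnePow : ℤ) • (a * freeD w δ b) := by
  refine freeDeg_induction (P := fun a => freeD w δ (a * b) =
      freeD w δ a * b + (i.negOnePow : ℤ) • (a * freeD w δ b)) (by simp)
    (fun l hl => ?_) (fun a h => ?_) (fun a a' h h' => ?_) ha
  · subst hl
    induction b using freeRing_induction with
    | zero => simp
    | word m => rw [← word_append, freeD_word, freeD_word, freeD_word, wordD_append]
    | neg m =>
      rw [mul_neg, map_neg, ← word_append, freeD_word, freeD_word, map_neg, freeD_word,
        wordD_append]
      simp only [mul_neg, smul_neg, neg_add]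
    | add b b' h h' => simp only [mul_add, map_add, h, h', smul_add]; abel
  · simp only [neg_mul, map_neg, h, smul_neg, neg_add]
  · simp only [add_mul, map_add, h, h', smul_add]; abel

theorem freeD_of (x : X) : freeD w δ (FreeRing.of x) = δ x := by
  have h := freeD_word w δ [x]
  simpa [word, wordD] using h

theorem freeD_one : freeD w δ 1 = 0 := freeD_word w δ []

theorem freeD_natCast (m : ℕ) : freeD w δ m = 0 := by
  rw [← nsmul_one, map_nsmul, freeD_one, smul_zero]

theorem freeD_of_mul (x : X) (b : FreeRing X) : freeD w δ (FreeRing.of x * b) =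
    δ x * b + ((w x).negOnePow : ℤ) • (FreeRing.of x * freeD w δ b) := by
  rw [freeD_leibniz b (of_mem_freeDeg x), freeD_of]

theorem freeD_natCast_mul (m : ℕ) (b : FreeRing X) :
    freeD w δ (m * b) = m * freeD w δ b := by
  rw [freeD_leibniz b (natCast_mem_freeDeg m), freeD_natCast]
  simp

theorem freeD_mem (hδ : ∀ x, δ x ∈ freeDeg w (w x - 1)) {i : ℤ} {a : FreeRing X}
    (ha : a ∈ freeDeg w i) : freeD w δ a ∈ freeDeg w (i - 1) := by
  have key (l : List X) : wordD w δ l ∈ freeDeg w (wordDeg w l - 1) := by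
    induction l with
    | nil => exact zero_mem _
    | cons x l ih =>
      refine add_mem ?_ (zsmul_mem ?_ _)
      · have := mul_mem_freeDeg (hδ x) (word_mem w l)
        rwa [show w x - 1 + wordDeg w l = wordDeg w (x :: l) - 1 by simp [wordDeg]; ring] at this
      · have := mul_mem_freeDeg (of_mem_freeDeg x) ih
        rwa [show w x + (wordDeg w l - 1) = wordDeg w (x :: l) - 1 by
          simp [wordDeg]; ring] at this
  refine freeDeg_induction (P := fun a => freeD w δ a ∈ freeDeg w (i - 1)) (by simp)
    (fun l hl => ?_) (fun a h => by simpa using h)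
    (fun a a' h h' => by simpa only [map_add] using add_mem h h') ha
  rw [freeD_word, ← hl]
  exact key l

theorem freeD_freeD (hδ : ∀ x, δ x ∈ freeDeg w (w x - 1)) (hδδ : ∀ x, freeD w δ (δ x) = 0)
    (a : FreeRing X) : freeD w δ (freeD w δ a) = 0 := by
  have h (l : List X) : freeD w δ (wordD w δ l) = 0 := by
    induction l with
    | nil => exact map_zero _
    | cons x l ih =>
      rw [wordD, map_add, map_zsmul, freeD_of_mul, freeD_leibniz _ (hδ x), hδδ, freeD_word, ih,
        Int.negOnePow_sub]
      simp
  induction a using freeRing_induction with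
  | zero => simp
  | word l => rw [freeD_word, h]
  | neg l => rw [map_neg, map_neg, freeD_word, h, neg_zero]
  | add a b ha hb => rw [map_add, map_add, ha, hb, add_zero]

/-- The decomposition of an element of the free ring into homogeneous components. -/
def freeDecompose (w : X → ℤ) : FreeRing X →+ ⨁ i, freeDeg w i :=
  FreeAbelianGroup.lift fun l : FreeMonoid X =>
    DirectSum.of (fun i => freeDeg w i) (wordDeg w l.toList) ⟨word l.toList, word_mem w _⟩

theorem freeDecompose_word (l : List X) : freeDecompose w (word l) =
    DirectSum.of (fun i => freeDeg w i) (wordDeg w l) ⟨word l, word_mem w _⟩ := by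
  have h : freeDecompose w (FreeAbelianGroup.of (FreeMonoid.ofList l)) =
      DirectSum.of (fun i => freeDeg w i) (wordDeg w l) ⟨word l, word_mem w _⟩ :=
    FreeAbelianGroup.lift_apply_of _ _
  rwa [of_eq_word] at h

instance (w : X → ℤ) : GradedRing (freeDeg w) where
  one_mem := one_mem_freeDeg
  mul_mem _ _ _ _ := mul_mem_freeDeg
  toDecomposition := decompositionOfHom _ (freeDecompose w)
    (fun a => by
      induction a using freeRing_induction with
      | zero => simp
      | word l => rw [freeDecompose_word, DirectSum.coeAddMonoidHom_of]
      | neg l => rw [map_neg, map_neg, freeDecompose_word, DirectSum.coeAddMonoidHom_of]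
      | add a b ha hb => rw [map_add, map_add, ha, hb])
    (fun i a => by
      obtain ⟨a, ha⟩ := a
      suffices h : ∃ h : a ∈ freeDeg w i,
          freeDecompose w a = DirectSum.of (fun i => freeDeg w i) i ⟨a, h⟩ from h.2
      refine freeDeg_induction (P := fun a => ∃ h : a ∈ freeDeg w i,
        freeDecompose w a = DirectSum.of (fun i => freeDeg w i) i ⟨a, h⟩)
        ⟨zero_mem _, ?_⟩ ?_ ?_ ?_ ha
      · rw [map_zero, of_eq_zero rfl]
      · rintro l rfl
        exact ⟨word_mem w l, freeDecompose_word l⟩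
      · rintro a ⟨h, e⟩
        exact ⟨neg_mem h, by rw [map_neg, e, ← map_neg]; rfl⟩
      · rintro a b ⟨h, e⟩ ⟨h', e'⟩
        exact ⟨add_mem h h', by rw [map_add, e, e', ← map_add]; rfl⟩)

/-- The free dga `ℤ⟨X; dx = δ x⟩` on generators `x` of degree `w x`, where `δ x` is homogeneous of
degree `w x - 1` and the derivation determined by `δ` squares to zero on generators. -/
def free (w : X → ℤ) (δ : X → FreeRing X) (hδ : ∀ x, δ x ∈ freeDeg w (w x - 1))
    (hδδ : ∀ x, freeD w δ (δ x) = 0) : DGA.{u} where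
  carrier := FreeRing X
  deg := freeDeg w
  d := freeD w δ
  d_mem := freeD_mem hδ
  d_d := freeD_freeD hδ hδδ
  leibniz := freeD_leibniz

end Free

/-! ### The two explicit dgas -/

/-- One generator `e`. -/
inductive OneGen : Type u
  | e

/-- Two generators `e` and `f`. -/
inductive TwoGen : Type u
  | e
  | f

section Explicit

variable (p : ℕ)

/-- `|e| = 1`. -/
def OneGen.deg : OneGen.{u} → ℤ
  | e => 1

/-- `de = p`. -/
def OneGen.diff : OneGen.{u} → FreeRing OneGen.{u}
  | e => p

/-- The free dga `ℤ[e; de = p]` with `|e| = 1`. -/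
def freeOne : DGA.{u} :=
  free OneGen.deg (OneGen.diff p) (fun | .e => natCast_mem_freeDeg p)
    (fun | .e => freeD_natCast p)

/-- The relations `e³` and `p e²`. -/
def OneGen.rels : Set (FreeRing OneGen.{u}) :=
  let e := FreeRing.of OneGen.e
  {e ^ 3, p * e ^ 2}

theorem OneGen.rels_homogeneous :
    ∀ r ∈ OneGen.rels.{u} p, ∃ k, r ∈ freeDeg OneGen.deg k := by
  have he : FreeRing.of OneGen.e ∈ freeDeg OneGen.deg.{u} 1 := of_mem_freeDeg OneGen.e
  have hpow (n : ℕ) := SetLike.pow_mem_graded (A := freeDeg OneGen.deg.{u}) n he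
  rintro _ (rfl | rfl)
  · exact ⟨_, hpow 3⟩
  · exact ⟨_, mul_mem_freeDeg (natCast_mem_freeDeg p) (hpow 2)⟩

theorem OneGen.rels_diff : ∀ r ∈ OneGen.rels.{u} p,
    freeD OneGen.deg (OneGen.diff p) r ∈ TwoSidedIdeal.span (OneGen.rels.{u} p) := by
  have he := freeD_of (w := OneGen.deg.{u}) (δ := OneGen.diff p) OneGen.e
  have hm := freeD_of_mul (w := OneGen.deg.{u}) (δ := OneGen.diff p) OneGen.e
  have hc := (Nat.cast_commute p (FreeRing.of OneGen.e.{u})).eq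
  simp only [OneGen.deg, OneGen.diff, Int.negOnePow_one, Units.val_neg, Units.val_one, neg_smul,
    one_smul] at he hm
  have h2 : freeD OneGen.deg.{u} (OneGen.diff p) (FreeRing.of OneGen.e ^ 2) = 0 := by
    rw [pow_two, hm, he, hc, add_neg_cancel]
  rintro _ (rfl | rfl)
  · rw [pow_succ', hm, h2, mul_zero, neg_zero, add_zero]
    exact TwoSidedIdeal.subset_span (Or.inr rfl)
  · rw [freeD_natCast_mul, h2, mul_zero]
    exact TwoSidedIdeal.zero_mem _

/-- The dga `ℤ[e; de = p]/(e³, pe²)` with `|e| = 1`. -/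
def exoticTwo : DGA.{u} :=
  (freeOne p).quotient (R := OneGen.rels p) (OneGen.rels_homogeneous p) (OneGen.rels_diff p)

/-- `|e| = 1` and `|f| = 3`. -/
def TwoGen.deg : TwoGen.{u} → ℤ
  | e => 1
  | f => 3

/-- `de = p` and `df = e²`. -/
def TwoGen.diff : TwoGen.{u} → FreeRing TwoGen.{u}
  | e => p
  | f => FreeRing.of e ^ 2

theorem TwoGen.diff_mem (x : TwoGen.{u}) :
    TwoGen.diff p x ∈ freeDeg TwoGen.deg (TwoGen.deg x - 1) := by
  have he : FreeRing.of TwoGen.e ∈ freeDeg TwoGen.deg.{u} 1 := of_mem_freeDeg TwoGen.e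
  cases x with
  | e => exact natCast_mem_freeDeg p
  | f =>
    have hd : TwoGen.deg.{u} TwoGen.f - 1 = 1 + 1 := by norm_num [TwoGen.deg]
    rw [TwoGen.diff, pow_two, hd]
    exact mul_mem_freeDeg he he

theorem TwoGen.freeD_e : freeD TwoGen.deg.{u} (TwoGen.diff p) (FreeRing.of e) = p := freeD_of _

theorem TwoGen.freeD_f :
    freeD TwoGen.deg.{u} (TwoGen.diff p) (FreeRing.of f) = FreeRing.of e * FreeRing.of e :=
  (freeD_of _).trans (pow_two _)

theorem TwoGen.freeD_e_mul (b : FreeRing TwoGen.{u}) :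
    freeD TwoGen.deg (TwoGen.diff p) (FreeRing.of e * b) =
      p * b - FreeRing.of e * freeD TwoGen.deg (TwoGen.diff p) b := by
  rw [freeD_of_mul]
  simp [TwoGen.deg, TwoGen.diff, sub_eq_add_neg]

theorem TwoGen.freeD_f_mul (b : FreeRing TwoGen.{u}) :
    freeD TwoGen.deg (TwoGen.diff p) (FreeRing.of f * b) =
      FreeRing.of e * (FreeRing.of e * b) -
        FreeRing.of f * freeD TwoGen.deg (TwoGen.diff p) b := by
  rw [freeD_of_mul]
  have : (3 : ℤ).negOnePow = -1 := by decide
  simp [TwoGen.deg, TwoGen.diff, sub_eq_add_neg, this, pow_two, mul_assoc]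

theorem TwoGen.freeD_diff (x : TwoGen.{u}) :
    freeD TwoGen.deg (TwoGen.diff p) (TwoGen.diff p x) = 0 := by
  cases x with
  | e => exact freeD_natCast p
  | f =>
    rw [TwoGen.diff, pow_two, freeD_e_mul, freeD_e, (Nat.cast_commute p _).eq, sub_self]

/-- The free dga `ℤ⟨e, f; de = p, df = e²⟩` with `|e| = 1` and `|f| = 3`. -/
def freeTwo : DGA.{u} :=
  free TwoGen.deg (TwoGen.diff p) (TwoGen.diff_mem p) (TwoGen.freeD_diff p)

/-- The relations `e⁴`, `e²f`, `efe`, `fe²`, `fef`, `f²` and `p(ef + fe)`. -/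
def TwoGen.rels : Set (FreeRing TwoGen.{u}) :=
  let e := FreeRing.of TwoGen.e
  let f := FreeRing.of TwoGen.f
  {e ^ 4, e ^ 2 * f, e * f * e, f * e ^ 2, f * e * f, f ^ 2, p * (e * f + f * e)}

theorem TwoGen.rels_homogeneous :
    ∀ r ∈ TwoGen.rels.{u} p, ∃ k, r ∈ freeDeg TwoGen.deg k := by
  have he : FreeRing.of TwoGen.e ∈ freeDeg TwoGen.deg.{u} 1 := of_mem_freeDeg TwoGen.e
  have hf : FreeRing.of TwoGen.f ∈ freeDeg TwoGen.deg.{u} 3 := of_mem_freeDeg TwoGen.f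
  have hpow (n : ℕ) := SetLike.pow_mem_graded (A := freeDeg TwoGen.deg.{u}) n he
  rintro _ (rfl | rfl | rfl | rfl | rfl | rfl | rfl)
  · exact ⟨_, hpow 4⟩
  · exact ⟨_, mul_mem_freeDeg (hpow 2) hf⟩
  · exact ⟨_, mul_mem_freeDeg (mul_mem_freeDeg he hf) he⟩
  · exact ⟨_, mul_mem_freeDeg hf (hpow 2)⟩
  · exact ⟨_, mul_mem_freeDeg (mul_mem_freeDeg hf he) hf⟩
  · exact ⟨_, SetLike.pow_mem_graded (A := freeDeg TwoGen.deg.{u}) 2 hf⟩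
  · exact ⟨_, mul_mem_freeDeg (natCast_mem_freeDeg p)
      (add_mem (mul_mem_freeDeg he hf)
      (mul_mem_freeDeg hf he : _ ∈ freeDeg TwoGen.deg.{u} (3 + 1)))⟩

theorem TwoGen.rels_diff : ∀ r ∈ TwoGen.rels.{u} p,
    freeD TwoGen.deg (TwoGen.diff p) r ∈ TwoSidedIdeal.span (TwoGen.rels.{u} p) := by
  have h1 := freeD_e_mul.{u} p
  have h2 := freeD_f_mul.{u} p
  have h3 := freeD_e.{u} p
  have h4 := freeD_f.{u} p
  have hs : TwoGen.rels.{u} p ⊆ TwoSidedIdeal.span (TwoGen.rels.{u} p) :=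
    TwoSidedIdeal.subset_span
  simp only [TwoGen.rels, Set.insert_subset_iff, Set.singleton_subset_iff, SetLike.mem_coe] at hs
  obtain ⟨r1, r2, r3, r4, r5, r6, r7⟩ := hs
  change _ ∈ TwoSidedIdeal.span (TwoGen.rels.{u} p) at r1 r2 r3 r4 r5 r6 r7
  set I := TwoSidedIdeal.span (TwoGen.rels.{u} p)
  have hc (x : FreeRing TwoGen.{u}) : x * p = p * x := (Nat.cast_commute p x).eq.symm
  have hc' (x y : FreeRing TwoGen.{u}) : x * (p * y) = p * (x * y) := by
    rw [← mul_assoc, hc, mul_assoc]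
  rintro _ (rfl | rfl | rfl | rfl | rfl | rfl | rfl) <;>
    simp only [pow_succ, pow_zero, one_mul, mul_assoc, h1, h2, h3, h4, mul_sub, hc, hc',
      freeD_natCast_mul, map_add, mul_add] at r1 r2 r3 r4 r5 r6 r7 ⊢
  · simp
  · simpa using r1
  · have := I.sub_mem r7 r1
    convert this using 1
    abel
  · simpa using r1
  · have h5 := I.mul_mem_right _ (FreeRing.of e) r4
    simp only [mul_assoc] at h5
    have := I.add_mem (I.sub_mem (I.mul_mem_left (FreeRing.of e) _ r2)
      (I.mul_mem_left p _ r6)) h5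
    convert this using 1
    abel
  · have := I.sub_mem r2 r4
    convert this using 1
  · convert I.zero_mem using 1
    abel

/-- The dga `ℤ⟨e, f; de = p, df = e²⟩/(e⁴, e²f, efe, fe², fef, f², p(ef + fe))` with
`|e| = 1` and `|f| = 3`. -/
def exoticFour : DGA.{u} :=
  (freeTwo p).quotient (R := TwoGen.rels p) (TwoGen.rels_homogeneous p) (TwoGen.rels_diff p)

end Explicit

end DGA

namespace DGA

/-! ### Homogeneous components of cycles and boundaries -/

section Components

variable (C : DGA.{u})

/-! Let `C` have exterior homology. Since p = 0 in H_0(C), there is x_0 of degree 1 with d x_0 = p.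
Try to continue with x_k of degree 2k + 1 such that d x_{k+1} is the sum of the products x_i x_j
over i + j = k. With the generating function x = ∑ x_k t^k this is the Maurer–Cartan type equation
dx = p + t x². The prescribed value of d x_k is automatically a cycle, because p + t x² commutes
with x (`map_obst_eq_zero`). So the only obstruction to choosing x_k is the class of `obst p x k` in
H_{2k}(C).

If n is odd, these groups vanish for k > 0 and every obstruction vanishes. If n = 2m, exactly one
obstruction can survive, in H_{2m}(C) ≅ 𝔽_p. Its class does not depend on the choices: odd homology
vanishes in the relevant degrees, so two partial solutions x and y are joined by a homotopy u with
du = x - y - t(uy - xu), and then d(uy - xu) = x² - y² (`IsResolving.obst_sub_mem_range`). Hence its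
vanishing is a quasi-isomorphism invariant (`QuasiIsomorphic.exists_isResolving_iff`). In the
exterior algebra p = 0, so x = 0 is a solution and the obstruction vanishes.

The invariant is complete because there is a universal example. Let `model` be the free dga on the
x_k and a cycle z of degree n, with d x_m = obst + c z. A contraction sending x_0 x_k w to x_{k+1} w
(`Cell.exists_homotopy_eq`) and a functional with values in 𝔽_p (`Cell.topCoeff_freeD`) show that in
degrees at most n its homology is 𝔽_p in degree 0 and 𝔽_p z in degree n. If `C` receives a map from
the model carrying z to a generator of H_n, then `C` is quasi-isomorphic to the truncation of the
model above degree n (`ExteriorLike.quasiIsomorphic_truncation`). When the obstruction vanishes,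
such a map exists for c = 0, and the exterior algebra has one too. When it does not, n = 2m and the
map exists for c = 1, with z going to minus the obstruction and x_m going to 0. So there is one type
for odd n and there are two for even n.

The two explicit dgas are truncations of free dgas on e, respectively on e and f. Their resolving
sequences are e, respectively e, f, and the obstructions e² and ef + fe generate the top homology,
hence are nonzero (`quotient_exotic`). -/

theorem proj_mem (i : ℤ) (x : C) : GradedRing.proj C.deg i x ∈ C.deg i :=
  (DirectSum.decompose C.deg x i).2

variable {C}

theorem proj_same {i : ℤ} {x : C} (hx : x ∈ C.deg i) : GradedRing.proj C.deg i x = x :=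
  DirectSum.decompose_of_mem_same _ hx

theorem proj_ne {i j : ℤ} {x : C} (hx : x ∈ C.deg i) (h : i ≠ j) :
    GradedRing.proj C.deg j x = 0 :=
  DirectSum.decompose_of_mem_ne _ hx h

theorem proj_d (i : ℤ) (x : C) :
    GradedRing.proj C.deg i (C.d x) = C.d (GradedRing.proj C.deg (i + 1) x) := by
  induction x using C.induction_homogeneous with
  | zero => simp
  | hom j x hx =>
    by_cases h : j = i + 1
    · subst h
      have := C.d_mem hx
      rw [add_sub_cancel_right] at this
      rw [proj_same hx, proj_same this]
    · rw [proj_ne hx h, proj_ne (C.d_mem hx) (by omega), map_zero]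
  | add x y hx hy => simp only [map_add, hx, hy]

theorem d_proj_eq_zero {x : C} (hx : C.d x = 0) (i : ℤ) :
    C.d (GradedRing.proj C.deg i x) = 0 := by
  have := proj_d (i - 1) x
  rw [hx, map_zero, sub_add_cancel] at this
  exact this.symm

theorem proj_mem_range {x : C} (hx : x ∈ C.d.range) (i : ℤ) :
    GradedRing.proj C.deg i x ∈ C.d.range := by
  obtain ⟨y, rfl⟩ := hx
  exact ⟨_, (proj_d i y).symm⟩

/-- Of an arbitrary primitive, only the component in degree `i + 1` matters. -/
theorem exists_mem_deg_of_mem_range {i : ℤ} {x : C} (hx : x ∈ C.deg i) (h : x ∈ C.d.range) :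
    ∃ y ∈ C.deg (i + 1), C.d y = x := by
  obtain ⟨y, rfl⟩ := h
  exact ⟨_, C.proj_mem (i + 1) y, by rw [← proj_d, proj_same hx]⟩

/-- To prove an additive property of all elements, or of all cycles, it suffices to prove it for
the homogeneous components. -/
theorem of_proj {P : C → Prop} (zero : P 0) (add : ∀ x y, P x → P y → P (x + y)) {x : C}
    (h : ∀ i, P (GradedRing.proj C.deg i x)) : P x := by
  classical
  rw [← DirectSum.sum_support_decompose C.deg x]
  exact Finset.sum_induction _ P add zero fun i _ => h i

theorem one_mem_deg : (1 : C) ∈ C.deg 0 := SetLike.GradedOne.one_mem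

theorem intCast_mem_deg_zero (k : ℤ) : (k : C) ∈ C.deg 0 := by
  rw [← zsmul_one]
  exact zsmul_mem one_mem_deg k

theorem mul_mem_deg {i j k : ℤ} {x y : C} (hx : x ∈ C.deg i) (hy : y ∈ C.deg j)
    (h : i + j = k) : x * y ∈ C.deg k :=
  h ▸ SetLike.GradedMul.mul_mem hx hy

theorem d_intCast (k : ℤ) : C.d (k : C) = 0 := by
  rw [← zsmul_one, map_zsmul, C.d_one, smul_zero]

theorem d_natCast (k : ℕ) : C.d (k : C) = 0 := by
  rw [← nsmul_one, map_nsmul, C.d_one, smul_zero]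

theorem d_mul_eq_zero {x y : C} (hx : C.d x = 0) (hy : C.d y = 0) : C.d (x * y) = 0 := by
  rw [C.d_mul, hx, hy, zero_mul, mul_zero, add_zero]

theorem d_zsmul_eq_zero {x : C} (hx : C.d x = 0) (k : ℤ) : C.d (k • x) = 0 := by
  rw [map_zsmul, hx, smul_zero]

theorem d_mem' {i j : ℤ} {x : C} (hx : x ∈ C.deg i) (h : i - 1 = j) : C.d x ∈ C.deg j :=
  h ▸ C.d_mem hx

theorem mul_mem_range_left {x y : C} (hx : C.d x = 0) (hy : y ∈ C.d.range) :
    x * y ∈ C.d.range := by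
  obtain ⟨z, rfl⟩ := hy
  have := C.boundaries.mul_mem_left ⟨x, hx⟩ (show ⟨C.d z, C.d_d z⟩ ∈ C.boundaries from ⟨z, rfl⟩)
  exact this

theorem mul_mem_range_right {x y : C} (hx : x ∈ C.d.range) (hy : C.d y = 0) :
    x * y ∈ C.d.range := by
  obtain ⟨z, rfl⟩ := hx
  have := C.boundaries.mul_mem_right ⟨y, hy⟩
    (show ⟨C.d z, C.d_d z⟩ ∈ C.boundaries from ⟨z, rfl⟩)
  exact this

end Components

/-! ### Homology classes of cycles -/

section HomologyClass

variable (C : DGA.{u})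

/-- The homology class of a cycle. -/
def cls (x : C) (hx : C.d x = 0) : C.Homology := Ideal.Quotient.mk C.boundaries ⟨x, hx⟩

variable {C}

theorem exists_cls (y : C.Homology) : ∃ x hx, C.cls x hx = y := by
  obtain ⟨⟨x, hx⟩, rfl⟩ := Ideal.Quotient.mk_surjective y
  exact ⟨x, hx, rfl⟩

theorem cls_eq_zero {x : C} {hx : C.d x = 0} : C.cls x hx = 0 ↔ x ∈ C.d.range :=
  Ideal.Quotient.eq_zero_iff_mem

theorem cls_eq {x y : C} {hx : C.d x = 0} {hy : C.d y = 0} :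
    C.cls x hx = C.cls y hy ↔ x - y ∈ C.d.range :=
  Ideal.Quotient.eq

theorem cls_intCast (k : ℤ) : C.cls k (d_intCast k) = k := rfl

theorem cls_zsmul (k : ℤ) (x : C) (hx : C.d x = 0) :
    C.cls (k • x) (d_zsmul_eq_zero hx k) = k • C.cls x hx :=
  map_zsmul (Ideal.Quotient.mk C.boundaries) k ⟨x, hx⟩

theorem cls_add (x y : C) (hx : C.d x = 0) (hy : C.d y = 0) :
    C.cls (x + y) (by rw [map_add, hx, hy, add_zero]) = C.cls x hx + C.cls y hy := rfl

theorem cls_mul (x y : C) (hx : C.d x = 0) (hy : C.d y = 0) :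
    C.cls (x * y) (d_mul_eq_zero hx hy) = C.cls x hx * C.cls y hy := rfl

theorem mem_homologyDeg {i : ℤ} {y : C.Homology} :
    y ∈ C.homologyDeg i ↔ ∃ x ∈ C.deg i, ∃ hx, C.cls x hx = y := by
  constructor
  · rintro ⟨⟨x, hx⟩, hi, rfl⟩
    exact ⟨x, hi, hx, rfl⟩
  · rintro ⟨x, hi, hx, rfl⟩
    exact ⟨⟨x, hx⟩, hi, rfl⟩

theorem homologyMap_cls {C D : DGA.{u}} (f : Hom C D) (x : C) (hx : C.d x = 0) :
    f.homologyMap (C.cls x hx) =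
      D.cls (f.toRingHom x) (by rw [← f.map_d, hx, map_zero]) := rfl

end HomologyClass

/-! ### Quasi-isomorphisms in terms of cycles and boundaries -/

section QuasiIso

variable {C D E : DGA.{u}}

theorem Hom.proj_map (f : Hom C D) (i : ℤ) (x : C) :
    GradedRing.proj D.deg i (f.toRingHom x) = f.toRingHom (GradedRing.proj C.deg i x) := by
  induction x using C.induction_homogeneous with
  | zero => simp
  | hom j x hx =>
    by_cases h : j = i
    · subst h
      rw [proj_same hx, proj_same (f.map_deg hx)]
    · rw [proj_ne hx h, proj_ne (f.map_deg hx) h, map_zero]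
  | add x y hx hy => simp only [map_add, hx, hy]

theorem Hom.map_mem_range (f : Hom C D) {x : C} (hx : x ∈ C.d.range) :
    f.toRingHom x ∈ D.d.range := by
  obtain ⟨y, rfl⟩ := hx
  exact ⟨_, (f.map_d y).symm⟩

/-- Injectivity on homology at chain level; it carries the vanishing of an obstruction back along a
quasi-isomorphism. -/
theorem Hom.IsQuasiIso.mem_range {f : Hom C D} (hf : f.IsQuasiIso) {x : C} (hx : C.d x = 0)
    (h : f.toRingHom x ∈ D.d.range) : x ∈ C.d.range := by
  rw [← cls_eq_zero (hx := hx)]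
  apply hf.1
  rw [homologyMap_cls]
  exact (cls_eq_zero.mpr h).trans (map_zero _).symm

/-- A map of dgas is a quasi-isomorphism when it is bijective on homology in each degree. -/
theorem Hom.isQuasiIso_of_homogeneous (f : Hom C D)
    (inj : ∀ i, ∀ x ∈ C.deg i, C.d x = 0 → f.toRingHom x ∈ D.d.range → x ∈ C.d.range)
    (surj : ∀ i, ∀ y ∈ D.deg i, D.d y = 0 → ∃ x, C.d x = 0 ∧ y - f.toRingHom x ∈ D.d.range) :
    f.IsQuasiIso := by
  constructor
  · rw [injective_iff_map_eq_zero]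
    intro y hy
    obtain ⟨x, hx, rfl⟩ := exists_cls y
    rw [homologyMap_cls, cls_eq_zero] at hy
    rw [cls_eq_zero]
    refine of_proj (P := (· ∈ C.d.range)) (zero_mem _) (fun _ _ => add_mem) fun i => ?_
    refine inj i _ (C.proj_mem i x) (d_proj_eq_zero hx i) ?_
    rw [← f.proj_map]
    exact proj_mem_range hy i
  · intro y
    obtain ⟨y, hy, rfl⟩ := exists_cls y
    have : ∃ x, C.d x = 0 ∧ y - f.toRingHom x ∈ D.d.range := by
      refine of_proj (P := fun y => ∃ x, C.d x = 0 ∧ y - f.toRingHom x ∈ D.d.range)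
        ⟨0, by simp⟩ ?_ fun i => surj i _ (D.proj_mem i y) (d_proj_eq_zero hy i)
      rintro y y' ⟨x, hx, h⟩ ⟨x', hx', h'⟩
      refine ⟨x + x', by rw [map_add, hx, hx', add_zero], ?_⟩
      rw [map_add, add_sub_add_comm]
      exact add_mem h h'
    obtain ⟨x, hx, h⟩ := this
    refine ⟨C.cls x hx, ?_⟩
    rw [homologyMap_cls, eq_comm, cls_eq]
    exact h

theorem Hom.IsQuasiIso.map_homologyDeg {f : Hom C D} (hf : f.IsQuasiIso) (i : ℤ) :
    (C.homologyDeg i).map f.homologyMap.toAddMonoidHom = D.homologyDeg i := by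
  ext y
  rw [mem_homologyDeg, AddSubgroup.mem_map]
  constructor
  · rintro ⟨x, hx, rfl⟩
    obtain ⟨x, hi, hx', rfl⟩ := mem_homologyDeg.mp hx
    exact ⟨f.toRingHom x, f.map_deg hi, _, (homologyMap_cls f x hx').symm⟩
  · rintro ⟨y, hi, hy, rfl⟩
    obtain ⟨x, hx⟩ := hf.2 (D.cls y hy)
    obtain ⟨x, hx', rfl⟩ := exists_cls x
    -- The cycle `x` found by surjectivity need not be homogeneous. Its component in degree `i`
    -- works equally well, because the components of boundaries are boundaries.
    refine ⟨C.cls _ (d_proj_eq_zero hx' i), mem_homologyDeg.mpr ⟨_, C.proj_mem i x, _, rfl⟩, ?_⟩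
    rw [homologyMap_cls, cls_eq] at hx
    refine (homologyMap_cls f _ (d_proj_eq_zero hx' i)).trans ?_
    rw [cls_eq, ← f.proj_map]
    have := proj_mem_range hx i
    rwa [map_sub, proj_same hi] at this

theorem Hom.IsQuasiIso.hasExteriorHomology_iff {f : Hom C D} (hf : f.IsQuasiIso) (p : ℕ)
    (n : ℤ) : HasExteriorHomology p n C ↔ HasExteriorHomology p n D := by
  let e : C.Homology ≃+* D.Homology := RingEquiv.ofBijective f.homologyMap hf
  constructor
  · rintro ⟨φ, hφ⟩
    refine ⟨e.symm.trans φ, fun i => ?_⟩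
    rw [← hφ, ← hf.map_homologyDeg, AddSubgroup.map_map]
    congr 1
    refine AddMonoidHom.ext fun x => ?_
    exact congrArg φ (e.symm_apply_apply x)
  · rintro ⟨φ, hφ⟩
    refine ⟨e.trans φ, fun i => ?_⟩
    rw [← hφ, ← hf.map_homologyDeg, AddSubgroup.map_map]
    rfl

theorem Hom.IsQuasiIso.quasiIsomorphic {f : Hom C D} (hf : f.IsQuasiIso) :
    QuasiIsomorphic C D :=
  Relation.EqvGen.rel _ _ ⟨f, hf⟩

theorem QuasiIsomorphic.symm (h : QuasiIsomorphic C D) : QuasiIsomorphic D C :=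
  Relation.EqvGen.symm _ _ h

theorem QuasiIsomorphic.trans (h : QuasiIsomorphic C D) (h' : QuasiIsomorphic D E) :
    QuasiIsomorphic C E :=
  Relation.EqvGen.trans _ _ _ h h'

end QuasiIso

/-! ### Exterior homology in terms of cycles and boundaries -/

/-- The homology of `C` in degrees `≤ n` is that of `Λ_{𝔽_p}(g_n)`, the class of `g` being a
generator in degree `n`. -/
structure ExteriorUpTo (p : ℕ) (n : ℤ) (C : DGA.{u}) (g : C) : Prop where
  mem : g ∈ C.deg n
  d_eq : C.d g = 0
  acyclic : ∀ i < n, i ≠ 0 → ∀ x ∈ C.deg i, C.d x = 0 → x ∈ C.d.range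
  zero : ∀ x ∈ C.deg 0, C.d x = 0 → ∃ k : ℤ, x - k ∈ C.d.range
  intCast : ∀ k : ℤ, (k : C) ∈ C.d.range ↔ (p : ℤ) ∣ k
  top : ∀ x ∈ C.deg n, C.d x = 0 → ∃ k : ℤ, x - k • g ∈ C.d.range
  zsmul : ∀ k : ℤ, k • g ∈ C.d.range ↔ (p : ℤ) ∣ k

/-- The homology of `C` is that of `Λ_{𝔽_p}(g_n)`, the class of `g` being a generator in
degree `n`. -/
structure ExteriorLike (p : ℕ) (n : ℤ) (C : DGA.{u}) (g : C) : Prop extends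
    ExteriorUpTo p n C g where
  acyclic_above : ∀ i > n, ∀ x ∈ C.deg i, C.d x = 0 → x ∈ C.d.range

theorem ExteriorLike.acyclic_of_ne {p : ℕ} {n : ℤ} {C : DGA.{u}} {g : C}
    (h : ExteriorLike p n C g) {i : ℤ} (h0 : i ≠ 0) (hn : i ≠ n) {x : C} (hx : x ∈ C.deg i)
    (hd : C.d x = 0) : x ∈ C.d.range :=
  hn.lt_or_gt.elim (fun hi => h.acyclic i hi h0 x hx hd) fun hi => h.acyclic_above i hi x hx hd

/-! ### Integer coordinates on the exterior algebra -/

section ExteriorRing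

variable (p : ℕ)

instance : CharP (ULift.{u} (ZMod p)) p := inferInstance

theorem exists_intCast_eq (a : ULift.{u} (ZMod p)) : ∃ k : ℤ, (k : ULift.{u} (ZMod p)) = a := by
  obtain ⟨a⟩ := a
  obtain ⟨k, rfl⟩ := ZMod.intCast_surjective a
  exact ⟨k, rfl⟩

theorem exists_exteriorRing_eq (x : ExteriorRing.{u} p) :
    ∃ a b : ℤ, x = a + b • (TrivSqZeroExt.inr 1 : ExteriorRing.{u} p) := by
  obtain ⟨a, ha⟩ := exists_intCast_eq p x.fst
  obtain ⟨b, hb⟩ := exists_intCast_eq p x.snd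
  refine ⟨a, b, ?_⟩
  ext
  · simp [ha]
  · simp [← hb]

theorem intCast_add_zsmul_inr_eq_zero {a b : ℤ} :
    (a : ExteriorRing.{u} p) + b • (TrivSqZeroExt.inr 1 : ExteriorRing.{u} p) = 0 ↔ (p : ℤ) ∣ a ∧ (p : ℤ) ∣ b := by
  rw [← CharP.intCast_eq_zero_iff (ULift.{u} (ZMod p)) p,
    ← CharP.intCast_eq_zero_iff (ULift.{u} (ZMod p)) p, TrivSqZeroExt.ext_iff]
  simp

end ExteriorRing

section ExteriorLift

variable (p : ℕ) {H : Type u} [Ring H] [CharP H p] (G : H) (hG : G * G = 0)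

/-- The ring map `Λ_{𝔽_p}(g) → H` sending `g` to a given element of square zero. -/
def exteriorLift : ExteriorRing.{u} p →+* H :=
  let γ : ULift.{u} (ZMod p) →+* H := (ZMod.castHom dvd_rfl H).comp ULift.ringEquiv.toRingHom
  have hψ (a b : ℤ) :
      γ (a + b • (TrivSqZeroExt.inr 1 : ExteriorRing.{u} p)).fst +
        γ (a + b • (TrivSqZeroExt.inr 1 : ExteriorRing.{u} p)).snd * G = a + b • G := by
    simp
  { toFun := fun x => γ x.fst + γ x.snd * G
    map_one' := by simp
    map_zero' := by simp
    map_add' := fun x y => by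
      simp only [TrivSqZeroExt.fst_add, TrivSqZeroExt.snd_add, map_add, add_mul]
      abel
    map_mul' := fun x y => by
      obtain ⟨a, b, rfl⟩ := exists_exteriorRing_eq p x
      obtain ⟨a', b', rfl⟩ := exists_exteriorRing_eq p y
      have : ((a : ExteriorRing.{u} p) + b • (TrivSqZeroExt.inr 1 : ExteriorRing.{u} p)) *
          ((a' : ExteriorRing.{u} p) + b' • (TrivSqZeroExt.inr 1 : ExteriorRing.{u} p)) =
          ((a * a' : ℤ) : ExteriorRing.{u} p) +
            (a * b' + b * a') • (TrivSqZeroExt.inr 1 : ExteriorRing.{u} p) := by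
        ext <;> simp [mul_comm]
      rw [this, hψ, hψ, hψ]
      simp only [zsmul_eq_mul, add_mul, mul_add, Int.cast_add, Int.cast_mul]
      rw [mul_assoc (b : H) G a', ← (Int.cast_commute a' G).eq, mul_assoc (b : H) G,
        ← mul_assoc G, ← (Int.cast_commute b' G).eq, mul_assoc (b' : H), hG]
      simp only [mul_assoc, mul_zero, add_zero]
      abel }

theorem exteriorLift_apply (a b : ℤ) :
    exteriorLift p G hG (a + b • (TrivSqZeroExt.inr 1 : ExteriorRing.{u} p)) = a + b • G := by
  simp [exteriorLift]

end ExteriorLift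

/-! ### From the homology ring to conditions on cycles and boundaries, and back -/

section Bridge

variable {p : ℕ} {n : ℤ} {C D : DGA.{u}} {g : C}

theorem exists_mul_eq_one_add_mul {m : ℤ} (hp : p.Prime) (hm : ¬ (p : ℤ) ∣ m) :
    ∃ a b : ℤ, a * m = 1 + b * p := by
  have : IsCoprime (p : ℤ) m := (Nat.prime_iff_prime_int.mp hp).coprime_iff_not_dvd.mpr hm
  obtain ⟨a, b, h⟩ := this
  exact ⟨b, -a, by linarith⟩

/-- Trades the ring isomorphism for conditions on cycles and boundaries, in which lifting and
truncation arguments can be run. The element `g` is any homogeneous cycle whose class corresponds to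
the generator. -/
theorem HasExteriorHomology.exists_exteriorLike (hn' : 0 < n)
    (h : HasExteriorHomology p n C) : ∃ g, ExteriorLike p n C g := by
  have hn := hn'.ne'
  obtain ⟨φ, hφ⟩ := h
  have mem {i : ℤ} {x : C} (hx : x ∈ C.deg i) (hd : C.d x = 0) :
      φ (C.cls x hd) ∈ exteriorDeg p n i := by
    rw [← hφ]
    exact ⟨_, mem_homologyDeg.mpr ⟨x, hx, hd, rfl⟩, rfl⟩
  have bdry {x : C} (hd : C.d x = 0) : x ∈ C.d.range ↔ φ (C.cls x hd) = 0 := by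
    rw [← cls_eq_zero (hx := hd), map_eq_zero_iff φ φ.injective]
  obtain ⟨g, hg, hdg, hφg⟩ : ∃ g ∈ C.deg n, ∃ hd, φ (C.cls g hd) = .inr 1 := by
    have := inr_mem_exteriorDeg.{u} p n 1
    rw [← hφ] at this
    obtain ⟨_, h, h'⟩ := this
    obtain ⟨g, hg, hd, rfl⟩ := mem_homologyDeg.mp h
    exact ⟨g, hg, hd, h'⟩
  have acyclic {i : ℤ} (h0 : i ≠ 0) (hi : i ≠ n) (x : C) (hx : x ∈ C.deg i) (hd : C.d x = 0) :
      x ∈ C.d.range := by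
    rw [bdry hd]
    obtain ⟨h1, h2⟩ := mem hx hd
    exact TrivSqZeroExt.ext (h1 h0) (h2 hi)
  refine ⟨g, ⟨hg, hdg, fun i hi h0 => acyclic h0 hi.ne, fun x hx hd => ?_, fun k => ?_,
    fun x hx hd => ?_, fun k => ?_⟩, ?_⟩
  · obtain ⟨a, b, hab⟩ := exists_exteriorRing_eq p (φ (C.cls x hd))
    refine ⟨a, ?_⟩
    rw [← cls_eq (hx := hd) (hy := d_intCast a), ← φ.injective.eq_iff, cls_intCast, map_intCast]
    have := (mem hx hd).2 hn.symm
    ext1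
    · rw [hab]; simp
    · rw [this]; simp
  · rw [bdry (d_intCast k), cls_intCast, map_intCast]
    simpa using intCast_add_zsmul_inr_eq_zero.{u} p (a := k) (b := 0)
  · obtain ⟨a, b, hab⟩ := exists_exteriorRing_eq p (φ (C.cls x hd))
    refine ⟨b, ?_⟩
    rw [← cls_eq (hx := hd) (hy := by rw [map_zsmul, hdg, smul_zero]), ← φ.injective.eq_iff,
      cls_zsmul _ _ hdg, map_zsmul, hφg]
    have := (mem hx hd).1 hn
    ext1
    · rw [this]; simp
    · rw [hab]; simp
  · rw [bdry (d_zsmul_eq_zero hdg _), cls_zsmul _ _ hdg, map_zsmul, hφg]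
    simpa using intCast_add_zsmul_inr_eq_zero.{u} p (a := 0) (b := k)
  · exact fun i hi => acyclic (by omega) hi.ne'

theorem ExteriorLike.exists_sub_mem_range (h : ExteriorLike p n C g) {x : C}
    (hx : C.d x = 0) : ∃ a b : ℤ, x - ((a : C) + b • g) ∈ C.d.range := by
  refine of_proj (P := fun x => ∃ a b : ℤ, x - ((a : C) + b • g) ∈ C.d.range) ⟨0, 0, by simp⟩ ?_
    fun i => ?_
  · rintro x y ⟨a, b, h⟩ ⟨a', b', h'⟩
    refine ⟨a + a', b + b', ?_⟩
    convert add_mem h h' using 1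
    push_cast
    rw [add_zsmul]
    abel
  · have hd := d_proj_eq_zero hx i
    have hi := C.proj_mem i x
    by_cases h0 : i = 0
    · obtain ⟨k, hk⟩ := h.zero _ (h0 ▸ hi) hd
      exact ⟨k, 0, by simpa using hk⟩
    · by_cases hn : i = n
      · obtain ⟨k, hk⟩ := h.top _ (hn ▸ hi) hd
        exact ⟨0, k, by simpa using hk⟩
      · exact ⟨0, 0, by simpa using h.acyclic_of_ne h0 hn hi hd⟩

/-- The two summands have different degrees, so the components of the boundary in degrees `0` and
`n` separate them. -/
theorem ExteriorUpTo.dvd_of_mem_range (hn : n ≠ 0) (h : ExteriorUpTo p n C g) {a b : ℤ}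
    (hab : (a + b • g : C) ∈ C.d.range) : (p : ℤ) ∣ a ∧ (p : ℤ) ∣ b := by
  have ha := intCast_mem_deg_zero (C := C) a
  have hb := zsmul_mem h.mem b
  rw [← h.intCast, ← h.zsmul]
  constructor
  · have := proj_mem_range hab 0
    rwa [map_add, proj_same ha, proj_ne hb hn, add_zero] at this
  · have := proj_mem_range hab n
    rwa [map_add, proj_same hb, proj_ne ha hn.symm, zero_add] at this

/-- The additive data force the ring structure: the square of `g` is a cycle of degree 2n > n, where
homology vanishes. So sending the generator to the class of `g` defines a ring map, and it is
bijective by the integer coordinates. -/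
theorem ExteriorLike.hasExteriorHomology (hn : 0 < n) (h : ExteriorLike p n C g) :
    HasExteriorHomology p n C := by
  have hchar : CharP C.Homology p := by
    refine ⟨fun k => ?_⟩
    have := h.intCast k
    rw [← cls_eq_zero (hx := d_intCast _), cls_intCast] at this
    exact_mod_cast this
  let G : C.Homology := C.cls g h.d_eq
  have hGG : G * G = 0 := by
    change C.cls g h.d_eq * C.cls g h.d_eq = 0
    rw [← cls_mul, cls_eq_zero]
    exact h.acyclic_above (n + n) (by omega) _ (mul_mem_deg h.mem h.mem rfl)
      (d_mul_eq_zero h.d_eq h.d_eq)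
  have hcls (a b : ℤ) : (a + b • G : C.Homology) = C.cls (a + b • g)
      (by rw [map_add, d_intCast, map_zsmul, h.d_eq, smul_zero, add_zero]) := by
    rw [cls_add _ _ (d_intCast a) (d_zsmul_eq_zero h.d_eq _), cls_intCast,
      cls_zsmul _ _ h.d_eq]
  let ψ : ExteriorRing.{u} p →+* C.Homology := exteriorLift p G hGG
  have hψ' (a b : ℤ) : ψ (a + b • (TrivSqZeroExt.inr 1 : ExteriorRing.{u} p)) = a + b • G :=
    exteriorLift_apply p G hGG a b
  have bij : Function.Bijective ψ := by
    constructor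
    · rw [injective_iff_map_eq_zero]
      intro x hx
      obtain ⟨a, b, rfl⟩ := exists_exteriorRing_eq p x
      rw [hψ', hcls, cls_eq_zero] at hx
      exact (intCast_add_zsmul_inr_eq_zero p).mpr (h.dvd_of_mem_range hn.ne' hx)
    · intro y
      obtain ⟨x, hx, rfl⟩ := exists_cls y
      obtain ⟨a, b, hab⟩ := h.exists_sub_mem_range hx
      refine ⟨a + b • (TrivSqZeroExt.inr 1 : ExteriorRing.{u} p), ?_⟩
      rw [hψ', hcls, eq_comm, cls_eq]
      exact hab
  let e := RingEquiv.ofBijective ψ bij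
  refine ⟨e.symm, fun i => ?_⟩
  suffices H : ∀ x, x ∈ exteriorDeg p n i ↔ e x ∈ C.homologyDeg i by
    ext x
    rw [H, AddSubgroup.mem_map]
    constructor
    · rintro ⟨y, hy, rfl⟩
      change e (e.symm y) ∈ _
      rwa [e.apply_symm_apply]
    · exact fun hx => ⟨_, hx, e.symm_apply_apply x⟩
  intro x
  constructor
  · obtain ⟨a, b, rfl⟩ := exists_exteriorRing_eq p x
    rintro ⟨h0, h1⟩
    change ψ _ ∈ _
    rw [hψ']
    refine add_mem ?_ ?_
    · by_cases hi : i = 0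
      · rw [← cls_intCast, hi]
        exact mem_homologyDeg.mpr ⟨a, intCast_mem_deg_zero a, _, rfl⟩
      · have : (a : ULift.{u} (ZMod p)) = 0 := by simpa using h0 hi
        rw [CharP.intCast_eq_zero_iff _ p] at this
        rw [(CharP.intCast_eq_zero_iff _ p a).mpr this]
        exact zero_mem _
    · by_cases hi : i = n
      · rw [hi]
        exact zsmul_mem (mem_homologyDeg.mpr ⟨g, h.mem, _, rfl⟩) _
      · have : (b : ULift.{u} (ZMod p)) = 0 := by simpa using h1 hi
        rw [CharP.intCast_eq_zero_iff _ p] at this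
        rw [zsmul_eq_mul, (CharP.intCast_eq_zero_iff _ p b).mpr this, zero_mul]
        exact zero_mem _
  · intro hx
    obtain ⟨y, hy, hd, he⟩ := mem_homologyDeg.mp hx
    have key {a b : ℤ} (hab : y - (a + b • g) ∈ C.d.range) : x = a + b • .inr 1 := by
      apply e.injective
      rw [← he]
      refine Eq.trans ?_ (hψ' a b).symm
      rw [hcls, cls_eq]
      exact hab
    by_cases h0 : i = 0
    · subst h0
      obtain ⟨k, hk⟩ := h.zero y hy hd
      rw [key (a := k) (b := 0) (by simpa using hk)]
      exact ⟨fun h => absurd rfl h, fun _ => by simp⟩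
    · by_cases hi : i = n
      · subst hi
        obtain ⟨k, hk⟩ := h.top y hy hd
        rw [key (a := 0) (b := k) (by simpa using hk)]
        exact ⟨fun _ => by simp, fun h => absurd rfl h⟩
      · rw [key (a := 0) (b := 0) (by simpa using h.acyclic_of_ne h0 hi hy hd)]
        simp

/-- A map of dgas with exterior homology is a quasi-isomorphism if it preserves the generator. -/
theorem ExteriorLike.isQuasiIso (hn : n ≠ 0) (h : ExteriorLike p n C g) (f : Hom C D)
    (h' : ExteriorLike p n D (f.toRingHom g)) : f.IsQuasiIso := by
  constructor
  · rw [injective_iff_map_eq_zero]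
    intro y hy
    obtain ⟨x, hx, rfl⟩ := exists_cls y
    rw [homologyMap_cls, cls_eq_zero] at hy
    obtain ⟨a, b, hab⟩ := h.exists_sub_mem_range hx
    have := sub_mem hy (f.map_mem_range hab)
    rw [← map_sub, sub_sub_cancel, map_add, map_intCast, map_zsmul] at this
    obtain ⟨ha, hb⟩ := h'.dvd_of_mem_range hn this
    rw [cls_eq_zero]
    simpa using add_mem hab (add_mem ((h.intCast a).mpr ha) ((h.zsmul b).mpr hb))
  · intro y
    obtain ⟨y, hy, rfl⟩ := exists_cls y
    obtain ⟨a, b, hab⟩ := h'.exists_sub_mem_range hy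
    refine ⟨C.cls (a + b • g)
      (by rw [map_add, d_intCast, map_zsmul, h.d_eq, smul_zero, add_zero]), ?_⟩
    rw [homologyMap_cls, eq_comm, cls_eq, map_add, map_intCast, map_zsmul]
    exact hab

/-- Any cycle of degree `n` that is not a boundary represents a generator of `H_n`. -/
theorem ExteriorLike.change_generator (hp : p.Prime) (h : ExteriorLike p n C g) {g' : C}
    (hg' : g' ∈ C.deg n) (hd : C.d g' = 0) (hr : g' ∉ C.d.range) : ExteriorLike p n C g' := by
  obtain ⟨m, hm⟩ := h.top g' hg' hd
  have hpm : ¬ (p : ℤ) ∣ m := fun hpm => hr <| by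
    simpa using add_mem hm ((h.zsmul m).mpr hpm)
  -- In homology g' = m g with m prime to p, so `a`, an inverse of m modulo p, converts multiples of
  -- `g` into multiples of `g'`.
  obtain ⟨a, b, hab⟩ := exists_mul_eq_one_add_mul hp hpm
  have hp' : Prime (p : ℤ) := Nat.prime_iff_prime_int.mp hp
  have key (k : ℤ) : k • g' ∈ C.d.range ↔ (p : ℤ) ∣ k := by
    have h1 : k • g' - (k * m) • g ∈ C.d.range := by
      simpa [smul_sub, mul_smul] using zsmul_mem hm k
    rw [← sub_add_cancel (k • g') ((k * m) • g), AddSubgroup.add_mem_cancel_left _ h1, h.zsmul,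
      hp'.dvd_mul, or_iff_left hpm]
  refine { h with mem := hg', d_eq := hd, top := fun x hx hdx => ?_, zsmul := key }
  obtain ⟨k, hk⟩ := h.top x hx hdx
  refine ⟨k * a, ?_⟩
  have h1 := zsmul_mem hm (k * a)
  have h2 := (h.zsmul (k * b * p)).mpr (Dvd.intro_left _ rfl)
  have h3 : (k * a) • m • g = k • g + (k * b * p) • g := by
    rw [smul_smul, mul_assoc, hab, mul_add, mul_one, add_smul, mul_assoc]
  convert sub_mem (sub_mem hk h1) h2 using 1
  rw [smul_sub, h3]
  abel

end Bridge

/-! ### Sub-dgas and connective covers -/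

section Sub

variable (C : DGA.{u}) (S : Subring C)

/-- The degree `i` part of a subring. -/
def subDeg (i : ℤ) : AddSubgroup S := (C.deg i).comap S.subtype.toAddMonoidHom

variable {S}

open Classical in
/-- The components of an element of a homogeneous subring. -/
noncomputable def subComponents (hS : ∀ x ∈ S, ∀ i, GradedRing.proj C.deg i x ∈ S) (x : S) :
    ⨁ i, C.subDeg S i :=
  DirectSum.mk (fun i => C.subDeg S i) (DirectSum.decompose C.deg (x : C)).support
    fun i => ⟨⟨GradedRing.proj C.deg i x, hS x x.2 i⟩, C.proj_mem i x⟩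

theorem subComponents_apply (hS : ∀ x ∈ S, ∀ i, GradedRing.proj C.deg i x ∈ S) (x : S) (i : ℤ) :
    C.subComponents hS x i = ⟨⟨GradedRing.proj C.deg i x, hS x x.2 i⟩, C.proj_mem i x⟩ := by
  classical
  by_cases hi : i ∈ (DirectSum.decompose C.deg (x : C)).support
  · exact DirectSum.mk_apply_of_mem hi
  · refine (DirectSum.mk_apply_of_notMem hi).trans (Subtype.ext (Subtype.ext ?_))
    rw [DFinsupp.notMem_support_iff] at hi
    exact (congrArg Subtype.val hi).symm

/-- Compared inside `C`, where the components are known to add up to the element. -/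
theorem coe_subComponents (hS : ∀ x ∈ S, ∀ i, GradedRing.proj C.deg i x ∈ S) (x : S) :
    DirectSum.coeAddMonoidHom (C.subDeg S) (C.subComponents hS x) = x := by
  classical
  apply Subtype.ext
  have h : S.subtype.toAddMonoidHom.comp (DirectSum.coeAddMonoidHom (C.subDeg S)) =
      (DirectSum.coeAddMonoidHom C.deg).comp (DirectSum.map fun i =>
        (S.subtype.toAddMonoidHom.comp (C.subDeg S i).subtype).codRestrict (C.deg i)
          fun y => y.2) := by
    refine DirectSum.addHom_ext fun i y => ?_
    simp only [AddMonoidHom.comp_apply, DirectSum.coeAddMonoidHom_of, DirectSum.map_of]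
    rfl
  refine (DFunLike.congr_fun h (C.subComponents hS x)).trans ?_
  rw [AddMonoidHom.comp_apply]
  refine Eq.trans (congrArg _ ?_) (DirectSum.Decomposition.left_inv (ℳ := C.deg) (x : C))
  refine DFinsupp.ext fun i => Subtype.ext ?_
  rw [DirectSum.map_apply, subComponents_apply]
  rfl

/-- The sub-dga on a homogeneous subring closed under the differential. -/
noncomputable def sub (hS : ∀ x ∈ S, ∀ i, GradedRing.proj C.deg i x ∈ S)
    (hd : ∀ x ∈ S, C.d x ∈ S) : DGA.{u} where
  carrier := S
  deg := C.subDeg S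
  graded :=
    { one_mem := SetLike.GradedOne.one_mem (A := C.deg)
      mul_mem := fun i j x y hx hy => SetLike.GradedMul.mul_mem (A := C.deg) hx hy
      toDecomposition := decompositionOfHom _
        { toFun := C.subComponents hS
          map_zero' := by
            refine DFinsupp.ext fun i => Subtype.ext (Subtype.ext ?_)
            rw [subComponents_apply]
            exact map_zero _
          map_add' := fun x y => by
            refine DFinsupp.ext fun i => Subtype.ext (Subtype.ext ?_)
            rw [subComponents_apply]
            refine (map_add (GradedRing.proj C.deg i) (x : C) y).trans ?_
            rw [DirectSum.add_apply, subComponents_apply, subComponents_apply]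
            rfl }
        (C.coe_subComponents hS)
        (fun i x => by
          refine DFinsupp.ext fun j => Subtype.ext (Subtype.ext ?_)
          refine (congrArg (fun t => ((t : C.subDeg S j) : S).1)
            (C.subComponents_apply hS x j)).trans ?_
          have hx : ((x : S) : C) ∈ C.deg i := x.2
          by_cases h : i = j
          · subst h
            rw [DirectSum.of_eq_same]
            exact proj_same hx
          · rw [DirectSum.of_eq_of_ne _ _ _ (Ne.symm h)]
            exact proj_ne hx h) }
  d := (C.d.comp S.subtype.toAddMonoidHom).codRestrict S.toAddSubgroup fun x => hd x x.2
  d_mem hx := C.d_mem (x := _) hx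
  d_d x := Subtype.ext (C.d_d x)
  leibniz y hx := Subtype.ext (C.leibniz y.1 hx)

/-- The inclusion of a sub-dga. -/
def subHom (hS : ∀ x ∈ S, ∀ i, GradedRing.proj C.deg i x ∈ S) (hd : ∀ x ∈ S, C.d x ∈ S) :
    Hom (C.sub hS hd) C where
  toRingHom := S.subtype
  map_deg hx := hx
  map_d _ := rfl

end Sub

/-! ### Connective covers -/

section Connective

/-- A dga is connective if it vanishes in negative degrees. -/
def IsConnective (C : DGA.{u}) : Prop := ∀ i < 0, ∀ x ∈ C.deg i, x = 0

variable (C : DGA.{u})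

/-- Reduces a component of a product to products of components. The subgroup is left free because
the connective cover needs it both for `⊥`, in negative degrees, and for the kernel of `d`, in
degree zero. -/
theorem proj_mul_mem {x y : C} (i : ℤ) {I : AddSubgroup C}
    (h : ∀ j k, j + k = i → GradedRing.proj C.deg j x * GradedRing.proj C.deg k y ∈ I) :
    GradedRing.proj C.deg i (x * y) ∈ I := by
  classical
  rw [← DirectSum.sum_support_decompose C.deg x, ← DirectSum.sum_support_decompose C.deg y,
    Finset.sum_mul_sum, map_sum]
  refine sum_mem fun j _ => ?_
  rw [map_sum]
  refine sum_mem fun k _ => ?_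
  have hjk := mul_mem_deg (C.proj_mem j x) (C.proj_mem k y) rfl
  by_cases hi : j + k = i
  · subst hi
    have := h j k rfl
    rw [← proj_same hjk] at this
    exact this
  · have := proj_ne hjk hi
    refine (congrArg (· ∈ I) this).mpr (zero_mem _)

/-- The elements whose components of negative degree vanish and whose component of degree zero is
a cycle. -/
def connectiveSubring : Subring C where
  carrier := {x | (∀ i < 0, GradedRing.proj C.deg i x = 0) ∧ C.d (GradedRing.proj C.deg 0 x) = 0}
  one_mem' := by
    have h := one_mem_deg (C := C)
    exact ⟨fun i hi => proj_ne h hi.ne', by rw [proj_same h, C.d_one]⟩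
  zero_mem' := by simp
  add_mem' := fun {x y} hx hy =>
    ⟨fun i hi => by rw [map_add, hx.1 i hi, hy.1 i hi, add_zero],
      by rw [map_add, map_add, hx.2, hy.2, add_zero]⟩
  neg_mem' := fun {x} hx =>
    ⟨fun i hi => by rw [map_neg, hx.1 i hi, neg_zero], by rw [map_neg, map_neg, hx.2, neg_zero]⟩
  mul_mem' := fun {x y} hx hy => by
    refine ⟨fun i hi => ?_, ?_⟩
    · refine C.proj_mul_mem (I := ⊥) i fun j k hjk => ?_
      by_cases hj : j < 0
      · rw [hx.1 j hj, zero_mul]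
        rfl
      · rw [hy.1 k (by omega), mul_zero]
        rfl
    · refine C.proj_mul_mem (I := C.d.ker) 0 fun j k hjk => ?_
      rw [AddMonoidHom.mem_ker]
      -- If j + k = 0 and (j, k) is not (0, 0), one of the two indices is negative and the product
      -- is zero.
      obtain hj | rfl | hj := lt_trichotomy j 0
      · rw [hx.1 j hj, zero_mul, map_zero]
      · obtain rfl : k = 0 := by omega
        exact d_mul_eq_zero hx.2 hy.2
      · rw [hy.1 k (by omega), mul_zero, map_zero]

variable {C} in
theorem mem_connectiveSubring_of_pos {i : ℤ} (hi : 0 < i) {x : C} (hx : x ∈ C.deg i) :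
    x ∈ C.connectiveSubring :=
  ⟨fun j hj => proj_ne hx (by omega), by rw [proj_ne hx hi.ne', map_zero]⟩

variable {C} in
theorem mem_connectiveSubring_of_zero {x : C} (hx : x ∈ C.deg 0) (hd : C.d x = 0) :
    x ∈ C.connectiveSubring :=
  ⟨fun j hj => proj_ne hx (by omega), by rw [proj_same hx, hd]⟩

theorem proj_mem_connectiveSubring {x : C} (hx : x ∈ C.connectiveSubring) (i : ℤ) :
    GradedRing.proj C.deg i x ∈ C.connectiveSubring := by
  have h := C.proj_mem i x
  obtain hi | rfl | hi := lt_trichotomy i 0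
  · rw [hx.1 i hi]
    exact zero_mem _
  · exact mem_connectiveSubring_of_zero h hx.2
  · exact mem_connectiveSubring_of_pos hi h

theorem d_mem_connectiveSubring {x : C} (hx : x ∈ C.connectiveSubring) :
    C.d x ∈ C.connectiveSubring := by
  refine ⟨fun i hi => ?_, ?_⟩
  · rw [proj_d]
    obtain h | h : i + 1 < 0 ∨ i + 1 = 0 := by omega
    · rw [hx.1 _ h, map_zero]
    · rw [h, hx.2]
  · rw [proj_d, C.d_d]

/-- The connective cover `τ_{≥0} C`. -/
noncomputable def connectiveCover : DGA.{u} :=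
  C.sub (fun _ hx => C.proj_mem_connectiveSubring hx) fun _ hx => C.d_mem_connectiveSubring hx

/-- The inclusion `τ_{≥0} C → C`. -/
noncomputable def connectiveCoverHom : Hom C.connectiveCover C :=
  C.subHom (fun _ hx => C.proj_mem_connectiveSubring hx) fun _ hx => C.d_mem_connectiveSubring hx

theorem isConnective_connectiveCover : C.connectiveCover.IsConnective := by
  intro i hi x hx
  have hx' : x.1 ∈ C.deg i := hx
  exact Subtype.ext ((proj_same hx').symm.trans (x.2.1 i hi))

variable {C} in
theorem mem_range_connectiveCover {i : ℤ} (hi : 0 ≤ i) {x : C.connectiveCover}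
    (hx : x ∈ C.connectiveCover.deg i) (h : C.connectiveCoverHom.toRingHom x ∈ C.d.range) :
    x ∈ C.connectiveCover.d.range := by
  obtain ⟨y, hy, hyx⟩ := exists_mem_deg_of_mem_range (C.connectiveCoverHom.map_deg hx) h
  exact ⟨⟨y, mem_connectiveSubring_of_pos (by omega) hy⟩, Subtype.ext hyx⟩

/-- Degree 0 of the cover keeps only cycles, and all positive degrees are kept. So cycles and
boundaries in degrees at least 0 are unchanged, and below 0 there is no homology to lose. -/
theorem isQuasiIso_connectiveCoverHom (h : ∀ i < 0, ∀ x ∈ C.deg i, C.d x = 0 → x ∈ C.d.range) :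
    C.connectiveCoverHom.IsQuasiIso := by
  refine Hom.isQuasiIso_of_homogeneous _ (fun i x hx hd hr => ?_) fun i y hy hd => ?_
  · obtain hi | hi := lt_or_ge i 0
    · rw [C.isConnective_connectiveCover i hi x hx]
      exact zero_mem _
    · exact mem_range_connectiveCover hi hx hr
  · obtain hi | hi := lt_or_ge i 0
    · exact ⟨0, map_zero _, by simpa using h i hi y hy hd⟩
    · have hy' : y ∈ C.connectiveSubring := by
        obtain rfl | hi := hi.eq_or_lt
        · exact mem_connectiveSubring_of_zero hy hd
        · exact mem_connectiveSubring_of_pos hi hy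
      refine ⟨⟨y, hy'⟩, Subtype.ext hd, ?_⟩
      change y - y ∈ _
      rw [sub_self]
      exact zero_mem _

end Connective

/-! ### Maps out of quotients and truncations -/

section QuotientMaps

variable (C : DGA.{u}) {D : DGA.{u}} {R : Set C} (hR : ∀ r ∈ R, ∃ k, r ∈ C.deg k)
  (hd : ∀ r ∈ R, C.d r ∈ TwoSidedIdeal.span R)

/-- The projection to a quotient dga. -/
def quotientHom : Hom C (C.quotient hR hd) where
  toRingHom := Ideal.Quotient.mk (TwoSidedIdeal.span R).asIdeal
  map_deg hx := ⟨_, hx, rfl⟩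
  map_d _ := rfl

theorem quotientHom_surjective : Function.Surjective (C.quotientHom hR hd).toRingHom :=
  Ideal.Quotient.mk_surjective

theorem quotientHom_eq_zero {x : C} :
    (C.quotientHom hR hd).toRingHom x = 0 ↔ x ∈ TwoSidedIdeal.span R :=
  Ideal.Quotient.eq_zero_iff_mem

theorem exists_quotientHom_eq {i : ℤ} {y : C.quotient hR hd} (hy : y ∈ (C.quotient hR hd).deg i) :
    ∃ x ∈ C.deg i, (C.quotientHom hR hd).toRingHom x = y := by
  obtain ⟨x, hx, rfl⟩ := hy
  exact ⟨x, hx, rfl⟩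

variable {C}

/-- A map of dgas that kills `R` factors through the quotient by `R`. -/
def Hom.quotientLift (f : Hom C D) (hf : ∀ r ∈ R, f.toRingHom r = 0) :
    Hom (C.quotient hR hd) D where
  toRingHom := Ideal.Quotient.lift (TwoSidedIdeal.span R).asIdeal f.toRingHom fun x hx => by
    have h : TwoSidedIdeal.span R ≤ TwoSidedIdeal.ker f.toRingHom :=
      TwoSidedIdeal.span_le.mpr fun r hr => (TwoSidedIdeal.mem_ker _).mpr (hf r hr)
    exact (TwoSidedIdeal.mem_ker _).mp (h hx)
  map_deg := by
    rintro i _ ⟨x, hx, rfl⟩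
    exact f.map_deg hx
  map_d x := by
    obtain ⟨x, rfl⟩ := Ideal.Quotient.mk_surjective x
    exact f.map_d x

/-- The composite of two maps of dgas. -/
def Hom.comp {E : DGA.{u}} (g : Hom D E) (f : Hom C D) : Hom C E where
  toRingHom := g.toRingHom.comp f.toRingHom
  map_deg hx := g.map_deg (f.map_deg hx)
  map_d x := (congrArg g.toRingHom (f.map_d x)).trans (g.map_d _)

end QuotientMaps

/-! ### Truncation above degree n -/

section Truncation

variable (C : DGA.{u}) (n : ℤ)

/-- The elements of degree `> n` and the boundaries of degree `n`. -/
def truncationRels : Set C :=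
  {x | (∃ i > n, x ∈ C.deg i) ∨ ∃ y ∈ C.deg (n + 1), C.d y = x}

theorem truncationRels_homogeneous : ∀ r ∈ C.truncationRels n, ∃ k, r ∈ C.deg k := by
  rintro r (⟨i, -, hr⟩ | ⟨y, hy, rfl⟩)
  · exact ⟨i, hr⟩
  · exact ⟨_, C.d_mem hy⟩

theorem truncationRels_d :
    ∀ r ∈ C.truncationRels n, C.d r ∈ TwoSidedIdeal.span (C.truncationRels n) := by
  rintro r (⟨i, hi, hr⟩ | ⟨y, hy, rfl⟩)
  · refine TwoSidedIdeal.subset_span ?_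
    by_cases h : i = n + 1
    · exact Or.inr ⟨r, h ▸ hr, rfl⟩
    · exact Or.inl ⟨i - 1, by omega, C.d_mem hr⟩
  · rw [C.d_d]
    exact TwoSidedIdeal.zero_mem _

/-- The truncation `τ_{≤n} C` of a connective dga `C`. -/
def truncation : DGA.{u} :=
  C.quotient (C.truncationRels_homogeneous n) (C.truncationRels_d n)

/-- The map `C → τ_{≤n} C`. -/
def truncationHom : Hom C (C.truncation n) :=
  C.quotientHom (C.truncationRels_homogeneous n) (C.truncationRels_d n)

variable {C n}

/-- The components of degree `≤ n` of the elements of the ideal generated by the elements of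
degree `> n` and the boundaries of degree `n`. -/
theorem IsConnective.proj_of_mem_span (hC : C.IsConnective) {x : C}
    (hx : x ∈ TwoSidedIdeal.span (C.truncationRels n)) :
    (∀ i < n, GradedRing.proj C.deg i x = 0) ∧ GradedRing.proj C.deg n x ∈ C.d.range := by
  refine AddSubgroup.closure_induction (p := fun x _ =>
    (∀ i < n, GradedRing.proj C.deg i x = 0) ∧ GradedRing.proj C.deg n x ∈ C.d.range)
    ?_ ?_ ?_ ?_ (C.mem_span_homogeneous _ hx)
  · rintro _ ⟨i, j, a, r, b, ha, hr, hb, rfl⟩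
    have above {k l : ℤ} {y : C} (hy : y ∈ C.deg l) (h : k < l ∨ y = 0) :
        GradedRing.proj C.deg k y = 0 := by
      obtain h | rfl := h
      · exact proj_ne hy h.ne'
      · exact map_zero _
    have ha0 : 0 ≤ i ∨ a = 0 := (lt_or_ge i 0).symm.imp_right fun hi => hC i hi a ha
    have hb0 : 0 ≤ j ∨ b = 0 := (lt_or_ge j 0).symm.imp_right fun hj => hC j hj b hb
    obtain rfl | ha' := eq_or_ne a 0
    · simp
    obtain rfl | hb' := eq_or_ne b 0
    · simp
    have hi := ha0.resolve_right ha'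
    have hj := hb0.resolve_right hb'
    obtain ⟨l, hl, hr⟩ | ⟨y, hy, rfl⟩ := hr
    · have h := mul_mem_deg (mul_mem_deg ha hr rfl) hb rfl
      exact ⟨fun k hk => above h (Or.inl (by omega)), by
        rw [above h (Or.inl (by omega))]; exact zero_mem _⟩
    · have hdy : C.d y ∈ C.deg n := d_mem' hy (by omega)
      have h := mul_mem_deg (mul_mem_deg ha hdy rfl) hb rfl
      refine ⟨fun k hk => above h (Or.inl (by omega)), ?_⟩
      by_cases hij : i + n + j = n
      · have hda : C.d a = 0 := hC (i - 1) (by omega) _ (C.d_mem ha)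
        have hdb : C.d b = 0 := hC (j - 1) (by omega) _ (C.d_mem hb)
        rw [hij] at h
        rw [proj_same h]
        exact mul_mem_range_right (mul_mem_range_left hda ⟨y, rfl⟩) hdb
      · rw [above h (Or.inl (by omega))]
        exact zero_mem _
  · simp
  · intro x y _ _ hx hy
    exact ⟨fun i hi => by rw [map_add, hx.1 i hi, hy.1 i hi, add_zero], by
      rw [map_add]; exact add_mem hx.2 hy.2⟩
  · intro x _ hx
    exact ⟨fun i hi => by rw [map_neg, hx.1 i hi, neg_zero], by
      rw [map_neg]; exact neg_mem hx.2⟩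

section

variable {R : Set C} (hR : ∀ r ∈ R, ∃ k, r ∈ C.deg k)
  (hd : ∀ r ∈ R, C.d r ∈ TwoSidedIdeal.span R)

/-- If x and dy agree modulo the ideal, their components in degree `i` differ by zero when i < n and
by a boundary when i = n. Only the span of `R` enters, so that a dga given by explicit relations can
be treated as a truncation. -/
theorem IsConnective.mem_range_quotient_iff (hC : C.IsConnective) (hn : 0 ≤ n)
    (hspan : TwoSidedIdeal.span R = TwoSidedIdeal.span (C.truncationRels n)) {i : ℤ} (hi : i ≤ n)
    {x : C} (hx : x ∈ C.deg i) :
    (C.quotientHom hR hd).toRingHom x ∈ (C.quotient hR hd).d.range ↔ x ∈ C.d.range := by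
  refine ⟨?_, Hom.map_mem_range _⟩
  rintro ⟨y, hy⟩
  obtain ⟨y, rfl⟩ := C.quotientHom_surjective hR hd y
  rw [← Hom.map_d, eq_comm, ← sub_eq_zero, ← map_sub, quotientHom_eq_zero, hspan] at hy
  obtain ⟨h1, h2⟩ := hC.proj_of_mem_span hy
  have h : GradedRing.proj C.deg i (x - C.d y) ∈ C.d.range := by
    obtain rfl | hi := hi.eq_or_lt
    · exact h2
    · rw [h1 i hi]
      exact zero_mem _
  rw [map_sub, proj_same hx] at h
  simpa using add_mem h (proj_mem_range (⟨y, rfl⟩ : C.d y ∈ C.d.range) i)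

/-- If `C` is connective and has exterior homology up to degree `n`, then its truncation has
exterior homology. -/
theorem ExteriorUpTo.quotient {p : ℕ} {g : C} (hC : C.IsConnective) (hn : 0 < n)
    (hspan : TwoSidedIdeal.span R = TwoSidedIdeal.span (C.truncationRels n))
    (h : ExteriorUpTo p n C g) :
    ExteriorLike p n (C.quotient hR hd) ((C.quotientHom hR hd).toRingHom g) := by
  have key {i : ℤ} (hi : i ≤ n) {x : C} (hx : x ∈ C.deg i) :=
    hC.mem_range_quotient_iff hR hd hn.le hspan hi hx
  have cyc {i : ℤ} (hi : i ≤ n) {y : C.quotient hR hd} (hy : y ∈ (C.quotient hR hd).deg i)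
      (hdy : (C.quotient hR hd).d y = 0) :
      ∃ x ∈ C.deg i, C.d x = 0 ∧ (C.quotientHom hR hd).toRingHom x = y := by
    obtain ⟨x, hx, rfl⟩ := C.exists_quotientHom_eq hR hd hy
    refine ⟨x, hx, ?_, rfl⟩
    rw [← Hom.map_d, quotientHom_eq_zero, hspan] at hdy
    -- The differential of the lift lies in the ideal and has degree below `n`, where the ideal is
    -- zero.
    rw [← proj_same (C.d_mem hx)]
    exact (hC.proj_of_mem_span hdy).1 _ (by omega)
  refine ⟨⟨Hom.map_deg _ h.mem, ?_, fun i hi h0 y hy hdy => ?_, fun y hy hdy => ?_, fun k => ?_,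
    fun y hy hdy => ?_, fun k => ?_⟩, fun i hi y hy _ => ?_⟩
  · rw [← Hom.map_d, h.d_eq, map_zero]
  · obtain ⟨x, hx, hdx, rfl⟩ := cyc hi.le hy hdy
    exact (key hi.le hx).mpr (h.acyclic i hi h0 x hx hdx)
  · obtain ⟨x, hx, hdx, rfl⟩ := cyc hn.le hy hdy
    obtain ⟨k, hk⟩ := h.zero x hx hdx
    refine ⟨k, ?_⟩
    rw [← map_intCast (C.quotientHom hR hd).toRingHom, ← map_sub]
    exact Hom.map_mem_range _ hk
  · rw [← h.intCast, ← key hn.le (intCast_mem_deg_zero k), map_intCast]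
  · obtain ⟨x, hx, hdx, rfl⟩ := cyc le_rfl hy hdy
    obtain ⟨k, hk⟩ := h.top x hx hdx
    refine ⟨k, ?_⟩
    rw [← map_zsmul, ← map_sub]
    exact Hom.map_mem_range _ hk
  · rw [← h.zsmul, ← key le_rfl (zsmul_mem h.mem k), map_zsmul]
  · obtain ⟨x, hx, rfl⟩ := C.exists_quotientHom_eq hR hd hy
    rw [(C.quotientHom_eq_zero hR hd).mpr]
    · exact zero_mem _
    · rw [hspan]
      exact TwoSidedIdeal.subset_span (Or.inl ⟨i, hi, hx⟩)

end

theorem ExteriorUpTo.truncation {p : ℕ} {g : C} (hC : C.IsConnective) (hn : 0 < n)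
    (h : ExteriorUpTo p n C g) :
    ExteriorLike p n (C.truncation n) ((C.truncationHom n).toRingHom g) :=
  h.quotient _ _ hC hn rfl

/-- A map of dgas induces a map of truncations. -/
def Hom.truncationMap {C D : DGA.{u}} (f : Hom C D) (n : ℤ) :
    Hom (C.truncation n) (D.truncation n) :=
  ((D.truncationHom n).comp f).quotientLift _ _ fun r hr => by
    refine (D.quotientHom_eq_zero _ _).mpr (TwoSidedIdeal.subset_span ?_)
    obtain ⟨i, hi, hr⟩ | ⟨y, hy, rfl⟩ := hr
    · exact Or.inl ⟨i, hi, f.map_deg hr⟩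
    · exact Or.inr ⟨f.toRingHom y, f.map_deg hy, (f.map_d y).symm⟩

/-- The connective cover of a dga with exterior homology has exterior homology. -/
theorem ExteriorLike.connectiveCover {p : ℕ} {g : C} (hn : 0 < n) (h : ExteriorLike p n C g)
    (g' : C.connectiveCover) (hg : C.connectiveCoverHom.toRingHom g' = g) :
    ExteriorLike p n C.connectiveCover g' := by
  have key {i : ℤ} (hi : 0 ≤ i) {x : C.connectiveCover} (hx : x ∈ C.connectiveCover.deg i) :
      x ∈ C.connectiveCover.d.range ↔ C.connectiveCoverHom.toRingHom x ∈ C.d.range :=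
    ⟨Hom.map_mem_range _, mem_range_connectiveCover hi hx⟩
  have cyc {x : C.connectiveCover} (hd : C.connectiveCover.d x = 0) :
      C.d (C.connectiveCoverHom.toRingHom x) = 0 := by
    rw [← Hom.map_d, hd, map_zero]
  have hgm : g' ∈ C.connectiveCover.deg n := by
    have := h.mem
    rw [← hg] at this
    exact this
  have acyclic {i : ℤ} (h0 : i ≠ 0) (hi : i ≠ n) (x : C.connectiveCover)
      (hx : x ∈ C.connectiveCover.deg i) (hd : C.connectiveCover.d x = 0) :
      x ∈ C.connectiveCover.d.range := by
    obtain hi' | hi' := lt_or_ge i 0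
    · rw [C.isConnective_connectiveCover i hi' x hx]
      exact zero_mem _
    · exact (key hi' hx).mpr (h.acyclic_of_ne h0 hi (Hom.map_deg _ hx) (cyc hd))
  refine ⟨⟨hgm, ?_, fun i hi h0 => acyclic h0 hi.ne, fun x hx hd => ?_, fun k => ?_,
    fun x hx hd => ?_, fun k => ?_⟩, fun i hi => acyclic (by omega) hi.ne'⟩
  · refine Subtype.ext (Eq.trans ?_ h.d_eq)
    rw [← hg]
    rfl
  · obtain ⟨k, hk⟩ := h.zero _ (Hom.map_deg _ hx) (cyc hd)
    refine ⟨k, ?_⟩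
    rw [key le_rfl (sub_mem hx (intCast_mem_deg_zero k)), map_sub, map_intCast]
    exact hk
  · rw [key le_rfl (intCast_mem_deg_zero k), map_intCast, h.intCast]
  · obtain ⟨k, hk⟩ := h.top _ (Hom.map_deg _ hx) (cyc hd)
    refine ⟨k, ?_⟩
    rw [key hn.le (sub_mem hx (zsmul_mem hgm k)), map_sub, map_zsmul, hg]
    exact hk
  · rw [key hn.le (zsmul_mem hgm k), map_zsmul, hg, h.zsmul]

end Truncation

/-- Maps from a connective dga factor through the connective cover. -/
noncomputable def Hom.connectiveLift {C D : DGA.{u}} (hC : C.IsConnective) (f : Hom C D) :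
    Hom C D.connectiveCover where
  toRingHom := f.toRingHom.codRestrict D.connectiveSubring fun x => by
    refine ⟨fun i hi => ?_, ?_⟩
    · rw [f.proj_map, hC i hi _ (C.proj_mem i x), map_zero]
    · rw [f.proj_map, ← f.map_d, hC _ (by omega) _ (C.d_mem (C.proj_mem 0 x)), map_zero]
  map_deg hx := f.map_deg hx
  map_d x := Subtype.ext (f.map_d x)

/-- A dga with exterior homology is quasi-isomorphic to the truncation of any connective dga with
exterior homology up to degree `n` that maps to it compatibly with the generators. -/
theorem ExteriorLike.quasiIsomorphic_truncation {p : ℕ} {n : ℤ} (hn : 0 < n) {C D : DGA.{u}}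
    {g : C} (hC : C.IsConnective) (h : ExteriorUpTo p n C g) (f : Hom C D)
    (h' : ExteriorLike p n D (f.toRingHom g)) : QuasiIsomorphic D (C.truncation n) := by
  -- The zig-zag is D ← τ_{≥0} D → τ_{≤n} τ_{≥0} D ← τ_{≤n} C. Passing to the connective cover first
  -- is necessary, since the quotient by `truncationRels` is controlled only for connective dgas.
  have h1 : D.connectiveCoverHom.IsQuasiIso :=
    D.isQuasiIso_connectiveCoverHom fun i hi x hx hd => h'.acyclic i (by omega) hi.ne x hx hd
  have h2 := h'.connectiveCover hn ((f.connectiveLift hC).toRingHom g) rfl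
  have h3 := h2.toExteriorUpTo.truncation D.isConnective_connectiveCover hn
  have h4 := h2.isQuasiIso hn.ne' _ h3
  have h5 := (h.truncation hC hn).isQuasiIso hn.ne' ((f.connectiveLift hC).truncationMap n) h3
  exact h1.quasiIsomorphic.symm.trans (h4.quasiIsomorphic.trans h5.quasiIsomorphic.symm)

/-! ### Resolutions of `𝔽_p` by successive extensions and their obstructions -/

section Obstruction

variable {R : Type*} [Ring R]

/-- The values prescribed for the differentials of elements `x₀, x₁, …` of degrees `1, 3, …`:
`d x₀ = p` and `d x_{k+1} = ∑_{i+j=k} xᵢ xⱼ`. -/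
def obst (p : ℕ) (x : ℕ → R) : ℕ → R
  | 0 => p
  | k + 1 => ∑ ij ∈ Finset.HasAntidiagonal.antidiagonal k, x ij.1 * x ij.2

/-- The correction term in the homotopy `u` between two sequences `x` and `y`. -/
def homotopyTerm (x y u : ℕ → R) : ℕ → R
  | 0 => 0
  | k + 1 => ∑ ij ∈ Finset.HasAntidiagonal.antidiagonal k, (u ij.1 * y ij.2 - x ij.1 * u ij.2)

/-- The value at `k` involves only indices below `k`, so a sequence may be changed from place `k` on
without affecting it. -/
theorem obst_congr (p : ℕ) {x y : ℕ → R} {k : ℕ} (h : ∀ i < k, x i = y i) :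
    obst p x k = obst p y k := by
  cases k with
  | zero => rfl
  | succ k =>
    refine Finset.sum_congr rfl fun ij hij => ?_
    rw [Finset.HasAntidiagonal.mem_antidiagonal] at hij
    rw [h _ (by omega), h _ (by omega)]

theorem homotopyTerm_congr {x y u v : ℕ → R} {k : ℕ} (h : ∀ i < k, u i = v i) :
    homotopyTerm x y u k = homotopyTerm x y v k := by
  cases k with
  | zero => rfl
  | succ k =>
    refine Finset.sum_congr rfl fun ij hij => ?_
    rw [Finset.HasAntidiagonal.mem_antidiagonal] at hij
    rw [h _ (by omega), h _ (by omega)]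

theorem map_obst {S : Type*} [Ring S] (f : R →+* S) (p : ℕ) (x : ℕ → R) (k : ℕ) :
    f (obst p x k) = obst p (fun i => f (x i)) k := by
  cases k with
  | zero => exact map_natCast f p
  | succ k => simp [obst]

open PowerSeries in
-- In generating functions the recursion reads p + t x², with p and t central. The convolution
-- identities below become short computations with noncommutative power series.
theorem mk_obst (p : ℕ) (x : ℕ → R) :
    PowerSeries.mk (obst p x) = (p : R⟦X⟧) + X * (PowerSeries.mk x * PowerSeries.mk x) := by
  have hp : (p : R⟦X⟧) = C (p : R) := (map_natCast C p).symm
  ext k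
  cases k with
  | zero => simp [obst]
  | succ k =>
    rw [map_add, coeff_succ_X_mul, coeff_mul, hp, coeff_C]
    simp [obst]

open PowerSeries in
theorem mk_homotopyTerm (x y u : ℕ → R) :
    PowerSeries.mk (homotopyTerm x y u) =
      X * (PowerSeries.mk u * PowerSeries.mk y - PowerSeries.mk x * PowerSeries.mk u) := by
  ext k
  cases k with
  | zero => simp [homotopyTerm]
  | succ k =>
    rw [coeff_succ_X_mul, map_sub, coeff_mul, coeff_mul]
    simp [homotopyTerm]

open PowerSeries in
-- The series p + t x² commutes with x; this is its commutator with x, coefficient by coefficient.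
theorem sum_obst_mul (p : ℕ) (x : ℕ → R) (k : ℕ) :
    ∑ ij ∈ Finset.HasAntidiagonal.antidiagonal k, (obst p x ij.1 * x ij.2 - x ij.1 * obst p x ij.2) = 0 := by
  have h : PowerSeries.mk (obst p x) * PowerSeries.mk x -
      PowerSeries.mk x * PowerSeries.mk (obst p x) = 0 := by
    have hX := X_mul (φ := PowerSeries.mk x)
    have hp := Nat.cast_commute p (PowerSeries.mk x)
    rw [mk_obst, add_mul, mul_add, hp.eq, ← mul_assoc (PowerSeries.mk x) X, ← hX]
    simp only [mul_assoc]
    abel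
  have := congrArg (coeff k) h
  simpa [coeff_mul] using this

open PowerSeries in
-- The left side is what the signed Leibniz rule gives for d(uy - xu) when dx = p + t x², dy = p + t
-- y² and du = x - y - t(uy - xu). All terms involving u cancel, leaving x² - y².
theorem sum_homotopyTerm (p : ℕ) (x y u : ℕ → R) (k : ℕ) :
    ∑ ij ∈ Finset.HasAntidiagonal.antidiagonal k, ((x ij.1 - y ij.1 - homotopyTerm x y u ij.1) * y ij.2 +
      u ij.1 * obst p y ij.2 - (obst p x ij.1 * u ij.2 -
        x ij.1 * (x ij.2 - y ij.2 - homotopyTerm x y u ij.2))) =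
      obst p x (k + 1) - obst p y (k + 1) := by
  set a := PowerSeries.mk x
  set b := PowerSeries.mk y
  set c := PowerSeries.mk u
  have h : (a - b - PowerSeries.mk (homotopyTerm x y u)) * b + c * PowerSeries.mk (obst p y) -
      (PowerSeries.mk (obst p x) * c - a * (a - b - PowerSeries.mk (homotopyTerm x y u))) =
      a * a - b * b := by
    have hX (φ : R⟦X⟧) : φ * X = X * φ := (X_mul (φ := φ)).symm
    have hp := Nat.cast_commute p c
    rw [mk_obst, mk_obst, mk_homotopyTerm, add_mul, mul_add, hp.eq]
    simp only [mul_sub, sub_mul, mul_assoc]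
    simp only [← mul_assoc _ X, hX]
    simp only [mul_assoc]
    abel
  have := congrArg (coeff k) h
  simpa [coeff_mul, a, b, c, Finset.sum_add_distrib, obst] using this

/-- An additive map satisfying the signed Leibniz rule on the `xᵢ` kills the obstructions. -/
theorem map_obst_eq_zero {d : R →+ R} {p : ℕ} {x : ℕ → R} {k : ℕ} (hp : d p = 0)
    (hd : ∀ i < k, d (x i) = obst p x i)
    (hmul : ∀ i < k, ∀ y, d (x i * y) = d (x i) * y - x i * d y) : d (obst p x k) = 0 := by
  cases k with
  | zero => exact hp
  | succ k =>
    -- The signed Leibniz rule turns d(x²) into (dx)x - x(dx), which is the commutator known to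
    -- vanish.
    rw [obst, map_sum, ← sum_obst_mul p x k]
    refine Finset.sum_congr rfl fun ij hij => ?_
    rw [Finset.HasAntidiagonal.mem_antidiagonal] at hij
    rw [hmul _ (by omega), hd _ (by omega), hd _ (by omega)]

end Obstruction

/-! ### Resolving sequences and the invariance of the obstruction -/

section Sequences

variable {C D : DGA.{u}}

theorem d_odd_mul {i : ℤ} {x : C} (hx : x ∈ C.deg (2 * i + 1)) (y : C) :
    C.d (x * y) = C.d x * y - x * C.d y := by
  rw [C.leibniz y hx, Int.negOnePow_succ, Int.negOnePow_two_mul]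
  simp [sub_eq_add_neg]

theorem d_even_mul {i : ℤ} {x : C} (hx : x ∈ C.deg (2 * i + 2)) (y : C) :
    C.d (x * y) = C.d x * y + x * C.d y := by
  rw [C.leibniz y hx, show 2 * i + 2 = 2 * (i + 1) by ring, Int.negOnePow_two_mul]
  simp

/-- Stated for any graded ring because it is also needed in a free ring, to show that a prescribed
differential is homogeneous before there is a dga. -/
theorem obst_mem {R : Type*} [Ring R] (𝒜 : ℤ → AddSubgroup R) [GradedRing 𝒜] {p : ℕ} {x : ℕ → R}
    (hx : ∀ i : ℕ, x i ∈ 𝒜 (2 * i + 1)) (k : ℕ) : obst p x k ∈ 𝒜 (2 * k) := by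
  cases k with
  | zero => exact SetLike.natCast_mem_graded 𝒜 p
  | succ k =>
    refine sum_mem fun ij hij => ?_
    rw [Finset.HasAntidiagonal.mem_antidiagonal] at hij
    have := SetLike.GradedMul.mul_mem (hx ij.1) (hx ij.2)
    rwa [show 2 * (ij.1 : ℤ) + 1 + (2 * ij.2 + 1) = 2 * (k + 1 : ℕ) by omega] at this

theorem obst_mem_natCast {R : Type*} [Ring R] (𝒜 : ℤ → AddSubgroup R) [GradedRing 𝒜] {p : ℕ}
    {x : ℕ → R} (hx : ∀ i : ℕ, x i ∈ 𝒜 (2 * i + 1)) (k : ℕ) : obst p x k ∈ 𝒜 (2 * k : ℕ) := by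
  have := obst_mem 𝒜 hx (p := p) k
  rwa [← Nat.cast_ofNat, ← Nat.cast_mul] at this

theorem homotopyTerm_mem {x y u : ℕ → C} (hx : ∀ i : ℕ, x i ∈ C.deg (2 * i + 1))
    (hy : ∀ i : ℕ, y i ∈ C.deg (2 * i + 1)) (hu : ∀ i : ℕ, u i ∈ C.deg (2 * i + 2)) (k : ℕ) :
    homotopyTerm x y u k ∈ C.deg (2 * k + 1) := by
  cases k with
  | zero => exact zero_mem _
  | succ k =>
    refine sum_mem fun ij hij => ?_
    rw [Finset.HasAntidiagonal.mem_antidiagonal] at hij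
    exact sub_mem (mul_mem_deg (hu _) (hy _) (by omega)) (mul_mem_deg (hx _) (hu _) (by omega))

/-- A sequence `x₀, x₁, …` with `d xₖ` as prescribed by `obst` for `k < m`. -/
structure IsResolving (p m : ℕ) (C : DGA.{u}) (x : ℕ → C) : Prop where
  mem : ∀ i : ℕ, x i ∈ C.deg (2 * i + 1)
  d_eq : ∀ i < m, C.d (x i) = obst p x i

theorem IsResolving.map {p m : ℕ} {x : ℕ → C} (h : IsResolving p m C x) (f : Hom C D) :
    IsResolving p m D fun i => f.toRingHom (x i) :=
  ⟨fun i => f.map_deg (h.mem i), fun i hi => by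
    rw [← f.map_d, h.d_eq i hi, map_obst]⟩

theorem IsResolving.d_obst {p m : ℕ} {x : ℕ → C} (h : IsResolving p m C x) :
    C.d (obst p x m) = 0 :=
  map_obst_eq_zero (d_natCast p) h.d_eq fun i _ => d_odd_mul (h.mem i)

/-- A resolving sequence extends by one step when its obstruction vanishes. -/
theorem IsResolving.exists_succ {p m : ℕ} {x : ℕ → C} (h : IsResolving p m C x)
    (ho : obst p x m ∈ C.d.range) : ∃ x, IsResolving p (m + 1) C x := by
  obtain ⟨y, hy, hd⟩ := exists_mem_deg_of_mem_range (obst_mem C.deg h.mem m) ho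
  have hlt {i : ℕ} (hi : i < m) : Function.update x m y i = x i :=
    Function.update_of_ne hi.ne _ _
  refine ⟨Function.update x m y, fun i => ?_, fun i hi => ?_⟩
  · obtain rfl | him := eq_or_ne i m
    · rwa [Function.update_self]
    · rw [Function.update_of_ne him]
      exact h.mem i
  · obtain hi | rfl := (Nat.lt_succ_iff.mp hi).lt_or_eq
    · rw [hlt hi, h.d_eq i hi, obst_congr p fun j hj => hlt (hj.trans hi)]
    · rw [Function.update_self, hd, obst_congr p fun j hj => hlt hj]

/-- The obstruction for index k lies in H_{2k}. For k = 0 it is p, which is zero in homology, and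
for the other indices the group vanishes, as 2k is neither 0 nor `n`. -/
theorem ExteriorLike.exists_isResolving {p : ℕ} {n : ℤ} {g : C} (h : ExteriorLike p n C g)
    (m : ℕ) (hm : ∀ k < m, 2 * (k : ℤ) ≠ n) : ∃ x, IsResolving p m C x := by
  induction m with
  | zero => exact ⟨0, fun i => zero_mem _, fun i hi => absurd hi (by omega)⟩
  | succ m ih =>
    obtain ⟨x, hx⟩ := ih fun k hk => hm k (by omega)
    refine hx.exists_succ ?_
    obtain rfl | hm0 := eq_or_ne m 0
    · have := (h.intCast p).mpr dvd_rfl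
      rwa [Int.cast_natCast] at this
    · exact h.acyclic_of_ne (by omega) (hm m (by omega)) (obst_mem C.deg hx.mem m) hx.d_obst

theorem d_homotopyTerm {p k : ℕ} {x y u : ℕ → C} (hx : IsResolving p k C x)
    (hy : IsResolving p k C y) (hu : ∀ i : ℕ, u i ∈ C.deg (2 * i + 2))
    (hd : ∀ i < k, C.d (u i) = x i - y i - homotopyTerm x y u i) :
    C.d (homotopyTerm x y u k) = obst p x k - obst p y k := by
  cases k with
  | zero => simp [homotopyTerm, obst]
  | succ k =>
    rw [← sum_homotopyTerm p x y u k, homotopyTerm, map_sum]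
    refine Finset.sum_congr rfl fun ij hij => ?_
    rw [Finset.HasAntidiagonal.mem_antidiagonal] at hij
    rw [map_sub, d_even_mul (hu _), d_odd_mul (hx.mem _), hd _ (by omega), hd _ (by omega),
      hx.d_eq _ (by omega), hy.d_eq _ (by omega)]

theorem IsResolving.mono {p m k : ℕ} {x : ℕ → C} (h : IsResolving p m C x) (hk : k ≤ m) :
    IsResolving p k C x :=
  ⟨h.mem, fun i hi => h.d_eq i (by omega)⟩

/-- The class of the obstruction does not depend on the resolving sequence. -/
theorem IsResolving.obst_sub_mem_range {p m : ℕ} {x y : ℕ → C} (hx : IsResolving p m C x)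
    (hy : IsResolving p m C y)
    (hC : ∀ k < m, ∀ z ∈ C.deg (2 * (k : ℤ) + 1), C.d z = 0 → z ∈ C.d.range) :
    obst p x m - obst p y m ∈ C.d.range := by
  have key (k : ℕ) (hk : k ≤ m) : ∃ u : ℕ → C, (∀ i : ℕ, u i ∈ C.deg (2 * i + 2)) ∧
      ∀ i < k, C.d (u i) = x i - y i - homotopyTerm x y u i := by
    induction k with
    | zero => exact ⟨0, fun i => zero_mem _, fun i hi => absurd hi (by omega)⟩
    | succ k ih =>
      obtain ⟨u, hu, hd⟩ := ih (by omega)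
      -- The u_i already found make this a cycle of odd degree 2k + 1, and the vanishing of homology
      -- there supplies the next u_k.
      have hc : C.d (x k - y k - homotopyTerm x y u k) = 0 := by
        rw [map_sub, map_sub, d_homotopyTerm (hx.mono (by omega)) (hy.mono (by omega)) hu hd,
          hx.d_eq k hk, hy.d_eq k hk, sub_self]
      have hm : x k - y k - homotopyTerm x y u k ∈ C.deg (2 * k + 1) :=
        sub_mem (sub_mem (hx.mem k) (hy.mem k)) (homotopyTerm_mem hx.mem hy.mem hu k)
      obtain ⟨v, hv, hdv⟩ := exists_mem_deg_of_mem_range hm (hC k hk _ hm hc)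
      have hlt {i : ℕ} (hi : i < k) : Function.update u k v i = u i :=
        Function.update_of_ne hi.ne _ _
      refine ⟨Function.update u k v, fun i => ?_, fun i hi => ?_⟩
      · obtain rfl | hik := eq_or_ne i k
        · rw [Function.update_self]
          convert hv using 2
          ring
        · rw [Function.update_of_ne hik]
          exact hu i
      · obtain hi | rfl := (Nat.lt_succ_iff.mp hi).lt_or_eq
        · rw [hlt hi, hd i hi, homotopyTerm_congr fun j hj => hlt (hj.trans hi)]
        · rw [Function.update_self, hdv, homotopyTerm_congr fun j hj => hlt hj]
  obtain ⟨u, hu, hd⟩ := key m le_rfl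
  exact ⟨_, d_homotopyTerm hx hy hu hd⟩

/-- For dgas with exterior homology in an even degree `2m`, the existence of a resolving sequence
with vanishing obstruction is invariant under quasi-isomorphism. -/
theorem QuasiIsomorphic.exists_isResolving_iff {p m : ℕ} (hm : 0 < m)
    (h : QuasiIsomorphic C D) :
    (HasExteriorHomology p (2 * m : ℕ) C ∧ ∃ x, IsResolving p (m + 1) C x) ↔
      (HasExteriorHomology p (2 * m : ℕ) D ∧ ∃ x, IsResolving p (m + 1) D x) := by
  induction h with
  | rel C D h =>
    obtain ⟨f, hf⟩ := h
    rw [hf.hasExteriorHomology_iff]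
    refine and_congr_right fun hD => ⟨fun ⟨x, hx⟩ => ⟨_, hx.map f⟩, fun ⟨y, hy⟩ => ?_⟩
    obtain ⟨g, hg⟩ := ((hf.hasExteriorHomology_iff _ _).mpr hD).exists_exteriorLike (by omega)
    obtain ⟨g', hg'⟩ := hD.exists_exteriorLike (by omega)
    obtain ⟨x, hx⟩ := hg.exists_isResolving m fun k hk => by omega
    -- The image in `D` of the obstruction of `x` is homologous to that of `y`, hence a boundary,
    -- and a quasi-isomorphism reflects boundaries among cycles.
    refine hx.exists_succ (hf.mem_range hx.d_obst ?_)
    rw [map_obst]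
    have h1 := (hx.map f).obst_sub_mem_range (hy.mono m.le_succ) fun k hk z hz hd =>
      hg'.acyclic_of_ne (by omega) (by omega) hz hd
    have h2 : obst p y m ∈ D.d.range := ⟨_, hy.d_eq m m.lt_succ_self⟩
    simpa using add_mem h1 h2
  | refl C => rfl
  | symm C D _ ih => exact ih.symm
  | trans C D E _ _ ih ih' => exact ih.trans ih'

/-- Two dgas with exterior homology in degree `2m` are not quasi-isomorphic if the obstruction
vanishes for one and not for the other. -/
theorem IsResolving.not_quasiIsomorphic {p m : ℕ} (hm : 0 < m) {x : ℕ → C} {y : ℕ → D}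
    (hC : HasExteriorHomology p (2 * m : ℕ) C) (hx : IsResolving p m C x)
    (hxm : obst p x m ∉ C.d.range)
    (hD : HasExteriorHomology p (2 * m : ℕ) D) (hy : IsResolving p (m + 1) D y) :
    ¬ QuasiIsomorphic C D := by
  intro h
  obtain ⟨-, z, hz⟩ := (h.exists_isResolving_iff hm).mpr ⟨hD, y, hy⟩
  obtain ⟨g, hg⟩ := hC.exists_exteriorLike (by omega)
  have h1 := hx.obst_sub_mem_range (hz.mono m.le_succ) fun k hk z hz hd =>
    hg.acyclic_of_ne (by omega) (by omega) hz hd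
  have h2 : obst p z m ∈ C.d.range := ⟨_, hz.d_eq m m.lt_succ_self⟩
  exact hxm (by simpa using add_mem h1 h2)

end Sequences

/-! ### Additive maps on free rings and maps out of free dgas -/

section FreeMaps

variable {X : Type u}

/-- The additive map on the free ring with prescribed values on words. -/
def wordLift {M : Type*} [AddCommGroup M] (f : List X → M) : FreeRing X →+ M :=
  FreeAbelianGroup.lift fun l : FreeMonoid X => f l.toList

theorem wordLift_word {M : Type*} [AddCommGroup M] (f : List X → M) (l : List X) :
    wordLift f (word l) = f l := by
  rw [← of_eq_word]
  exact FreeAbelianGroup.lift_apply_of _ _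

theorem word_cons (x : X) (l : List X) : word (x :: l) = FreeRing.of x * word l := by
  simp [word]

theorem wordDeg_cons (w : X → ℤ) (x : X) (l : List X) :
    wordDeg w (x :: l) = w x + wordDeg w l := by
  simp [wordDeg]

theorem wordDeg_nil (w : X → ℤ) : wordDeg w [] = 0 := rfl

theorem word_nil : word ([] : List X) = 1 := rfl

theorem wordDeg_nonneg {w : X → ℤ} (hw : ∀ x, 0 ≤ w x) (l : List X) : 0 ≤ wordDeg w l :=
  List.sum_nonneg fun a ha => by
    obtain ⟨b, -, rfl⟩ := List.mem_map.mp ha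
    exact hw b

theorem eq_zero_of_mem_freeDeg_of_neg {w : X → ℤ} (hw : ∀ x, 0 ≤ w x) {i : ℤ} (hi : i < 0)
    {a : FreeRing X} (ha : a ∈ freeDeg w i) : a = 0 := by
  refine freeDeg_induction (P := fun a : FreeRing X => a = 0) rfl ?_
    (fun a h => by rw [h, neg_zero]) (fun a b h h' => by rw [h, h', add_zero]) ha
  rintro l rfl
  exact absurd (wordDeg_nonneg hw l) hi.not_ge

theorem freeRing_hom_ext {M : Type*} [AddCommGroup M] {f g : FreeRing X →+ M}
    (h : ∀ l, f (word l) = g (word l)) (a : FreeRing X) : f a = g a := by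
  induction a using freeRing_induction with
  | zero => rw [map_zero, map_zero]
  | word l => exact h l
  | neg l => rw [map_neg, map_neg, h]
  | add a b ha hb => rw [map_add, map_add, ha, hb]

variable {w : X → ℤ} {δ : X → FreeRing X} (hδ : ∀ x, δ x ∈ freeDeg w (w x - 1))
  (hδδ : ∀ x, freeD w δ (δ x) = 0) {C : DGA.{u}} (v : X → C) (hv : ∀ x, v x ∈ C.deg (w x))
  (hd : ∀ x, C.d (v x) = FreeRing.lift v (δ x))

/-- The map from a free dga determined by its values on generators. -/
def freeHom : Hom (free w δ hδ hδδ) C where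
  toRingHom := FreeRing.lift v
  map_deg {i a} ha := by
    refine freeDeg_induction (P := fun a => FreeRing.lift v a ∈ C.deg i)
      (by rw [map_zero]; exact zero_mem _) ?_ (fun a h => by rw [map_neg]; exact neg_mem h)
      (fun a b h h' => by rw [map_add]; exact add_mem h h') ha
    rintro l rfl
    clear ha
    induction l with
    | nil => exact (map_one (FreeRing.lift v)) ▸ one_mem_deg
    | cons x l ih =>
      rw [word_cons, map_mul, FreeRing.lift_of]
      exact mul_mem_deg (hv x) ih (by simp [wordDeg])
  map_d a := by
    refine freeRing_hom_ext (f := (FreeRing.lift v).toAddMonoidHom.comp (freeD w δ))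
      (g := C.d.comp (FreeRing.lift v).toAddMonoidHom) (fun l => ?_) a
    change FreeRing.lift v (freeD w δ (word l)) = C.d (FreeRing.lift v (word l))
    rw [freeD_word]
    induction l with
    | nil =>
      change FreeRing.lift v 0 = C.d (FreeRing.lift v 1)
      rw [map_zero, map_one, C.d_one]
    | cons x l ih =>
      rw [word_cons, map_mul, FreeRing.lift_of, C.leibniz _ (hv x), wordD, map_add, map_zsmul,
        map_mul, map_mul, ih, hd, FreeRing.lift_of]

end FreeMaps

/-! ### A free model of dgas with exterior homology -/

/-- Generators `x₀, x₁, …` and `z`. -/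
inductive Cell : Type u
  | x (k : ℕ)
  | z

namespace Cell

/-- `|xₖ| = 2k + 1` and `|z| = n`. -/
def deg (n : ℕ) : Cell.{u} → ℤ
  | x k => 2 * k + 1
  | z => n

/-- The generator `xₖ`. -/
def X (k : ℕ) : FreeRing Cell.{u} := FreeRing.of (x k)

/-- The generator `z`. -/
def Z : FreeRing Cell.{u} := FreeRing.of z

/-- The differential of the generators: `dz = 0`, `d xₖ` is prescribed by `obst` for `k ≤ m`, with
an additional summand `c z` for `k = m`, and `d xₖ = 0` for `k > m`. -/
def diff (p m : ℕ) (c : ℤ) : Cell.{u} → FreeRing Cell.{u}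
  | x k => if k < m then obst p X k else if k = m then obst p X k + c • Z else 0
  | z => 0

variable {p m n : ℕ} {c : ℤ}

theorem diff_x_lt {k : ℕ} (hk : k < m) : diff.{u} p m c (x k) = obst p X k := if_pos hk

theorem diff_x_self : diff.{u} p m c (x m) = obst p X m + c • Z := by simp [diff]

theorem diff_x_le {k : ℕ} (hk : k ≤ m) :
    diff.{u} p m c (x k) = obst p X k + if k = m then c • Z else 0 := by
  obtain hk | rfl := hk.lt_or_eq
  · rw [diff_x_lt hk, if_neg hk.ne, add_zero]
  · rw [diff_x_self, if_pos rfl]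

theorem diff_x_gt {k : ℕ} (hk : m < k) : diff.{u} p m c (x k) = 0 := by
  rw [diff, if_neg hk.not_gt, if_neg hk.ne']

theorem X_mem (k : ℕ) : X.{u} k ∈ freeDeg (deg n) (2 * k + 1) :=
  of_mem_freeDeg (w := deg n) (x k)

theorem Z_mem : Z.{u} ∈ freeDeg (deg n) n := of_mem_freeDeg (w := deg n) z

/-- The summand `c • Z` of d x_m must have degree 2m; this is the purpose of the alternative `hc`.
-/
theorem diff_mem (hc : c = 0 ∨ n = 2 * m) (y : Cell.{u}) :
    diff p m c y ∈ freeDeg (deg n) (deg n y - 1) := by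
  cases y with
  | z => exact zero_mem _
  | x k =>
    have hk : obst p X.{u} k ∈ freeDeg (deg n) (2 * k) := obst_mem (freeDeg (deg n)) X_mem k
    rw [deg, add_sub_cancel_right]
    obtain h | h := le_or_gt k m
    · rw [diff_x_le h]
      refine add_mem hk ?_
      split_ifs with hkm
      · obtain rfl | rfl := hc
        · rw [zero_smul]
          exact zero_mem _
        · rw [hkm]
          have := zsmul_mem (Z_mem.{u} (n := 2 * m)) c
          rwa [Nat.cast_mul, Nat.cast_ofNat] at this
      · exact zero_mem _
    · rw [diff_x_gt h]
      exact zero_mem _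

theorem freeD_X_mul (k : ℕ) (a : FreeRing Cell.{u}) :
    freeD (deg n) (diff p m c) (X k * a) =
      diff p m c (x k) * a - X k * freeD (deg n) (diff p m c) a := by
  rw [X, freeD_of_mul, deg, Int.negOnePow_succ, Int.negOnePow_two_mul]
  simp [sub_eq_add_neg]

theorem freeD_X (k : ℕ) : freeD (deg.{u} n) (diff p m c) (X k) = diff p m c (x k) := freeD_of _

theorem freeD_Z : freeD (deg.{u} n) (diff p m c) Z = 0 := freeD_of _

/-- The formal cancellation `map_obst_eq_zero` applies to the derivation of the free ring itself,
and the extra summand is a multiple of the cycle z. -/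
theorem freeD_diff (y : Cell.{u}) :
    freeD (deg n) (diff p m c) (diff p m c y) = 0 := by
  cases y with
  | z => exact map_zero _
  | x k =>
    obtain h | h := le_or_gt k m
    · have h1 : freeD (deg.{u} n) (diff p m c) (obst p X k) = 0 :=
        map_obst_eq_zero (freeD_natCast p)
          (fun i hi => by rw [freeD_X, diff_x_lt (hi.trans_le h)])
          fun i hi a => by rw [freeD_X_mul, freeD_X]
      rw [diff_x_le h, map_add, h1, zero_add]
      split_ifs
      · rw [map_zsmul, freeD_Z, smul_zero]
      · exact map_zero _
    · rw [diff_x_gt h, map_zero]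

end Cell

/-- The free dga on generators `x₀, x₁, …` and `z` with the differential `Cell.diff`. -/
def model (p m n : ℕ) (c : ℤ) (hc : c = 0 ∨ n = 2 * m) : DGA.{u} :=
  free (Cell.deg n) (Cell.diff p m c) (Cell.diff_mem hc) Cell.freeD_diff

/-! ### Maps out of the model -/

section ModelHom

variable {p m n : ℕ} {c : ℤ} (hc : c = 0 ∨ n = 2 * m)

/-- The generator `xₖ` of the model. -/
def modelX (k : ℕ) : model.{u} p m n c hc := Cell.X k

/-- The generator `z` of the model. -/
def modelZ : model.{u} p m n c hc := Cell.Z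

variable {C : DGA.{u}} {y : ℕ → C} {g : C}

/-- The images of the generators of the model. -/
def modelValue (m : ℕ) (y : ℕ → C) (g : C) : Cell.{u} → C
  | .x k => if k ≤ m then y k else 0
  | .z => g

/-- The map from the model determined by a resolving sequence `y` and a cycle `g`. -/
def modelHom (hy : IsResolving p m C y) (hym : C.d (y m) = obst p y m + c • g) (hg : g ∈ C.deg n)
    (hdg : C.d g = 0) : Hom (model p m n c hc) C :=
  freeHom (Cell.diff_mem hc) Cell.freeD_diff (modelValue m y g)
    (fun a => by
      cases a with
      | z => exact hg
      | x k =>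
        rw [modelValue]
        split_ifs
        · exact hy.mem k
        · exact zero_mem _)
    (fun a => by
      have hX (k : ℕ) : FreeRing.lift (modelValue m y g) (Cell.X k) =
          if k ≤ m then y k else 0 := FreeRing.lift_of _ _
      have hZ : FreeRing.lift (modelValue m y g) Cell.Z = g := FreeRing.lift_of _ _
      cases a with
      | z => exact hdg.trans (map_zero _).symm
      | x k =>
        rw [modelValue]
        split_ifs with hk
        · rw [Cell.diff_x_le hk, map_add, map_obst, obst_congr p (y := y)
            fun i hi => (hX i).trans (if_pos (hi.le.trans hk))]
          split_ifs with hkm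
          · rw [hkm, map_zsmul, hZ, hym]
          · rw [map_zero, add_zero, hy.d_eq k (lt_of_le_of_ne hk hkm)]
        · rw [Cell.diff_x_gt (not_le.mp hk), map_zero, map_zero])

theorem modelHom_Z (hy : IsResolving p m C y) (hym : C.d (y m) = obst p y m + c • g)
    (hg : g ∈ C.deg n) (hdg : C.d g = 0) :
    (modelHom hc hy hym hg hdg).toRingHom (modelZ hc) = g :=
  FreeRing.lift_of _ _

end ModelHom

/-! ### The homology of the free model in low degrees -/

namespace Cell

variable {p m n : ℕ} {c : ℤ}

/-- The coefficient of the empty word. -/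
def constCoeff : FreeRing Cell.{u} →+ ℤ := wordLift fun l => match l with
  | [] => 1
  | _ :: _ => 0

theorem constCoeff_of_mul (a : Cell.{u}) (b : FreeRing Cell.{u}) :
    constCoeff (FreeRing.of a * b) = 0 :=
  freeRing_hom_ext (f := constCoeff.comp (AddMonoidHom.mulLeft (FreeRing.of a))) (g := 0)
    (fun l => by
      rw [AddMonoidHom.comp_apply, AddMonoidHom.coe_mulLeft, ← word_cons]
      exact wordLift_word _ _) b

theorem constCoeff_one : constCoeff (1 : FreeRing Cell.{u}) = 1 := wordLift_word _ []

/-- Additive maps that vanish on `p`, `z` and the products `xᵢ xⱼ` vanish on differentials of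
generators. -/
theorem map_diff_eq_zero {M : Type*} [AddCommGroup M] (f : FreeRing Cell.{u} →+ M)
    (hp : f p = 0) (hz : f Z = 0) (hX : ∀ i j, f (X i * X j) = 0) (a : Cell.{u}) :
    f (diff p m c a) = 0 := by
  cases a with
  | z => exact map_zero f
  | x k =>
    obtain h | h := le_or_gt k m
    · rw [diff_x_le h, map_add]
      have h1 : f (obst p X k) = 0 := by
        cases k with
        | zero => exact hp
        | succ k =>
          rw [obst, map_sum]
          exact Finset.sum_eq_zero fun ij _ => hX _ _
      rw [h1, zero_add]
      split_ifs
      · rw [map_zsmul, hz, smul_zero]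
      · exact map_zero f
    · rw [diff_x_gt h, map_zero]

/-- A differential can produce the empty word only through the constant p in d x_0, so modulo p the
constant coefficient vanishes on boundaries. -/
theorem dvd_constCoeff_freeD (a : FreeRing Cell.{u}) :
    (p : ℤ) ∣ constCoeff (freeD (deg n) (diff p m c) a) := by
  rw [← ZMod.intCast_zmod_eq_zero_iff_dvd]
  refine freeRing_hom_ext (f := (Int.castAddHom (ZMod p)).comp
    (constCoeff.comp (freeD (deg n) (diff p m c)))) (g := 0) (fun l => ?_) a
  simp only [AddMonoidHom.comp_apply, freeD_word, AddMonoidHom.zero_apply]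
  cases l with
  | nil => simp [wordD]
  | cons a l =>
    rw [wordD, map_add, map_zsmul, constCoeff_of_mul, smul_zero, add_zero]
    refine map_diff_eq_zero (p := p) ((Int.castAddHom (ZMod p)).comp
      (constCoeff.comp (AddMonoidHom.mulRight (word l)))) ?_ ?_ ?_ a
    · change ((constCoeff ((p : FreeRing Cell) * word l) : ℤ) : ZMod p) = 0
      rw [← nsmul_eq_mul, map_nsmul]
      simp
    · simp [Z, constCoeff_of_mul]
    · simp [X, mul_assoc, constCoeff_of_mul]

/-- The functional detecting the class of `z` modulo `p`. -/
def topCoeff (p m : ℕ) (c : ℤ) : FreeRing Cell.{u} →+ ZMod p := wordLift fun l => match l with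
  | [z] => 1
  | [x 0, x j] => if j + 1 = m then -c else 0
  | _ => 0

theorem topCoeff_Z : topCoeff.{u} p m c Z = 1 := by
  rw [show Z = word [z] by simp [word, Z]]
  exact wordLift_word _ _

theorem topCoeff_natCast_mul (a : FreeRing Cell.{u}) : topCoeff p m c (p * a) = 0 := by
  rw [← nsmul_eq_mul, map_nsmul]
  simp

theorem topCoeff_mul_natCast_mul (a b : FreeRing Cell.{u}) :
    topCoeff p m c (a * (p * b)) = 0 := by
  rw [← mul_assoc, ← (Nat.cast_commute p a).eq, mul_assoc, topCoeff_natCast_mul]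

theorem topCoeff_X_mul_X (i j : ℕ) : topCoeff.{u} p m c (X i * X j) =
    if i = 0 ∧ j + 1 = m then -(c : ZMod p) else 0 := by
  rw [show X i * X j = word [x i, x j] by simp [word, X]]
  refine (wordLift_word _ _).trans ?_
  cases i with
  | zero => simp
  | succ i => simp

theorem topCoeff_mul_mul_mul (a b e : Cell.{u}) (y : FreeRing Cell.{u}) :
    topCoeff p m c (FreeRing.of a * (FreeRing.of b * (FreeRing.of e * y))) = 0 :=
  freeRing_hom_ext (f := (topCoeff p m c).comp ((AddMonoidHom.mulLeft (FreeRing.of a)).comp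
    ((AddMonoidHom.mulLeft (FreeRing.of b)).comp (AddMonoidHom.mulLeft (FreeRing.of e)))))
    (g := 0) (fun l => by
      simp only [AddMonoidHom.comp_apply, AddMonoidHom.coe_mulLeft, ← word_cons]
      refine (wordLift_word _ _).trans ?_
      cases a with
      | z => rfl
      | x k => cases k <;> cases b <;> rfl) y

theorem topCoeff_Z_mul_mul (b : Cell.{u}) (y : FreeRing Cell.{u}) :
    topCoeff p m c (Z * (FreeRing.of b * y)) = 0 :=
  freeRing_hom_ext (f := (topCoeff p m c).comp ((AddMonoidHom.mulLeft Z).comp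
    (AddMonoidHom.mulLeft (FreeRing.of b))))
    (g := 0) (fun l => by
      simp only [AddMonoidHom.comp_apply, AddMonoidHom.coe_mulLeft, Z, ← word_cons]
      exact wordLift_word _ _) y

theorem topCoeff_mul_Z_mul (b : Cell.{u}) (y : FreeRing Cell.{u}) :
    topCoeff p m c (FreeRing.of b * (Z * y)) = 0 :=
  freeRing_hom_ext (f := (topCoeff p m c).comp ((AddMonoidHom.mulLeft (FreeRing.of b)).comp
    (AddMonoidHom.mulLeft Z)))
    (g := 0) (fun l => by
      simp only [AddMonoidHom.comp_apply, AddMonoidHom.coe_mulLeft, Z, ← word_cons]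
      refine (wordLift_word _ _).trans ?_
      cases b with
      | z => rfl
      | x k => cases k <;> cases l <;> rfl) y

/-- In d x_m the word x_0 x_{m-1} occurs once and contributes -c, cancelling the contribution of c
z. All other terms of a boundary are multiples of p or words on which the functional is zero. If m =
0 there is no word x_0 x_{m-1}, so c must vanish. -/
theorem topCoeff_freeD (hm : m = 0 → c = 0) (a : FreeRing Cell.{u}) :
    topCoeff p m c (freeD (deg n) (diff p m c) a) = 0 := by
  refine freeRing_hom_ext (f := (topCoeff p m c).comp (freeD (deg n) (diff p m c))) (g := 0)
    (fun l => ?_) a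
  simp only [AddMonoidHom.comp_apply, freeD_word, AddMonoidHom.zero_apply]
  rcases l with _ | ⟨a, _ | ⟨b, l⟩⟩
  · exact map_zero _
  · rw [wordD, wordD, mul_zero, smul_zero, add_zero, show word [] = (1 : FreeRing Cell.{u}) from rfl,
      mul_one]
    cases a with
    | z => exact map_zero _
    | x k =>
      have hp : topCoeff.{u} p m c p = 0 := by
        rw [← mul_one (p : FreeRing Cell), topCoeff_natCast_mul]
      obtain h | h := le_or_gt k m
      · rw [diff_x_le h, map_add]
        cases k with
        | zero =>
          rw [obst, hp, zero_add]
          split_ifs with h0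
          · rw [hm h0.symm, zero_smul, map_zero]
          · exact map_zero _
        | succ k =>
          rw [obst, map_sum, Finset.sum_eq_single (0, k)]
          · rw [topCoeff_X_mul_X]
            by_cases hk : k + 1 = m
            · rw [if_pos ⟨rfl, hk⟩, if_pos hk, map_zsmul, topCoeff_Z]
              simp
            · simp [hk]
          · rintro ⟨i, j⟩ hij hne
            rw [topCoeff_X_mul_X, if_neg]
            rintro ⟨hi, -⟩
            rw [Finset.HasAntidiagonal.mem_antidiagonal] at hij
            simp only at hij hi
            exact hne (Prod.ext hi (by simp only; omega))
          · intro h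
            exact absurd (Finset.HasAntidiagonal.mem_antidiagonal.mpr (zero_add k)) h
      · rw [diff_x_gt h, map_zero]
  -- For words of length at least two the Leibniz rule gives three terms, by differentiating the
  -- first letter, the second, or the rest. Each term consists of multiples of p, words of length at
  -- least three, or words of length two containing z.
  · have h1 : topCoeff p m c (diff p m c a * word (b :: l)) = 0 := by
      refine map_diff_eq_zero (p := p) ((topCoeff p m c).comp
        (AddMonoidHom.mulRight (word (b :: l)))) ?_ ?_ ?_ a
      · exact topCoeff_natCast_mul _
      · simp [word_cons, topCoeff_Z_mul_mul]
      · simp [word_cons, X, mul_assoc, topCoeff_mul_mul_mul]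
    have h2 : topCoeff p m c (FreeRing.of a * (diff p m c b * word l)) = 0 := by
      refine map_diff_eq_zero (p := p) ((topCoeff p m c).comp
        ((AddMonoidHom.mulLeft (FreeRing.of a)).comp (AddMonoidHom.mulRight (word l)))) ?_ ?_ ?_ b
      · exact topCoeff_mul_natCast_mul _ _
      · simp [topCoeff_mul_Z_mul]
      · simp [X, mul_assoc, topCoeff_mul_mul_mul]
    have h3 : topCoeff p m c (FreeRing.of a * (FreeRing.of b * wordD (deg n) (diff p m c) l)) =
        0 := by
      cases l with
      | nil => simp [wordD]
      | cons e l =>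
        rw [wordD, mul_add, mul_add, map_add, mul_smul_comm, mul_smul_comm, map_zsmul,
          topCoeff_mul_mul_mul, smul_zero, add_zero]
        refine map_diff_eq_zero (p := p) ((topCoeff p m c).comp
          ((AddMonoidHom.mulLeft (FreeRing.of a)).comp ((AddMonoidHom.mulLeft (FreeRing.of b)).comp
            (AddMonoidHom.mulRight (word l))))) ?_ ?_ ?_ e
        · change topCoeff p m c (FreeRing.of a * (FreeRing.of b * (p * word l))) = 0
          rw [← mul_assoc, topCoeff_mul_natCast_mul]
        · simp [Z, topCoeff_mul_mul_mul]
        · simp [X, mul_assoc, topCoeff_mul_mul_mul]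
    rw [wordD, wordD, mul_add, smul_add, map_add, map_add, h1, map_zsmul, h2, mul_smul_comm,
      smul_smul, map_zsmul, h3]
    simp

/-- The contracting homotopy: `x₀ xₖ w ↦ x_{k+1} w`. -/
def contraction : FreeRing Cell.{u} →+ FreeRing Cell.{u} := wordLift fun l => match l with
  | x 0 :: x k :: l => word (x (k + 1) :: l)
  | _ => 0

theorem contraction_one : contraction (1 : FreeRing Cell.{u}) = 0 := wordLift_word _ []

theorem contraction_X_zero : contraction (X.{u} 0) = 0 := by
  rw [X, ← mul_one (FreeRing.of _), ← show word [] = (1 : FreeRing Cell.{u}) from rfl, ← word_cons]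
  exact wordLift_word _ _

theorem contraction_X_zero_mul (k : ℕ) (a : FreeRing Cell.{u}) :
    contraction (X 0 * (X k * a)) = X (k + 1) * a :=
  freeRing_hom_ext (f := contraction.comp ((AddMonoidHom.mulLeft (X 0)).comp
    (AddMonoidHom.mulLeft (X k)))) (g := AddMonoidHom.mulLeft (X (k + 1))) (fun l => by
      simp only [AddMonoidHom.comp_apply, AddMonoidHom.coe_mulLeft, X, ← word_cons]
      exact wordLift_word _ _) a

theorem contraction_X_succ_mul (k : ℕ) (a : FreeRing Cell.{u}) :
    contraction (X (k + 1) * a) = 0 :=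
  freeRing_hom_ext (f := contraction.comp (AddMonoidHom.mulLeft (X (k + 1)))) (g := 0) (fun l => by
      simp only [AddMonoidHom.comp_apply, AddMonoidHom.coe_mulLeft, X, ← word_cons]
      exact wordLift_word _ _) a

theorem contraction_Z_mul (a : FreeRing Cell.{u}) : contraction (Z * a) = 0 :=
  freeRing_hom_ext (f := contraction.comp (AddMonoidHom.mulLeft Z)) (g := 0) (fun l => by
      simp only [AddMonoidHom.comp_apply, AddMonoidHom.coe_mulLeft, Z, ← word_cons]
      exact wordLift_word _ _) a

end Cell

namespace Cell

variable {p m n : ℕ} {c : ℤ}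

theorem deg_nonneg : ∀ x : Cell.{u}, 0 ≤ deg n x
  | x k => (by positivity : (0 : ℤ) ≤ 2 * k + 1)
  | z => Int.natCast_nonneg n

theorem eq_nil_of_wordDeg_le (hn : 0 < n) {l : List Cell.{u}} (hl : wordDeg (deg n) l ≤ 0) :
    l = [] := by
  cases l with
  | nil => rfl
  | cons a l =>
    rw [wordDeg_cons] at hl
    have := wordDeg_nonneg (deg_nonneg (n := n)) l
    cases a <;> rw [deg] at hl <;> omega

/-- Only the summand x_0 x_k begins with x_0. -/
theorem contraction_obst_succ_mul (k : ℕ) (a : FreeRing Cell.{u}) :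
    contraction (obst p X (k + 1) * a) = X (k + 1) * a := by
  rw [obst, Finset.sum_mul, map_sum, Finset.sum_eq_single (0, k)]
  · rw [mul_assoc, contraction_X_zero_mul]
  · rintro ⟨i, j⟩ hij hne
    rw [Finset.HasAntidiagonal.mem_antidiagonal] at hij
    cases i with
    | zero => exact absurd (congrArg (Prod.mk 0) ((zero_add j).symm.trans hij)) hne
    | succ i => rw [mul_assoc, contraction_X_succ_mul]
  · intro h
    exact absurd (Finset.HasAntidiagonal.mem_antidiagonal.mpr (zero_add k)) h

theorem natCast_mul_comm (p : ℕ) (a b : FreeRing Cell.{u}) : a * (p * b) = p * (a * b) := by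
  rw [← mul_assoc, ← (Nat.cast_commute p a).eq, mul_assoc]

theorem map_natCast_mul (f : FreeRing Cell.{u} →+ FreeRing Cell.{u}) (a : FreeRing Cell.{u}) :
    f (p * a) = p * f a := by
  rw [← nsmul_eq_mul, map_nsmul, nsmul_eq_mul]

/-- Contracting x_0 x_i x_j a gives x_{i+1} x_j a; summed over i + j = k - 1 these are all terms of
`obst p X (k + 1) * a` except the one with first index 0. For k = 0 the two terms with p cancel
instead. -/
theorem contraction_X_zero_mul_obst_mul (k : ℕ) (a : FreeRing Cell.{u}) :
    obst p X (k + 1) * a + contraction (p * (X k * a)) -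
      contraction (X 0 * (obst p X k * a)) = X 0 * (X k * a) := by
  cases k with
  | zero =>
    rw [obst, obst, natCast_mul_comm, add_sub_cancel_right]
    simp [mul_assoc]
  | succ k =>
    have h : contraction (X 0 * (obst p X.{u} (k + 1) * a)) =
        ∑ ij ∈ Finset.HasAntidiagonal.antidiagonal k, X (ij.1 + 1) * X ij.2 * a := by
      rw [obst, Finset.sum_mul, Finset.mul_sum, map_sum]
      refine Finset.sum_congr rfl fun ij _ => ?_
      rw [mul_assoc, contraction_X_zero_mul, mul_assoc]
    rw [h, map_natCast_mul, contraction_X_succ_mul, mul_zero, add_zero, obst,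
      Finset.Nat.sum_antidiagonal_succ, add_mul, Finset.sum_mul, add_sub_cancel_right, mul_assoc]

/-- The summand c z would occur here only for m = 0, and then n > 0 forces c = 0. -/
theorem diff_x_zero (hn : 0 < n) (hc : c = 0 ∨ n = 2 * m) : diff.{u} p m c (x 0) = p := by
  rw [diff_x_le m.zero_le, obst]
  split_ifs with h
  · rw [hc.resolve_right (by omega), zero_smul, add_zero]
  · rw [add_zero]

/-- `contraction` is a homotopy between the identity and a map with values in `ℤ x₀ ⊕ ℤ z`, in
degrees between `1` and `n`. -/
theorem exists_homotopy_eq (hn : 0 < n) (hnm : n ≤ 2 * m + 1) (hc : c = 0 ∨ n = 2 * m) {i : ℤ}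
    (hi0 : 0 < i) (hin : i ≤ n) {a : FreeRing Cell.{u}} (ha : a ∈ freeDeg (deg n) i) :
    ∃ k k' : ℤ, (i ≠ n → k' = 0) ∧ a - freeD (deg n) (diff p m c) (contraction a) -
      contraction (freeD (deg n) (diff p m c) a) = k • X 0 + k' • Z := by
  set d := freeD (deg.{u} n) (diff p m c)
  have dX (k : ℕ) (a : FreeRing Cell.{u}) : d (X k * a) = diff p m c (x k) * a - X k * d a :=
    freeD_X_mul k a
  refine freeDeg_induction (P := fun a => ∃ k k' : ℤ, (i ≠ n → k' = 0) ∧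
    a - d (contraction a) - contraction (d a) = k • X 0 + k' • Z) ⟨0, 0, fun _ => rfl, by simp⟩
    ?_ ?_ ?_ ha
  · rintro l rfl
    rcases l with _ | ⟨(_ | k) | _, l⟩
    · simp [wordDeg] at hi0
    · rcases l with _ | ⟨k | _, l⟩
      -- The word x_0 is the leftover: the contraction kills both it and its differential p.
      · refine ⟨1, 0, fun _ => rfl, ?_⟩
        have h1 : word [x.{u} 0] = X 0 := by simp [word, X]
        have h2 : contraction (d (X.{u} 0)) = 0 := by
          rw [freeD_X, diff_x_zero hn hc, ← mul_one (p : FreeRing Cell), map_natCast_mul, contraction_one,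
            mul_zero]
        rw [h1, h2, contraction_X_zero]
        simp
      · have h0 := wordDeg_nonneg (deg_nonneg.{u} (n := n)) l
        rw [wordDeg_cons, wordDeg_cons, deg, deg] at hin
        -- The degree 2k + 2 is at most n ≤ 2m + 1, so x_{k+1} is still a generator with the
        -- prescribed differential.
        have hk : k + 1 ≤ m := by omega
        have h1 : word (x 0 :: x k :: l) = X.{u} 0 * (X k * word l) := by
          rw [word_cons, word_cons, X, X]
        have h2 : d (X.{u} 0 * (X k * word l)) = p * (X k * word l) -
            (X 0 * (obst p X k * word l) - X 0 * (X k * d (word l))) := by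
          rw [dX, dX, diff_x_lt (by omega), diff_x_lt (by omega), obst, mul_sub]
        have h3 : word (x 0 :: x k :: l) - d (contraction (word (x 0 :: x k :: l))) -
            contraction (d (word (x 0 :: x k :: l))) =
            -((if k + 1 = m then c • Z else 0) * word l) := by
          rw [h1, contraction_X_zero_mul, h2, dX, diff_x_le hk, map_sub, map_sub,
            contraction_X_zero_mul, ← contraction_X_zero_mul_obst_mul (p := p) k, add_mul]
          abel
        rw [h3, wordDeg_cons, wordDeg_cons, deg, deg]
        split_ifs with hkm
        · obtain rfl | hc := hc
          · exact ⟨0, 0, fun _ => rfl, by simp⟩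
          -- With n = 2m the prefix x_0 x_{m-1} already has degree n, so nothing follows it, and the
          -- summand c z of d x_m is what remains.
          · obtain rfl := eq_nil_of_wordDeg_le hn (l := l) (by omega)
            refine ⟨0, -c, fun h => absurd ?_ h, ?_⟩
            · simp [wordDeg]
              omega
            · simp [word]
        · exact ⟨0, 0, fun _ => rfl, by simp⟩
      -- The prefix x_0 z already has degree n + 1, out of range.
      · have h0 := wordDeg_nonneg (deg_nonneg.{u} (n := n)) l
        rw [wordDeg_cons, wordDeg_cons, deg, deg] at hin
        omega
    · have h0 := wordDeg_nonneg (deg_nonneg.{u} (n := n)) l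
      rw [wordDeg_cons, deg] at hin
      refine ⟨0, 0, fun _ => rfl, ?_⟩
      have h1 : word (x (k + 1) :: l) = X.{u} (k + 1) * word l := by rw [word_cons, X]
      have h2 : contraction ((if k + 1 = m then c • Z.{u} else 0) * word l) = 0 := by
        split_ifs
        · rw [smul_mul_assoc, map_zsmul, contraction_Z_mul, smul_zero]
        · rw [zero_mul, map_zero]
      rw [h1, contraction_X_succ_mul, dX, diff_x_le (by omega), add_mul, map_sub, map_add, h2,
        contraction_obst_succ_mul, contraction_X_succ_mul]
      simp
    · rw [wordDeg_cons, deg] at hin ⊢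
      obtain rfl := eq_nil_of_wordDeg_le hn (l := l) (by omega)
      refine ⟨0, 1, fun h => absurd (by simp [wordDeg]) h, ?_⟩
      have h1 : word [z] = Z.{u} := by simp [word, Z]
      have h2 : contraction Z.{u} = 0 := by rw [← mul_one Z, contraction_Z_mul]
      have h3 : d Z = 0 := freeD_Z
      rw [h1, h2, h3]
      simp
  · rintro a ⟨k, k', hk', h⟩
    refine ⟨-k, -k', fun hi => by rw [hk' hi, neg_zero], ?_⟩
    rw [map_neg, map_neg, map_neg, map_neg, neg_smul, neg_smul, ← neg_add, ← h]
    abel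
  · rintro a b ⟨k, k', hk', h⟩ ⟨j, j', hj', h'⟩
    refine ⟨k + j, k' + j', fun hi => by rw [hk' hi, hj' hi, zero_add], ?_⟩
    rw [map_add, map_add, map_add, map_add, add_smul, add_smul, add_add_add_comm, ← h, ← h']
    abel

/-- For a cycle the homotopy formula reads a - d(s a) = k x_0 + k' z. Applying d gives k p = 0, so k
= 0. -/
theorem exists_freeD_eq_sub (hp : p ≠ 0) (hn : 0 < n) (hnm : n ≤ 2 * m + 1)
    (hc : c = 0 ∨ n = 2 * m) {i : ℤ} (hi0 : 0 < i) (hin : i ≤ n) {a : FreeRing Cell.{u}}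
    (ha : a ∈ freeDeg (deg n) i) (hd : freeD (deg n) (diff p m c) a = 0) :
    ∃ k : ℤ, (i ≠ n → k = 0) ∧ ∃ b, freeD (deg n) (diff p m c) b = a - k • Z := by
  obtain ⟨k, k', hk', h⟩ := exists_homotopy_eq (p := p) hn hnm hc hi0 hin ha
  rw [hd, map_zero, sub_zero] at h
  have h0 := congrArg (freeD (deg n) (diff p m c)) h
  rw [map_sub, hd, freeD_freeD (diff_mem hc) freeD_diff, map_add, map_zsmul, map_zsmul, freeD_X,
    diff_x_zero hn hc, freeD_Z, smul_zero, add_zero, sub_zero] at h0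
  have h1 := congrArg constCoeff h0
  rw [map_zero, map_zsmul, ← nsmul_one, map_nsmul, constCoeff_one] at h1
  have hk : k = 0 := by simpa [hp] using h1.symm
  refine ⟨k', hk', contraction a, ?_⟩
  rw [hk, zero_smul, zero_add] at h
  rw [← h, sub_sub_cancel]

theorem exists_freeD_eq_intCast (hn : 0 < n) (hc : c = 0 ∨ n = 2 * m) (k : ℤ) :
    (∃ b : FreeRing Cell.{u}, freeD (deg n) (diff p m c) b = k) ↔ (p : ℤ) ∣ k := by
  constructor
  · rintro ⟨b, hb⟩
    have := dvd_constCoeff_freeD (p := p) (m := m) (n := n) (c := c) b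
    rw [hb, ← zsmul_one, map_zsmul, constCoeff_one] at this
    simpa using this
  · rintro ⟨k, rfl⟩
    refine ⟨k • X 0, ?_⟩
    rw [map_zsmul, freeD_X, diff_x_zero hn hc, zsmul_eq_mul, mul_comm, Int.cast_mul,
      Int.cast_natCast]

/-- The class of z has order exactly p: d(x_0 z) = p z bounds the order from above, and `topCoeff`
bounds it from below. -/
theorem exists_freeD_eq_zsmul_Z (hn : 0 < n) (hc : c = 0 ∨ n = 2 * m) (k : ℤ) :
    (∃ b : FreeRing Cell.{u}, freeD (deg n) (diff p m c) b = k • Z) ↔ (p : ℤ) ∣ k := by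
  constructor
  · rintro ⟨b, hb⟩
    have := topCoeff_freeD (p := p) (m := m) (n := n) (c := c) (fun h => hc.resolve_right (by omega)) b
    rw [hb, map_zsmul, topCoeff_Z] at this
    rw [← ZMod.intCast_zmod_eq_zero_iff_dvd]
    simpa using this
  · rintro ⟨k, rfl⟩
    refine ⟨k • (X 0 * Z), ?_⟩
    rw [map_zsmul, freeD_X_mul, diff_x_zero hn hc, freeD_Z, mul_zero, sub_zero, ← nsmul_eq_mul,
      ← natCast_zsmul, smul_smul, mul_comm]

theorem exists_eq_intCast (hn : 0 < n) {a : FreeRing Cell.{u}} (ha : a ∈ freeDeg (deg n) 0) :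
    ∃ k : ℤ, a = k := by
  refine freeDeg_induction (P := fun a => ∃ k : ℤ, a = k) ⟨0, Int.cast_zero.symm⟩
    (fun l hl => ?_) ?_ ?_ ha
  · rw [eq_nil_of_wordDeg_le hn hl.le]
    exact ⟨1, Int.cast_one.symm⟩
  · rintro a ⟨k, rfl⟩
    exact ⟨-k, (Int.cast_neg k).symm⟩
  · rintro a b ⟨k, rfl⟩ ⟨k', rfl⟩
    exact ⟨k + k', (Int.cast_add k k').symm⟩

end Cell

/-! ### Exterior homology of the model in degrees at most n -/

section Model

variable {p m n : ℕ} {c : ℤ} (hc : c = 0 ∨ n = 2 * m)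

theorem isConnective_model : (model.{u} p m n c hc).IsConnective :=
  fun _ hi _ ha => eq_zero_of_mem_freeDeg_of_neg Cell.deg_nonneg hi ha

theorem isResolving_model : IsResolving p m (model.{u} p m n c hc) (modelX hc) :=
  ⟨Cell.X_mem, fun _ hi => (Cell.freeD_X _).trans (Cell.diff_x_lt hi)⟩

theorem model_d_modelX_self : (model.{u} p m n c hc).d (modelX hc m) =
    obst p (modelX hc) m + c • modelZ hc :=
  (Cell.freeD_X _).trans Cell.diff_x_self

/-- The model has exterior homology in degrees `≤ n`. -/
theorem exteriorUpTo_model (hp : p ≠ 0) (hn : 0 < n) (hnm : n ≤ 2 * m + 1) :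
    ExteriorUpTo p n (model.{u} p m n c hc) (modelZ hc) where
  mem := Cell.Z_mem
  d_eq := Cell.freeD_Z
  acyclic i hi h0 a ha hd := by
    obtain hi0 | hi0 := h0.lt_or_gt
    · rw [isConnective_model hc i hi0 a ha]
      exact zero_mem _
    · obtain ⟨k, hk, b, hb⟩ := Cell.exists_freeD_eq_sub hp hn hnm hc hi0 hi.le ha hd
      refine ⟨b, hb.trans ?_⟩
      rw [hk hi.ne, zero_smul]
      exact sub_zero a
  zero a ha _ := by
    obtain ⟨k, rfl⟩ := Cell.exists_eq_intCast hn ha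
    exact ⟨k, 0, (map_zero _).trans (sub_self _).symm⟩
  intCast := Cell.exists_freeD_eq_intCast hn hc
  top a ha hd := by
    obtain ⟨k, -, h⟩ := Cell.exists_freeD_eq_sub hp hn hnm hc (by omega) le_rfl ha hd
    exact ⟨k, h⟩
  zsmul := Cell.exists_freeD_eq_zsmul_Z hn hc

end Model

/-! ### Classification -/

section Classification

variable {p : ℕ}

theorem exists_exteriorLike_exterior {n : ℤ} (hn' : 0 < n) :
    ∃ g, ExteriorLike p n (exterior.{u} p n) g := by
  have hn := hn'.ne'
  have range (x : ExteriorRing.{u} p) :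
      (x : exterior.{u} p n) ∈ (exterior.{u} p n).d.range ↔ x = 0 :=
    ⟨fun ⟨_, h⟩ => h.symm, fun h => ⟨(0 : ExteriorRing.{u} p), h.symm⟩⟩
  have acyclic {i : ℤ} (h0 : i ≠ 0) (hi : i ≠ n) (x : ExteriorRing.{u} p)
      (hx : x ∈ exteriorDeg p n i) : (x : exterior.{u} p n) ∈ (exterior.{u} p n).d.range :=
    (range x).mpr (TrivSqZeroExt.ext (hx.1 h0) (hx.2 hi))
  refine ⟨(TrivSqZeroExt.inr 1 : ExteriorRing.{u} p), ⟨inr_mem_exteriorDeg p n 1, rfl,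
    fun i hi h0 x hx _ => ?_, fun (x : ExteriorRing.{u} p) (hx : x ∈ exteriorDeg p n 0) _ => ?_,
    fun k => ?_, fun (x : ExteriorRing.{u} p) (hx : x ∈ exteriorDeg p n n) _ => ?_, fun k => ?_⟩,
    fun i hi x hx _ => ?_⟩
  · exact acyclic h0 hi.ne x hx
  · obtain ⟨k, hk⟩ := exists_intCast_eq p x.fst
    refine ⟨k, (range (x - k : ExteriorRing.{u} p)).mpr (sub_eq_zero.mpr ?_)⟩
    exact TrivSqZeroExt.ext (by simp [hk]) (by simpa using hx.2 hn.symm)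
  · refine (range (k : ExteriorRing.{u} p)).trans ?_
    simpa using intCast_add_zsmul_inr_eq_zero.{u} p (a := k) (b := 0)
  · obtain ⟨k, hk⟩ := exists_intCast_eq p x.snd
    refine ⟨k, (range (x - k • (TrivSqZeroExt.inr 1 : ExteriorRing.{u} p))).mpr
      (sub_eq_zero.mpr ?_)⟩
    exact TrivSqZeroExt.ext (by simpa using hx.1 hn) (by simp [← hk])
  · refine (range (k • (TrivSqZeroExt.inr 1 : ExteriorRing.{u} p))).trans ?_
    simpa using intCast_add_zsmul_inr_eq_zero.{u} p (a := 0) (b := k)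
  · exact acyclic (by omega) hi.ne' x hx

theorem hasExteriorHomology_exterior {n : ℤ} (hn : 0 < n) :
    HasExteriorHomology p n (exterior.{u} p n) :=
  (exists_exteriorLike_exterior hn).elim fun _ h => h.hasExteriorHomology hn

/-- Since p = 0 in the exterior algebra, the zero sequence resolves to any length and no obstruction
appears. -/
theorem isResolving_zero_exterior (m : ℕ) (n : ℤ) :
    IsResolving p m (exterior.{u} p n) fun _ => 0 := by
  refine ⟨fun i => zero_mem _, fun i _ => ?_⟩
  cases i with
  | zero =>
    refine Eq.symm (a := (p : ExteriorRing.{u} p)) ?_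
    have := (intCast_add_zsmul_inr_eq_zero.{u} p (a := p) (b := 0)).mpr ⟨dvd_rfl, dvd_zero _⟩
    rw [zero_smul, add_zero, Int.cast_natCast] at this
    exact this
  | succ i => exact (Finset.sum_eq_zero fun ij _ => mul_zero _).symm

/-- The representatives of the quasi-isomorphism types with exterior homology. -/
abbrev representative (p m n : ℕ) (c : ℤ) (hc : c = 0 ∨ n = 2 * m) : DGA.{u} :=
  (model.{u} p m n c hc).truncation n

variable {m n : ℕ} {c : ℤ} (hc : c = 0 ∨ n = 2 * m) {C : DGA.{u}}

theorem exteriorLike_representative (hp : p.Prime) (hn : 0 < n) (hnm : n ≤ 2 * m + 1) :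
    ExteriorLike p n (representative.{u} p m n c hc)
      (((model.{u} p m n c hc).truncationHom n).toRingHom (modelZ hc)) :=
  (exteriorUpTo_model hc hp.ne_zero hn hnm).truncation (isConnective_model hc) (by omega)

/-- Recognition of the representatives. -/
theorem IsResolving.quasiIsomorphic_representative (hp : p.Prime) (hn : 0 < n)
    (hnm : n ≤ 2 * m + 1) (hC : HasExteriorHomology p n C) {y : ℕ → C} {g : C}
    (hy : IsResolving p m C y) (hym : C.d (y m) = obst p y m + c • g) (hg : g ∈ C.deg n)
    (hdg : C.d g = 0) (hgr : g ∉ C.d.range) :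
    QuasiIsomorphic C (representative p m n c hc) := by
  obtain ⟨g', hg'⟩ := hC.exists_exteriorLike (by omega)
  refine ExteriorLike.quasiIsomorphic_truncation (by omega) (isConnective_model hc)
    (exteriorUpTo_model hc hp.ne_zero hn hnm) (modelHom hc hy hym hg hdg) ?_
  rw [modelHom_Z]
  exact hg'.change_generator hp hg hdg hgr

theorem ExteriorLike.not_mem_range (hp : p.Prime) {n : ℤ} {g : C} (h : ExteriorLike p n C g) :
    g ∉ C.d.range := by
  rw [← one_smul ℤ g, h.zsmul]
  exact fun h => (Nat.prime_iff_prime_int.mp hp).not_isUnit (isUnit_of_dvd_one h)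

/-- A sequence one step longer than the model requires allows c = 0. Then `C` and the exterior
algebra, with its zero sequence, are both quasi-isomorphic to the same truncated model. -/
theorem IsResolving.quasiIsomorphic_exterior (hp : p.Prime) (hn : 0 < n)
    (hnm : n ≤ 2 * m + 1) (hC : HasExteriorHomology p n C) {y : ℕ → C}
    (hy : IsResolving p (m + 1) C y) : QuasiIsomorphic C (exterior p n) := by
  obtain ⟨g, hg⟩ := hC.exists_exteriorLike (by omega)
  obtain ⟨g', h⟩ := exists_exteriorLike_exterior.{u} (p := p) (n := n) (by omega)
  refine QuasiIsomorphic.trans (D := representative p m n 0 (Or.inl rfl))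
    ((hy.mono m.le_succ).quasiIsomorphic_representative _ hp hn hnm hC ?_ hg.mem hg.d_eq
      (hg.not_mem_range hp))
    (QuasiIsomorphic.symm ((isResolving_zero_exterior m n).quasiIsomorphic_representative _ hp hn
      hnm (hasExteriorHomology_exterior (by omega)) ?_ h.mem h.d_eq (h.not_mem_range hp)))
  · rw [hy.d_eq m m.lt_succ_self, zero_smul, add_zero]
  · rw [(isResolving_zero_exterior (m + 1) n).d_eq m m.lt_succ_self, zero_smul, add_zero]

/-- The obstruction itself serves as the generator: sending x_m to 0 and z to `-obst p y m`
satisfies d x_m = obst + z. Resetting the term of index `m` to 0 does not change the obstruction,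
which uses only earlier terms. -/
theorem IsResolving.quasiIsomorphic_exotic (hp : p.Prime) (hm : 0 < m)
    (hC : HasExteriorHomology p (2 * m : ℕ) C) {y : ℕ → C} (hy : IsResolving p m C y)
    (ho : obst p y m ∉ C.d.range) :
    QuasiIsomorphic C (representative p m (2 * m) 1 (Or.inr rfl)) := by
  have hlt {i : ℕ} (hi : i < m) : Function.update y m 0 i = y i := Function.update_of_ne hi.ne _ _
  have hobst {k : ℕ} (hk : k ≤ m) : obst p (Function.update y m 0) k = obst p y k :=
    obst_congr p fun i hi => hlt (hi.trans_le hk)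
  have hy' : IsResolving p m C (Function.update y m 0) := by
    refine ⟨fun i => ?_, fun i hi => by rw [hlt hi, hobst hi.le, hy.d_eq i hi]⟩
    obtain rfl | him := eq_or_ne i m
    · rw [Function.update_self]
      exact zero_mem _
    · rw [Function.update_of_ne him]
      exact hy.mem i
  refine hy'.quasiIsomorphic_representative (g := -obst p y m) _ hp (by omega) (by omega) hC ?_
    (neg_mem (obst_mem_natCast C.deg hy.mem m)) (by rw [map_neg, hy.d_obst, neg_zero]) (by rwa [neg_mem_iff])
  rw [Function.update_self, hobst le_rfl, map_zero, one_smul, add_neg_cancel]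

/-- For c = 1 the equation d x_m = obst + z makes the obstruction homologous to -z, whose class has
order p. -/
theorem model_zsmul_obst_mem_range_iff (hp : p.Prime) (hm : 0 < m) (k : ℤ) :
    k • obst p (modelX (p := p) (m := m) (n := 2 * m) (c := 1) (Or.inr rfl)) m ∈
      (model.{u} p m (2 * m) 1 (Or.inr rfl)).d.range ↔ (p : ℤ) ∣ k := by
  rw [← (exteriorUpTo_model.{u} (m := m) (n := 2 * m) (c := 1) (Or.inr rfl) hp.ne_zero (by omega)
    (by omega)).zsmul]
  have h : k • (model.{u} p m (2 * m) 1 (Or.inr rfl)).d (modelX _ m) ∈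
      (model.{u} p m (2 * m) 1 (Or.inr rfl)).d.range := zsmul_mem (AddMonoidHom.mem_range.mpr ⟨_, rfl⟩) k
  rw [model_d_modelX_self, one_smul, smul_add] at h
  constructor
  · exact fun h' => (AddSubgroup.add_mem_cancel_left _ h').mp h
  · exact fun h' => (AddSubgroup.add_mem_cancel_right _ h').mp h

theorem not_quasiIsomorphic_exterior (hm : 0 < m) (hC : HasExteriorHomology p (2 * m : ℕ) C)
    {x : ℕ → C} (hx : IsResolving p m C x) (hxm : obst p x m ∉ C.d.range) :
    ¬ QuasiIsomorphic C (exterior p (2 * m : ℕ)) :=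
  hx.not_quasiIsomorphic hm hC hxm
    (hasExteriorHomology_exterior (by omega))
    (isResolving_zero_exterior (m + 1) _)

/-- Truncation does not change which elements of degree n are boundaries, so the obstruction stays
nonzero in the truncated model. -/
theorem exotic_not_quasiIsomorphic_exterior (hp : p.Prime) (hm : 0 < m) :
    ¬ QuasiIsomorphic (representative.{u} p m (2 * m) 1 (Or.inr rfl))
      (exterior p (2 * m : ℕ)) := by
  have hX := isResolving_model.{u} (p := p) (m := m) (n := 2 * m) (c := 1) (Or.inr rfl)
  have h := exteriorLike_representative.{u} (p := p) (m := m) (n := 2 * m) (c := 1) (Or.inr rfl)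
    hp (by omega) (by omega)
  refine not_quasiIsomorphic_exterior hm (h.hasExteriorHomology (by omega))
    (hX.map (truncationHom _ _)) ?_
  rw [← map_obst]
  intro h'
  have h2 := ((isConnective_model (Or.inr rfl)).mem_range_quotient_iff
    (truncationRels_homogeneous _ _) (truncationRels_d _ _) (by positivity) rfl
    (i := (2 * m : ℕ)) le_rfl (by
      exact obst_mem_natCast (model.{u} p m (2 * m) 1 (Or.inr rfl)).deg hX.mem m)).mp h'
  rw [← one_smul ℤ (obst _ _ _), model_zsmul_obst_mem_range_iff hp hm] at h2
  exact (Nat.prime_iff_prime_int.mp hp).not_isUnit (isUnit_of_dvd_one h2)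

end Classification

/-! ### The explicit exotic dgas -/

section Explicit

variable {X : Type u}

open Classical in
/-- The coefficient of a word. -/
noncomputable def coeffWord (l : List X) : FreeRing X →+ ℤ :=
  wordLift fun l' => if l' = l then 1 else 0

theorem coeffWord_self (l : List X) : coeffWord l (word l) = 1 := by
  rw [coeffWord, wordLift_word, if_pos rfl]

theorem coeffWord_ne {l l' : List X} (h : l' ≠ l) : coeffWord l (word l') = 0 := by
  rw [coeffWord, wordLift_word, if_neg h]

/-- A map to the model that preserves the resolving sequence shows that the obstruction has order
`p`. -/
theorem dvd_of_map_obst {p m : ℕ} (hp : p.Prime) (hm : 0 < m) {C : DGA.{u}} {x : ℕ → C}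
    (f : Hom C (model p m (2 * m) 1 (Or.inr rfl)))
    (hf : ∀ i < m, f.toRingHom (x i) = modelX _ i) {k : ℤ}
    (hk : k • obst p x m ∈ C.d.range) : (p : ℤ) ∣ k := by
  rw [← model_zsmul_obst_mem_range_iff.{u} hp hm, ← obst_congr p hf, ← map_obst, ← map_zsmul]
  exact f.map_mem_range hk

theorem dvd_of_map_intCast {p m : ℕ} (hp : p.Prime) (hm : 0 < m) {C : DGA.{u}}
    (f : Hom C (model p m (2 * m) 1 (Or.inr rfl))) {k : ℤ}
    (hk : (k : C) ∈ C.d.range) : (p : ℤ) ∣ k := by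
  rw [← (exteriorUpTo_model.{u} (m := m) (n := 2 * m) (c := 1) (Or.inr rfl) hp.ne_zero (by omega)
    (by omega)).intCast, ← map_intCast f.toRingHom]
  exact f.map_mem_range hk

/-- An element of degree `i` lies in any subgroup that contains the words of degree `i`. -/
theorem mem_of_mem_freeDeg {w : X → ℤ} {i : ℤ} {S : AddSubgroup (FreeRing X)}
    (h : ∀ l, wordDeg w l = i → word l ∈ S) {a : FreeRing X} (ha : a ∈ freeDeg w i) : a ∈ S :=
  freeDeg_induction (P := (· ∈ S)) (zero_mem S) h (fun _ => neg_mem) (fun _ _ => add_mem) ha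

end Explicit

/-! #### Degree two -/

namespace OneGen

variable {p : ℕ}

/-- The generator `e` of the free ring. -/
def E : FreeRing OneGen.{u} := FreeRing.of e

theorem word_eq (l : List OneGen.{u}) : word l = E ^ l.length := by
  induction l with
  | nil => rfl
  | cons a l ih =>
    cases a
    rw [word_cons, ih, List.length_cons, pow_succ']
    rfl

theorem wordDeg_eq (l : List OneGen.{u}) : wordDeg deg l = l.length := by
  induction l with
  | nil => rfl
  | cons a l ih =>
    cases a
    rw [wordDeg_cons, ih, List.length_cons, deg]
    push_cast
    ring

theorem exists_eq_zsmul_pow {k : ℕ} {i : ℤ} (hi : i = k) {a : FreeRing OneGen.{u}}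
    (ha : a ∈ freeDeg deg i) : ∃ j : ℤ, a = j • E ^ k := by
  subst hi
  have : a ∈ AddSubgroup.zmultiples (E.{u} ^ k) := by
    refine mem_of_mem_freeDeg (fun l hl => ?_) ha
    rw [wordDeg_eq, Nat.cast_inj] at hl
    rw [word_eq, hl]
    exact AddSubgroup.mem_zmultiples _
  obtain ⟨j, hj⟩ := AddSubgroup.mem_zmultiples_iff.mp this
  exact ⟨j, hj.symm⟩

theorem freeD_E : freeD deg.{u} (diff p) E = p := freeD_of _

theorem freeD_E_mul (b : FreeRing OneGen.{u}) :
    freeD deg (diff p) (E * b) = p * b - E * freeD deg (diff p) b := by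
  rw [E, freeD_of_mul]
  simp [deg, diff, sub_eq_add_neg]

theorem freeD_E_sq : freeD deg.{u} (diff p) (E ^ 2) = 0 := by
  rw [pow_two, freeD_E_mul, freeD_E, (Nat.cast_commute p _).eq, sub_self]

theorem freeD_E_cube : freeD deg.{u} (diff p) (E ^ 3) = p * E ^ 2 := by
  rw [pow_succ', freeD_E_mul, freeD_E_sq, mul_zero, sub_zero]

/-- The image of `e` in the model. -/
def modelValue (p : ℕ) : OneGen.{u} → model.{u} p 1 (2 * 1) 1 (Or.inr rfl) :=
  fun _ => modelX _ 0

/-- The map from the free dga on `e` to the model. -/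
def toModel (p : ℕ) : Hom (freeOne.{u} p) (model p 1 (2 * 1) 1 (Or.inr rfl)) :=
  freeHom _ _ (modelValue p)
    (fun x => by
      cases x
      exact (isResolving_model _).mem 0)
    (fun x => by
      cases x
      exact ((isResolving_model _).d_eq 0 one_pos).trans
        (map_natCast (FreeRing.lift (modelValue.{u} p)) p).symm)

/-- The sequence `e, 0, 0, …`. -/
def seq (p : ℕ) : ℕ → freeOne.{u} p
  | 0 => E
  | _ + 1 => 0

theorem isResolving_seq : IsResolving p 1 (freeOne.{u} p) (seq p) := by
  refine ⟨fun i => ?_, fun i hi => ?_⟩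
  · cases i with
    | zero => exact of_mem_freeDeg e
    | succ i => exact zero_mem _
  · obtain rfl : i = 0 := by omega
    exact freeD_E

theorem obst_seq : obst p (seq.{u} p) 1 = (E * E : FreeRing OneGen.{u}) := by
  simp [obst, seq]
  rfl

theorem isConnective : (freeOne.{u} p).IsConnective :=
  fun _ hi _ ha => eq_zero_of_mem_freeDeg_of_neg (fun | e => zero_le_one) hi ha

/-- Up to degree 2 the free ring has the basis 1, e, e². Here de = p and d(e³) = p e² give the
divisible boundaries, and that there are no others is read off by mapping to the model. -/
theorem exteriorUpTo (hp : p.Prime) :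
    ExteriorUpTo p 2 (freeOne.{u} p) (obst p (seq p) 1) := by
  refine ⟨obst_mem_natCast (freeOne p).deg isResolving_seq.mem 1, isResolving_seq.d_obst,
    fun i hi h0 a ha hd => ?_, fun a ha _ => ?_, fun k => ⟨?_, ?_⟩, fun a ha _ => ?_,
    fun k => ⟨?_, ?_⟩⟩
  · obtain hi0 | hi0 := h0.lt_or_gt
    · rw [isConnective i hi0 a ha]
      exact zero_mem _
    · obtain rfl : i = 1 := by omega
      obtain ⟨j, rfl⟩ := exists_eq_zsmul_pow (k := 1) rfl ha
      have h : freeD deg.{u} (diff p) (j • E ^ 1) = 0 := hd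
      rw [pow_one, map_zsmul, freeD_E, ← nsmul_one, ← word_nil] at h
      have := congrArg (coeffWord []) h
      rw [map_zsmul, map_nsmul, coeffWord_self, map_zero] at this
      have hj : j = 0 := by simpa [hp.ne_zero] using this
      rw [hj]
      exact ⟨0, (map_zero _).trans (zero_smul ℤ (E ^ 1)).symm⟩
  · obtain ⟨j, rfl⟩ := exists_eq_zsmul_pow (k := 0) rfl ha
    refine ⟨j, 0, (map_zero _).trans (Eq.symm (sub_eq_zero.mpr ?_))⟩
    exact zsmul_one j
  · exact dvd_of_map_intCast hp one_pos (toModel p)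
  · rintro ⟨j, rfl⟩
    refine ⟨(j • E : FreeRing OneGen), ?_⟩
    refine (map_zsmul (freeD deg (diff p)) j E).trans ?_
    rw [freeD_E, zsmul_eq_mul, mul_comm (p : ℤ), Int.cast_mul, Int.cast_natCast]
    rfl
  · obtain ⟨j, rfl⟩ := exists_eq_zsmul_pow (k := 2) rfl ha
    refine ⟨j, 0, (map_zero _).trans (Eq.symm (sub_eq_zero.mpr ?_))⟩
    rw [obst_seq, ← pow_two]
    rfl
  · refine dvd_of_map_obst hp one_pos (toModel p) fun i hi => ?_
    obtain rfl : i = 0 := by omega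
    exact FreeRing.lift_of (modelValue p) e
  · rintro ⟨j, rfl⟩
    have h : j • (p * E ^ 2) = (p * j : ℤ) • (E * E : FreeRing OneGen.{u}) := by
      rw [mul_comm, mul_smul, natCast_zsmul, ← pow_two, nsmul_eq_mul]
    exact ⟨(j • E ^ 3 : FreeRing OneGen), (map_zsmul (freeD deg (diff p)) j _).trans
      ((congrArg (j • ·) freeD_E_cube).trans (h.trans (congrArg ((p * j : ℤ) • ·) obst_seq.symm)))⟩

/-- Degrees above 2 are spanned by multiples of e³, and the boundaries of degree 2 are the multiples
of d(e³) = p e². -/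
theorem span_rels : TwoSidedIdeal.span (rels.{u} p) =
    TwoSidedIdeal.span ((freeOne.{u} p).truncationRels 2) := by
  have hE (k : ℕ) : E.{u} ^ k ∈ freeDeg deg k := by
    have := word_mem deg (List.replicate k e.{u})
    rwa [wordDeg_eq, word_eq, List.length_replicate] at this
  refine le_antisymm (TwoSidedIdeal.span_le.mpr ?_) (TwoSidedIdeal.span_le.mpr ?_)
  · rintro _ (rfl | rfl)
    · exact TwoSidedIdeal.subset_span (Or.inl ⟨3, by norm_num, hE 3⟩)
    · exact TwoSidedIdeal.subset_span (Or.inr ⟨E ^ 3, hE 3, freeD_E_cube⟩)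
  · rintro a (⟨i, hi, ha⟩ | ⟨b, hb, rfl⟩)
    · obtain ⟨k, rfl⟩ : ∃ k : ℕ, i = (k + 3 : ℕ) := ⟨(i - 3).toNat, by omega⟩
      obtain ⟨j, rfl⟩ := exists_eq_zsmul_pow rfl ha
      refine zsmul_mem ?_ j
      rw [pow_add]
      exact TwoSidedIdeal.mul_mem_left _ _ _ (TwoSidedIdeal.subset_span (Or.inl rfl))
    · obtain ⟨j, rfl⟩ := exists_eq_zsmul_pow (k := 3) rfl hb
      have : (freeOne.{u} p).d (j • E ^ 3 : FreeRing OneGen) = (j • (p * E ^ 2) : FreeRing OneGen) :=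
        (map_zsmul (freeD deg (diff p)) j _).trans (congrArg (j • ·) freeD_E_cube)
      have hmem : (p * E ^ 2 : FreeRing OneGen) ∈ TwoSidedIdeal.span (rels.{u} p) :=
        TwoSidedIdeal.subset_span (Or.inr rfl)
      exact (congrArg (· ∈ TwoSidedIdeal.span (rels.{u} p)) this).mpr (zsmul_mem hmem j)

end OneGen

/-- Since the obstruction generates H_{2m} it is nonzero, which is the invariant separating the
quotient from the exterior algebra. -/
theorem quotient_exotic {p m : ℕ} (hp : p.Prime) (hm : 0 < m) {C : DGA.{u}} (hC : C.IsConnective)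
    {x : ℕ → C} (hx : IsResolving p m C x) (h : ExteriorUpTo p (2 * m : ℕ) C (obst p x m))
    {R : Set C} (hR : ∀ r ∈ R, ∃ k, r ∈ C.deg k) (hd : ∀ r ∈ R, C.d r ∈ TwoSidedIdeal.span R)
    (hspan : TwoSidedIdeal.span R = TwoSidedIdeal.span (C.truncationRels (2 * m : ℕ))) :
    HasExteriorHomology p (2 * m : ℕ) (C.quotient hR hd) ∧
      ¬ QuasiIsomorphic (C.quotient hR hd) (exterior p (2 * m : ℕ)) := by
  have h1 := h.quotient hR hd hC (by omega) hspan
  have h2 := h1.hasExteriorHomology (by omega)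
  refine ⟨h2, not_quasiIsomorphic_exterior hm h2 (hx.map (C.quotientHom hR hd)) ?_⟩
  rw [← map_obst]
  exact h1.not_mem_range hp

theorem exoticTwo_exotic {p : ℕ} (hp : p.Prime) :
    HasExteriorHomology p 2 (exoticTwo.{u} p) ∧
      ¬ QuasiIsomorphic (exoticTwo.{u} p) (exterior p 2) :=
  quotient_exotic (m := 1) hp one_pos OneGen.isConnective OneGen.isResolving_seq
    (OneGen.exteriorUpTo hp) (OneGen.rels_homogeneous p) (OneGen.rels_diff p) OneGen.span_rels

/-! #### Degree four -/

namespace TwoGen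

variable {p : ℕ}

/-- The generator `e` of the free ring. -/
def E : FreeRing TwoGen.{u} := FreeRing.of e

/-- The generator `f` of the free ring. -/
def F : FreeRing TwoGen.{u} := FreeRing.of f

theorem deg_nonneg : ∀ x : TwoGen.{u}, 0 ≤ deg x
  | e => zero_le_one
  | f => by norm_num [deg]

theorem d_E : freeD deg.{u} (diff p) E = p := freeD_e p

theorem d_F : freeD deg.{u} (diff p) F = E * E := freeD_f p

theorem d_E_mul (b : FreeRing TwoGen.{u}) :
    freeD deg (diff p) (E * b) = p * b - E * freeD deg (diff p) b := freeD_e_mul p b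

theorem d_F_mul (b : FreeRing TwoGen.{u}) :
    freeD deg (diff p) (F * b) = E * (E * b) - F * freeD deg (diff p) b := freeD_f_mul p b

theorem mul_natCast (a : FreeRing TwoGen.{u}) : a * p = p * a := (Nat.cast_commute p a).eq.symm

theorem d_E_mul_E : freeD deg.{u} (diff p) (E * E) = 0 := by
  rw [d_E_mul, d_E, mul_natCast, sub_self]

theorem d_E_cube : freeD deg.{u} (diff p) (E * (E * E)) = p * (E * E) := by
  rw [d_E_mul, d_E_mul_E, mul_zero, sub_zero]

theorem d_E_mul_F : freeD deg.{u} (diff p) (E * F) = p * F - E * (E * E) := by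
  rw [d_E_mul, d_F]

theorem d_F_mul_E : freeD deg.{u} (diff p) (F * E) = E * (E * E) - p * F := by
  rw [d_F_mul, d_E, mul_natCast]

theorem d_F_mul_E_mul_E : freeD deg.{u} (diff p) (F * (E * E)) = E * (E * (E * E)) := by
  rw [d_F_mul, d_E_mul_E, mul_zero, sub_zero]

theorem d_E_pow_four : freeD deg.{u} (diff p) (E * (E * (E * E))) = 0 := by
  rw [d_E_mul, d_E_cube, ← mul_assoc E (p : FreeRing TwoGen), mul_natCast, mul_assoc, sub_self]

/-- This is the source of the relation p(ef + fe): in efe + fe² the two copies of e⁴ and of e³ terms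
are arranged to cancel. -/
theorem d_E_mul_F_mul_E_add :
    freeD deg (diff p) (E.{u} * (F * E) + F * (E * E)) = p * (E * F + F * E) := by
  rw [map_add, d_F_mul_E_mul_E, d_E_mul, d_F_mul_E, mul_sub, ← mul_assoc E (p : FreeRing _),
    mul_natCast, mul_assoc, mul_add]
  abel

/-- The words of degree at most four. -/
theorem word_cases (l : List TwoGen.{u}) : l ∈ ([[], [e], [e, e], [f], [e, e, e], [e, f], [f, e],
    [e, e, e, e]] : List (List TwoGen.{u})) ∨ 4 < wordDeg deg l := by
  rcases l with _ | ⟨_ | _, _ | ⟨_ | _, _ | ⟨_ | _, _ | ⟨_ | _, _ | ⟨_ | _, l⟩⟩⟩⟩⟩ <;>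
    simp [wordDeg_cons, wordDeg_nil, deg]
  all_goals
    have := wordDeg_nonneg deg_nonneg l
    omega

theorem mem_of_mem_deg_le {i : ℤ} (hi : i ≤ 4) {S : AddSubgroup (FreeRing TwoGen.{u})}
    (h : ∀ l ∈ ([[], [e], [e, e], [f], [e, e, e], [e, f], [f, e], [e, e, e, e]] :
      List (List TwoGen.{u})), wordDeg deg l = i → word l ∈ S)
    {a : FreeRing TwoGen.{u}} (ha : a ∈ freeDeg deg i) : a ∈ S := by
  refine mem_of_mem_freeDeg (fun l hl => ?_) ha
  obtain h' | h' := word_cases l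
  · exact h l h' hl
  · omega

theorem exists_eq_deg_zero {a : FreeRing TwoGen.{u}} (ha : a ∈ freeDeg deg 0) :
    ∃ j : ℤ, j • 1 = a := by
  refine AddSubgroup.mem_zmultiples_iff.mp (mem_of_mem_deg_le (by norm_num) ?_ ha)
  simp [wordDeg_cons, wordDeg_nil, deg, word_nil]

theorem exists_eq_deg_one {a : FreeRing TwoGen.{u}} (ha : a ∈ freeDeg deg 1) :
    ∃ j : ℤ, j • E = a := by
  refine AddSubgroup.mem_zmultiples_iff.mp (mem_of_mem_deg_le (by norm_num) ?_ ha)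
  simp [wordDeg_cons, wordDeg_nil, deg, word_cons, word_nil, E]

theorem exists_eq_deg_two {a : FreeRing TwoGen.{u}} (ha : a ∈ freeDeg deg 2) :
    ∃ j : ℤ, j • (E * E) = a := by
  refine AddSubgroup.mem_zmultiples_iff.mp (mem_of_mem_deg_le (by norm_num) ?_ ha)
  simp [wordDeg_cons, wordDeg_nil, deg, word_cons, word_nil, E]

theorem exists_eq_deg_three {a : FreeRing TwoGen.{u}} (ha : a ∈ freeDeg deg 3) :
    ∃ j k : ℤ, j • (E * (E * E)) + k • F = a := by
  have : a ∈ AddSubgroup.closure {E.{u} * (E * E), F} := by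
    refine mem_of_mem_deg_le (by norm_num) ?_ ha
    have h1 : E * (E * E) ∈ AddSubgroup.closure {E.{u} * (E * E), F} :=
      AddSubgroup.subset_closure (by simp)
    have h2 : F ∈ AddSubgroup.closure {E.{u} * (E * E), F} :=
      AddSubgroup.subset_closure (by simp)
    simpa [wordDeg_cons, wordDeg_nil, deg, word_cons, word_nil, E, F] using And.intro h2 h1
  exact AddSubgroup.mem_closure_pair.mp this

theorem exists_eq_deg_four {a : FreeRing TwoGen.{u}} (ha : a ∈ freeDeg deg 4) :
    ∃ i j k : ℤ, i • (E * (E * (E * E))) + (j • (E * F) + k • (F * E)) = a := by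
  have : a ∈ AddSubgroup.zmultiples (E.{u} * (E * (E * E))) ⊔
      AddSubgroup.closure {E * F, F * E} := by
    refine mem_of_mem_deg_le le_rfl ?_ ha
    have h1 : E * (E * (E * E)) ∈ AddSubgroup.zmultiples (E.{u} * (E * (E * E))) ⊔
      AddSubgroup.closure {E * F, F * E} :=
      AddSubgroup.mem_sup_left (AddSubgroup.mem_zmultiples _)
    have h2 : E * F ∈ AddSubgroup.zmultiples (E.{u} * (E * (E * E))) ⊔
      AddSubgroup.closure {E * F, F * E} :=
      AddSubgroup.mem_sup_right (AddSubgroup.subset_closure (by simp))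
    have h3 : F * E ∈ AddSubgroup.zmultiples (E.{u} * (E * (E * E))) ⊔
      AddSubgroup.closure {E * F, F * E} :=
      AddSubgroup.mem_sup_right (AddSubgroup.subset_closure (by simp))
    simpa [wordDeg_cons, wordDeg_nil, deg, word_cons, word_nil, E, F] using And.intro h2 ⟨h3, h1⟩
  obtain ⟨x, hx, y, hy, rfl⟩ := AddSubgroup.mem_sup.mp this
  obtain ⟨i, rfl⟩ := AddSubgroup.mem_zmultiples_iff.mp hx
  obtain ⟨j, k, rfl⟩ := AddSubgroup.mem_closure_pair.mp hy
  exact ⟨i, j, k, rfl⟩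

/-- Every word of degree above 4 contains one of the six monomial relations, which is visible from
its first four letters. -/
theorem word_mem_span {l : List TwoGen.{u}} (hl : 4 < wordDeg deg l) :
    word l ∈ TwoSidedIdeal.span (rels.{u} p) := by
  have hs : rels.{u} p ⊆ TwoSidedIdeal.span (rels.{u} p) := TwoSidedIdeal.subset_span
  simp only [rels, Set.insert_subset_iff, Set.singleton_subset_iff, SetLike.mem_coe] at hs
  obtain ⟨r1, r2, r3, r4, r5, r6, -⟩ := hs
  change _ ∈ TwoSidedIdeal.span (rels.{u} p) at r1 r2 r3 r4 r5 r6
  set I := TwoSidedIdeal.span (rels.{u} p)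
  simp only [pow_succ, pow_zero, one_mul] at r1 r2 r4 r6
  have hr {r : FreeRing TwoGen.{u}} (h : r ∈ I) {l : List TwoGen.{u}} (y : FreeRing TwoGen.{u})
      (hl : word l = r * y) : word l ∈ I :=
    hl ▸ I.mul_mem_right _ y h
  have hl' (x : TwoGen.{u}) {l : List TwoGen.{u}} (h : word l ∈ I) : word (x :: l) ∈ I := by
    rw [word_cons]
    exact I.mul_mem_left _ _ h
  match l, hl with
  | e :: e :: e :: e :: l, _ => exact hr r1 (word l) (by simp only [word_cons, mul_assoc])
  | e :: e :: e :: f :: l, _ =>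
    exact hl' e (hr r2 (word l) (by simp only [word_cons, mul_assoc]))
  | e :: e :: f :: l, _ => exact hr r2 (word l) (by simp only [word_cons, mul_assoc])
  | e :: f :: e :: l, _ => exact hr r3 (word l) (by simp only [word_cons, mul_assoc])
  | e :: f :: f :: l, _ => exact hl' e (hr r6 (word l) (by simp only [word_cons, mul_assoc]))
  | f :: e :: e :: l, _ => exact hr r4 (word l) (by simp only [word_cons, mul_assoc])
  | f :: e :: f :: l, _ => exact hr r5 (word l) (by simp only [word_cons, mul_assoc])
  | f :: f :: l, _ => exact hr r6 (word l) (by simp only [word_cons, mul_assoc])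
  | [], hl | [e], hl | [f], hl | [e, e], hl | [e, f], hl | [f, e], hl | [e, e, e], hl =>
    simp [wordDeg_cons, wordDeg_nil, deg] at hl

theorem mul_mem_freeDeg_of_eq {i j k : ℤ} {a b : FreeRing TwoGen.{u}} (ha : a ∈ freeDeg deg i)
    (hb : b ∈ freeDeg deg j) (h : i + j = k) : a * b ∈ freeDeg deg k :=
  h ▸ mul_mem_freeDeg ha hb

theorem E_mem : E.{u} ∈ freeDeg deg 1 := of_mem_freeDeg e

theorem F_mem : F.{u} ∈ freeDeg deg 3 := of_mem_freeDeg f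

theorem span_rels : TwoSidedIdeal.span (rels.{u} p) =
    TwoSidedIdeal.span ((freeTwo.{u} p).truncationRels 4) := by
  have hEE : E.{u} * E ∈ freeDeg deg 2 := mul_mem_freeDeg_of_eq E_mem E_mem rfl
  have hFE : F.{u} * E ∈ freeDeg deg 4 := mul_mem_freeDeg_of_eq F_mem E_mem rfl
  have hFEE : F.{u} * (E * E) ∈ freeDeg deg 5 := mul_mem_freeDeg_of_eq F_mem hEE rfl
  have hEFE : E.{u} * (F * E) ∈ freeDeg deg 5 := mul_mem_freeDeg_of_eq E_mem hFE rfl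
  refine le_antisymm (TwoSidedIdeal.span_le.mpr ?_) (TwoSidedIdeal.span_le.mpr ?_)
  · have key {a : FreeRing TwoGen.{u}} {i : ℤ} (hi : 4 < i) (ha : a ∈ freeDeg deg i) :
        a ∈ TwoSidedIdeal.span ((freeTwo.{u} p).truncationRels 4) :=
      TwoSidedIdeal.subset_span (Or.inl ⟨i, hi, ha⟩)
    have key' {a b : FreeRing TwoGen.{u}} (hb : b ∈ freeDeg deg 5)
        (h : freeD deg (diff p) b = a) :
        a ∈ TwoSidedIdeal.span ((freeTwo.{u} p).truncationRels 4) :=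
      TwoSidedIdeal.subset_span (Or.inr ⟨b, hb, h⟩)
    have m2 : E.{u} ^ 2 * F ∈ freeDeg deg 5 := by
      rw [pow_two]
      exact mul_mem_freeDeg_of_eq hEE F_mem rfl
    have m3 : E.{u} * F * E ∈ freeDeg deg 5 := by rwa [mul_assoc]
    have m4 : F.{u} * E ^ 2 ∈ freeDeg deg 5 := by rwa [pow_two]
    have m5 : F.{u} * E * F ∈ freeDeg deg 7 := mul_mem_freeDeg_of_eq hFE F_mem rfl
    have m6 : F.{u} ^ 2 ∈ freeDeg deg 6 := by
      rw [pow_two]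
      exact mul_mem_freeDeg_of_eq F_mem F_mem rfl
    have d1 : freeD deg (diff p) (F.{u} * (E * E)) = E ^ 4 := by
      rw [d_F_mul_E_mul_E]
      simp only [pow_succ, pow_zero, one_mul, mul_assoc]
    rintro _ (rfl | rfl | rfl | rfl | rfl | rfl | rfl)
    · exact key' hFEE d1
    · exact key (by norm_num) m2
    · exact key (by norm_num) m3
    · exact key (by norm_num) m4
    · exact key (by norm_num) m5
    · exact key (by norm_num) m6
    · exact key' (add_mem hEFE hFEE) d_E_mul_F_mul_E_add
  · have key {a : FreeRing TwoGen.{u}} {i : ℤ} (hi : 4 < i) (ha : a ∈ freeDeg deg i) :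
        a ∈ TwoSidedIdeal.span (rels.{u} p) :=
      freeDeg_induction (P := (· ∈ TwoSidedIdeal.span (rels.{u} p))) (zero_mem _)
        (fun l hl => word_mem_span (hl.symm ▸ hi)) (fun _ => neg_mem) (fun _ _ => add_mem) ha
    rintro a (⟨i, hi, ha⟩ | ⟨b, hb, rfl⟩)
    · exact key hi ha
    -- An element of degree 5 already lies in the ideal, and the ideal is closed under the
    -- differential.
    · exact (freeTwo p).d_mem_span (rels p) (rels_homogeneous p) (rels_diff p)
        (key (by norm_num) hb)

/-- The images of `e` and `f` in the model. -/
def modelValue (p : ℕ) : TwoGen.{u} → model.{u} p 2 (2 * 2) 1 (Or.inr rfl)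
  | e => modelX _ 0
  | f => modelX _ 1

/-- The map from the free dga on `e` and `f` to the model. -/
def toModel (p : ℕ) : Hom (freeTwo.{u} p) (model p 2 (2 * 2) 1 (Or.inr rfl)) :=
  freeHom _ _ (modelValue p)
    (fun x => by
      cases x
      · exact (isResolving_model _).mem 0
      · exact (isResolving_model _).mem 1)
    (fun x => by
      cases x
      · exact ((isResolving_model _).d_eq 0 two_pos).trans
          (map_natCast (FreeRing.lift (modelValue.{u} p)) p).symm
      · refine ((isResolving_model _).d_eq 1 one_lt_two).trans ?_
        have h : FreeRing.lift (modelValue.{u} p) (FreeRing.of e) = modelX _ 0 :=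
          FreeRing.lift_of _ _
        rw [diff, map_pow, h, pow_two]
        simp [obst])

/-- The sequence `e, f, 0, 0, …`. -/
def seq (p : ℕ) : ℕ → freeTwo.{u} p
  | 0 => E
  | 1 => F
  | _ + 2 => 0

theorem obst_seq_one : obst p (seq.{u} p) 1 = (E * E : FreeRing TwoGen.{u}) := by
  simp [obst, seq]
  rfl

theorem obst_seq_two : obst p (seq.{u} p) 2 = (E * F + F * E : FreeRing TwoGen.{u}) := by
  simp [obst, seq, Finset.Nat.antidiagonal_succ]
  rfl

theorem isResolving_seq : IsResolving p 2 (freeTwo.{u} p) (seq p) := by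
  refine ⟨fun i => ?_, fun i hi => ?_⟩
  · match i with
    | 0 => exact E_mem
    | 1 => exact F_mem
    | i + 2 => exact zero_mem _
  · match i with
    | 0 => exact d_E
    | 1 => exact d_F.trans obst_seq_one.symm

theorem isConnective : (freeTwo.{u} p).IsConnective :=
  fun _ hi _ ha => eq_zero_of_mem_freeDeg_of_neg deg_nonneg hi ha

end TwoGen

/-! ### Cycles of degree at most four in the free dga on e and f -/

namespace TwoGen

variable {p : ℕ}

theorem eq_zero_of_freeD_deg_one (hp : p ≠ 0) {a : FreeRing TwoGen.{u}}
    (ha : a ∈ freeDeg deg 1) (hd : freeD deg (diff p) a = 0) : a = 0 := by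
  obtain ⟨j, rfl⟩ := exists_eq_deg_one ha
  rw [map_zsmul, d_E, ← nsmul_one, ← word_nil] at hd
  have := congrArg (coeffWord []) hd
  rw [map_zsmul, map_nsmul, coeffWord_self, map_zero] at this
  have hj : j = 0 := by simpa [hp] using this
  rw [hj, zero_smul]

theorem exists_freeD_eq_deg_two {a : FreeRing TwoGen.{u}} (ha : a ∈ freeDeg deg 2) :
    ∃ b, freeD deg (diff p) b = a := by
  obtain ⟨j, rfl⟩ := exists_eq_deg_two ha
  exact ⟨j • F, by rw [map_zsmul, d_F]⟩

/-- If j e³ + k f is a cycle, its differential (jp + k) e² vanishes, so k = -jp and the cycle is -j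
d(ef). -/
theorem exists_freeD_eq_deg_three {a : FreeRing TwoGen.{u}} (ha : a ∈ freeDeg deg 3)
    (hd : freeD deg (diff p) a = 0) : ∃ b, freeD deg (diff p) b = a := by
  obtain ⟨j, k, rfl⟩ := exists_eq_deg_three ha
  rw [map_add, map_zsmul, map_zsmul, d_E_cube, d_F, ← nsmul_eq_mul,
    show E.{u} * E = word [e, e] by simp [word, E]] at hd
  have := congrArg (coeffWord [e, e]) hd
  rw [map_add, map_zsmul, map_zsmul, map_nsmul, coeffWord_self, map_zero] at this
  have hk : k = -j * p := by
    simp only [nsmul_eq_mul, smul_eq_mul, mul_one] at this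
    linarith
  refine ⟨-j • (E * F), ?_⟩
  rw [map_zsmul, d_E_mul_F, hk, smul_sub, ← nsmul_eq_mul, ← natCast_zsmul, smul_smul, neg_smul]
  abel

/-- The coefficient of e³ in the differential forces ef and fe to occur equally often, and e⁴ is the
boundary of fe². -/
theorem exists_freeD_eq_deg_four {a : FreeRing TwoGen.{u}} (ha : a ∈ freeDeg deg 4)
    (hd : freeD deg (diff p) a = 0) :
    ∃ j : ℤ, ∃ b, freeD deg (diff p) b = a - j • (E * F + F * E) := by
  obtain ⟨i, j, k, rfl⟩ := exists_eq_deg_four ha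
  rw [map_add, map_add, map_zsmul, map_zsmul, map_zsmul, d_E_pow_four, d_E_mul_F, d_F_mul_E,
    ← nsmul_eq_mul, show E.{u} * (E * E) = word [e, e, e] by simp [word, E],
    show F.{u} = word [f] by simp [word, F]] at hd
  have := congrArg (coeffWord [e, e, e]) hd
  rw [map_add, map_add, map_zsmul, map_zsmul, map_zsmul, map_sub, map_sub, map_nsmul,
    coeffWord_self, coeffWord_ne (by simp), map_zero] at this
  have hk : k = j := by
    simp only [smul_zero, smul_eq_mul] at this
    linarith
  refine ⟨j, i • (F * (E * E)), ?_⟩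
  rw [map_zsmul, d_F_mul_E_mul_E, hk, smul_add]
  abel

theorem exteriorUpTo (hp : p.Prime) :
    ExteriorUpTo p 4 (freeTwo.{u} p) (obst p (seq p) 2) where
  mem := obst_mem_natCast (freeTwo p).deg isResolving_seq.mem 2
  d_eq := isResolving_seq.d_obst
  acyclic i hi h0 a ha hd := by
    obtain hi0 | hi0 := h0.lt_or_gt
    · rw [isConnective i hi0 a ha]
      exact zero_mem _
    · obtain rfl | rfl | rfl : i = 1 ∨ i = 2 ∨ i = 3 := by omega
      · exact ⟨0, (map_zero _).trans (eq_zero_of_freeD_deg_one hp.ne_zero ha hd).symm⟩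
      · exact exists_freeD_eq_deg_two ha
      · exact exists_freeD_eq_deg_three ha hd
  zero a ha _ := by
    obtain ⟨j, rfl⟩ := exists_eq_deg_zero ha
    exact ⟨j, 0, (map_zero _).trans (Eq.symm (sub_eq_zero.mpr (zsmul_one j)))⟩
  intCast k := by
    refine ⟨dvd_of_map_intCast hp two_pos (toModel p), ?_⟩
    rintro ⟨j, rfl⟩
    have h : freeD deg (diff p) (j • E.{u}) = (p * j : ℤ) := by
      rw [map_zsmul, d_E, zsmul_eq_mul, mul_comm (p : ℤ), Int.cast_mul, Int.cast_natCast]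
    exact ⟨(j • E : FreeRing TwoGen), h⟩
  top a ha hd := by
    obtain ⟨j, h⟩ := exists_freeD_eq_deg_four ha hd
    rw [obst_seq_two]
    exact ⟨j, h⟩
  zsmul k := by
    constructor
    · refine dvd_of_map_obst hp two_pos (toModel p) fun i hi => ?_
      match i with
      | 0 => exact FreeRing.lift_of (modelValue p) e
      | 1 => exact FreeRing.lift_of (modelValue p) f
    · rintro ⟨j, rfl⟩
      have h : freeD deg (diff p) (j • (E.{u} * (F * E) + F * (E * E))) =
          (p * j : ℤ) • (E * F + F * E) := by
        rw [map_zsmul, d_E_mul_F_mul_E_add, mul_comm, mul_smul, natCast_zsmul, nsmul_eq_mul]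
      rw [obst_seq_two]
      exact ⟨_, h⟩

end TwoGen

theorem exoticFour_exotic {p : ℕ} (hp : p.Prime) :
    HasExteriorHomology p 4 (exoticFour.{u} p) ∧
      ¬ QuasiIsomorphic (exoticFour.{u} p) (exterior p 4) :=
  quotient_exotic (m := 2) hp two_pos TwoGen.isConnective TwoGen.isResolving_seq
    (TwoGen.exteriorUpTo hp) (TwoGen.rels_homogeneous p) (TwoGen.rels_diff p) TwoGen.span_rels

end DGA

/-- Quasi-isomorphism types of dgas over `ℤ` with homology algebra `Λ_{𝔽_p}(g_n)`. -/
theorem mainTheorem6 (p : ℕ) [Fact p.Prime] :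
    (∀ n : ℕ, Odd n →
      DGA.HasExteriorHomology p n (DGA.exterior.{u} p n) ∧
      ∀ C : DGA.{u}, DGA.HasExteriorHomology p n C →
        DGA.QuasiIsomorphic C (DGA.exterior p n)) ∧
    (∀ n : ℕ, 2 ≤ n → Even n →
      DGA.HasExteriorHomology p n (DGA.exterior.{u} p n) ∧
      ∃ E : DGA.{u}, DGA.HasExteriorHomology p n E ∧
        ¬ DGA.QuasiIsomorphic E (DGA.exterior p n) ∧
        ∀ C : DGA.{u}, DGA.HasExteriorHomology p n C →
          DGA.QuasiIsomorphic C (DGA.exterior p n) ∨ DGA.QuasiIsomorphic C E) ∧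
    (DGA.HasExteriorHomology p 2 (DGA.exoticTwo.{u} p) ∧
      ¬ DGA.QuasiIsomorphic (DGA.exoticTwo.{u} p) (DGA.exterior p 2)) ∧
    (DGA.HasExteriorHomology p 4 (DGA.exoticFour.{u} p) ∧
      ¬ DGA.QuasiIsomorphic (DGA.exoticFour.{u} p) (DGA.exterior p 4)) := by
  have hp : p.Prime := Fact.out
  refine ⟨fun n hn => ⟨DGA.hasExteriorHomology_exterior (by exact_mod_cast hn.pos), fun C hC => ?_⟩,
    fun n hn2 hn => ⟨DGA.hasExteriorHomology_exterior (by omega), ?_⟩, DGA.exoticTwo_exotic hp,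
    DGA.exoticFour_exotic hp⟩
  · obtain ⟨m, rfl⟩ := hn
    obtain ⟨g, hg⟩ := hC.exists_exteriorLike (by omega)
    -- For odd n no obstruction degree 2k equals n, so the sequence can be continued one step
    -- further than in the even case.
    obtain ⟨y, hy⟩ := hg.exists_isResolving (m + 1) fun k _ => by omega
    exact hy.quasiIsomorphic_exterior hp (by omega) le_rfl hC
  · obtain ⟨m, rfl⟩ := even_iff_two_dvd.mp hn
    have hm : 0 < m := by omega
    refine ⟨DGA.representative p m (2 * m) 1 (Or.inr rfl),
      (DGA.exteriorLike_representative _ hp (by omega) (by omega)).hasExteriorHomology (by omega),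
      DGA.exotic_not_quasiIsomorphic_exterior hp hm, fun C hC => ?_⟩
    obtain ⟨g, hg⟩ := hC.exists_exteriorLike (by omega)
    obtain ⟨y, hy⟩ := hg.exists_isResolving m fun k _ => by omega
    -- The sequence exists up to the single obstruction in H_{2m}, and its vanishing decides between
    -- the two types.
    by_cases ho : DGA.obst p y m ∈ C.d.range
    · obtain ⟨y, hy⟩ := hy.exists_succ ho
      exact Or.inl (hy.quasiIsomorphic_exterior hp (by omega) (by omega) hC)
    · exact Or.inr (hy.quasiIsomorphic_exotic hp hm hC ho)
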